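/- **Setting.** Let $\mathcal X$ be a set, let $W=(W_t:t\in\mathcal X)$ be a mean-zero Gaussian process, and for every $n$ let $x_{1,n},\dots,x_{n,n}\in\mathcal X$ be design points. For $f:\mathcal X\to\mathbb R$ write $\vec f_n=(f(x_{1,n}),\dots,f(x_{n,n}))^T$. Under $P_f$ one observes $\vec Y_n\sim\mathcal N_n(\vec f_n,I)$. Given a scale $c$, the prior on $f$ is the law of $\sqrt c\,W$. Let $U_n$ be the covariance matrix of $\vec W_n$, put $\Sigma_{n,c}=I+cU_n$, let $\hat f_{n,c}$ be the posterior mean of $\vec f_n$ given $(\vec Y_n,c)$, and let $r_n(c,\eta)$ be the radius for which the ball $\{w\in\mathbb R^n:\|w-\hat f_{n,c}\|<r_n(c,\eta)\}$ has posterior probability $\eta$ given $(\vec Y_n,c)$, where $\|\cdot\|$ is the Euclidean norm. Let $e_{1,n},\dots,e_{n,n}$ be an orthonormal basis of eigenvectors of $U_n$, with eigenvalues $\lambda_{1,n},\dots,\lambda_{n,n}$, and put $f_{j,n}=\vec f_n^Te_{j,n}$. Assume that there are constants $m\ge1$ and $0<\underline\delta\le\overline\delta<\infty$ such that, for all $n$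 and $1\le j\le n$, $$\underline\delta\,\frac n{j^m}\le\lambda_{j,n}\le\overline\delta\,\frac n{j^m}.$$ Put $I_n=[\log n/n,\,n^{m-1}]$. **Credible sets.** For $0<\eta<1$ and $M>0$ consider the following sets $\hat C_{n,\eta,M}$. * *Likelihood-based empirical Bayes:* $\{f:\|\vec f_n-\hat f_{n,\hat c_n}\|<M r_n(\hat c_n,\eta)\}$, where $\hat c_n$ is any measurable minimizer over $c\in I_n$ of $\log\det\Sigma_{n,c}+\vec Y_n^T\Sigma_{n,c}^{-1}\vec Y_n$. * *Risk-based empirical Bayes:* the same set, where $\hat c_n$ is any measurable minimizer over $c\in I_n$ of $\operatorname{tr}((I-\Sigma_{n,c}^{-1})^2)-\operatorname{tr}(\Sigma_{n,c}^{-2})+\vec Y_n^T\Sigma_{n,c}^{-2}\vec Y_n$. * *Hierarchical Bayes:* $c$ has a prior density on $I_n$ proportional to $c^{-1-\kappa}e^{-\lambda/c}$, for fixed $\kappa,\lambda>0$. For fixed $0<p_1<p_2<1$ let $\hat c_{1,n}<\hat c_{2,n}$ be the $p_1$- and $p_2$-quantiles of the posterior distribution of $c$ given $\vec Y_n$. The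 set is $\bigcup_{\hat c_{1,n}<c<\hat c_{2,n}}\{f:\|\vec f_n-\hat f_{n,c}\|<M r_n(c,\eta)\}$. **Classes of functions.** For constants $L,\rho,d$ and $k_0\in\mathbb N$ let $\mathcal F_n=\mathcal F_n(L,\rho,k_0,d)$ be the set of all $f:\mathcal X\to\mathbb R$ with $\sum_{j=1}^nf_{j,n}^2\le dn$ that satisfy the discrete polished tail condition $$\sum_{j=k}^nf_{j,n}^2\le L\sum_{k\le j\le \rho k\wedge n}f_{j,n}^2\qquad\text{for all integers }k\ge k_0.$$ For $\alpha\geq0$ put $\|f\|_{n,\alpha}^2=\frac1n\sum_{j=1}^nj^{2\alpha}f_{j,n}^2$ and $\|f\|_{n,\alpha,\infty}^2=\frac1n\max_{1\le j\le n}j^{1+2\alpha}f_{j,n}^2$. **Theorem.** There is a constant $d>0$, depending only on $\underline\delta$ and $m$, such that the following hold. (i) *Coverage.* For all $L,\rho,k_0$ there is $M_0$ such that for all $M\ge M_0$, all $\eta\in(0,1)$ and, in the hierarchical case, all $0<p_1<p_2<1$, each of the three types of credible sets satisfies $$\inf_{f\in\mathcal F_n(L,\rho,k_0,d)}P_f\bigl(f\in\hat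 C_{n,\eta,M}\bigr)\to1\qquad(n\to\infty).$$ (ii) *Diameter.* Assume in addition that $m>1$. Then for all $M>0$, $\eta\in(0,1)$ and, in the hierarchical case, all $0<p_1<p_2<1$, the diameter of $\hat C_{n,\eta,M}$ relative to $\|\cdot\|_{n,0}$ is $O_{P_f}(n^{-\alpha/(1+2\alpha)})$, uniformly in $f$ with $\|f\|_{n,\alpha}\le R$ or $\|f\|_{n,\alpha,\infty}\le R$, for every $R>0$: for every $\varepsilon>0$ there is $K$ such that for all sufficiently large $n$ the supremum over these $f$ of $P_f\bigl(\operatorname{diam}\hat C_{n,\eta,M}>Kn^{-\alpha/(1+2\alpha)}\bigr)$ is at most $\varepsilon$. This holds for every $\alpha\in(0,m/2)$ for the likelihood-based and the hierarchical method, and for every $\alpha\in(0,m)$ for the risk-based method. -/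

import Mathlib

open MeasureTheory ProbabilityTheory Filter Topology
open scoped ENNReal Matrix

namespace CredibleBalls

noncomputable section

/-- `ℝⁿ` with the Euclidean norm. -/
abbrev Vec (n : ℕ) : Type := EuclideanSpace ℝ (Fin n)

/-! ### The regression model -/

/-- The vector `(f(x₁), …, f(xₙ))` of the values of a function at the design points. -/
def restr {X : Type*} {n : ℕ} (x : Fin n → X) (f : X → ℝ) : Vec n :=
  WithLp.toLp 2 (fun i => f (x i))

/-- The law `P_f` of the observation `Y = (f(x₁), …, f(xₙ)) + ε` with standard normal `ε`. -/
def dataLaw {X : Type*} {n : ℕ} (x : Fin n → X) (f : X → ℝ) : Measure (Vec n) :=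
  multivariateGaussian (restr x f) 1

/-- The Gaussian density of the observation at `y`, given the vector `w` of function values. -/
def likelihood {n : ℕ} (y w : Vec n) : ℝ≥0∞ :=
  ENNReal.ofReal ((2 * Real.pi) ^ (-(n : ℝ) / 2) * Real.exp (-‖y - w‖ ^ 2 / 2))

/-! ### The prior and the posterior given the scale -/

/-- The covariance matrix `Uₙ` of the unit scale process at the design points. -/
def unitCov {X Ω : Type*} [MeasurableSpace Ω] {n : ℕ} (P : Measure Ω) (W : X → Ω → ℝ)
    (x : Fin n → X) : Matrix (Fin n) (Fin n) ℝ :=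
  Matrix.of fun i j => covariance (W (x i)) (W (x j)) P

/-- The prior law, given the scale `c`, of the vector of function values at the design points:
the law of the values of the process `√c W`. -/
def priorLaw {X Ω : Type*} [MeasurableSpace Ω] {n : ℕ} (P : Measure Ω) (W : X → Ω → ℝ)
    (x : Fin n → X) (c : ℝ) : Measure (Vec n) :=
  P.map fun ω => restr x fun t => Real.sqrt c * W t ω

/-- The marginal density `p(y | c)` of the observation in the Bayesian model with scale `c`. -/
def marginal {X Ω : Type*} [MeasurableSpace Ω] {n : ℕ} (P : Measure Ω) (W : X → Ω → ℝ)
    (x : Fin n → X) (c : ℝ) (y : Vec n) : ℝ≥0∞ :=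
  ∫⁻ w, likelihood y w ∂(priorLaw P W x c)

/-- The posterior law of the vector of function values given `Y = y` and the scale `c`
(Bayes' formula). -/
def posterior {X Ω : Type*} [MeasurableSpace Ω] {n : ℕ} (P : Measure Ω) (W : X → Ω → ℝ)
    (x : Fin n → X) (c : ℝ) (y : Vec n) : Measure (Vec n) :=
  (marginal P W x c y)⁻¹ • (priorLaw P W x c).withDensity (likelihood y)

/-- The posterior mean `f̂_{n,c}` given the scale `c`. -/
def postMean {X Ω : Type*} [MeasurableSpace Ω] {n : ℕ} (P : Measure Ω) (W : X → Ω → ℝ)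
    (x : Fin n → X) (c : ℝ) (y : Vec n) : Vec n :=
  ∫ w, w ∂(posterior P W x c y)

/-- The radius `r_n(c,η)`: the ball of this radius around the posterior mean has posterior
probability `η`. -/
def radius {X Ω : Type*} [MeasurableSpace Ω] {n : ℕ} (P : Measure Ω) (W : X → Ω → ℝ)
    (x : Fin n → X) (c η : ℝ) (y : Vec n) : ℝ :=
  sInf {r : ℝ | 0 ≤ r ∧
    ENNReal.ofReal η ≤ posterior P W x c y (Metric.ball (postMean P W x c y) r)}

/-- The set of functions `f` with `‖(f(x₁), …, f(xₙ)) - f̂_{n,c}‖ < M r_n(c,η)`. -/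
def ballSet {X Ω : Type*} [MeasurableSpace Ω] {n : ℕ} (P : Measure Ω) (W : X → Ω → ℝ)
    (x : Fin n → X) (M η c : ℝ) (y : Vec n) : Set (X → ℝ) :=
  {f | ‖restr x f - postMean P W x c y‖ < M * radius P W x c η y}

/-! ### The empirical Bayes methods -/

/-- The interval `I_n = [log n / n, n ^ (m - 1)]` of scales. -/
def scaleInterval (m : ℝ) (n : ℕ) : Set ℝ :=
  Set.Icc (Real.log n / n) ((n : ℝ) ^ (m - 1))

/-- `Σ_{n,c} = I + c Uₙ`. -/
def sigmaMat {n : ℕ} (U : Matrix (Fin n) (Fin n) ℝ) (c : ℝ) : Matrix (Fin n) (Fin n) ℝ :=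
  1 + c • U

/-- Minus twice the marginal log likelihood: `log det Σ + yᵀ Σ⁻¹ y`, for `Σ = I + c U`. -/
def likCriterion {n : ℕ} (U : Matrix (Fin n) (Fin n) ℝ) (y : Vec n) (c : ℝ) : ℝ :=
  Real.log (sigmaMat U c).det + y.ofLp ⬝ᵥ ((sigmaMat U c)⁻¹ *ᵥ y.ofLp)

/-- The estimate of the risk of the posterior mean:
`tr((I - Σ⁻¹)²) - tr(Σ⁻²) + yᵀ Σ⁻² y`, for `Σ = I + c U`. -/
def riskCriterion {n : ℕ} (U : Matrix (Fin n) (Fin n) ℝ) (y : Vec n) (c : ℝ) : ℝ :=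
  ((1 - (sigmaMat U c)⁻¹) ^ 2).trace - (((sigmaMat U c)⁻¹) ^ 2).trace
    + y.ofLp ⬝ᵥ (((sigmaMat U c)⁻¹) ^ 2 *ᵥ y.ofLp)

/-- `chat` is an estimator that minimizes the criterion `crit y` over `I`, for every
observation `y`. -/
def IsArgminEstimator {n : ℕ} (crit : Vec n → ℝ → ℝ) (I : Set ℝ) (chat : Vec n → ℝ) : Prop :=
  Measurable chat ∧ ∀ y, chat y ∈ I ∧ IsMinOn (crit y) I (chat y)

/-! ### The hierarchical Bayes method -/

/-- The unnormalized density `c ↦ c ^ (-1-κ) exp (-l/c)` of the inverse Gamma prior. -/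
def invGammaDensity (κ l c : ℝ) : ℝ≥0∞ :=
  ENNReal.ofReal (c ^ (-1 - κ) * Real.exp (-l / c))

/-- The unnormalized posterior law of the scale `c` given `Y = y`, for the inverse Gamma prior
truncated to `I_n`. -/
def scalePosteriorAux {X Ω : Type*} [MeasurableSpace Ω] {n : ℕ} (P : Measure Ω)
    (W : X → Ω → ℝ) (x : Fin n → X) (m κ l : ℝ) (y : Vec n) : Measure ℝ :=
  (volume.restrict (scaleInterval m n)).withDensity
    fun c => marginal P W x c y * invGammaDensity κ l c

/-- The posterior law of the scale `c` given `Y = y`. -/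
def scalePosterior {X Ω : Type*} [MeasurableSpace Ω] {n : ℕ} (P : Measure Ω)
    (W : X → Ω → ℝ) (x : Fin n → X) (m κ l : ℝ) (y : Vec n) : Measure ℝ :=
  (scalePosteriorAux P W x m κ l y Set.univ)⁻¹ • scalePosteriorAux P W x m κ l y

/-- The `p`-quantile of a law on the real line. -/
def quantile (μ : Measure ℝ) (p : ℝ) : ℝ :=
  sInf {t : ℝ | ENNReal.ofReal p ≤ μ (Set.Iic t)}

/-- The hierarchical Bayes credible set: the union of the balls for the scales that lie strictly
between the `p₁`- and `p₂`-quantiles of the posterior law of the scale. -/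
def hbSet {X Ω : Type*} [MeasurableSpace Ω] {n : ℕ} (P : Measure Ω) (W : X → Ω → ℝ)
    (x : Fin n → X) (m κ l p₁ p₂ M η : ℝ) (y : Vec n) : Set (X → ℝ) :=
  {f | ∃ c : ℝ, quantile (scalePosterior P W x m κ l y) p₁ < c ∧
    c < quantile (scalePosterior P W x m κ l y) p₂ ∧ f ∈ ballSet P W x M η c y}

/-! ### Classes of functions -/

/-- The coordinate `f_{j,n}` of the vector of function values in the basis `e`
(the index `j : Fin n` stands for the number `j + 1`). -/
def coef {X : Type*} {n : ℕ} (x : Fin n → X) (e : OrthonormalBasis (Fin n) ℝ (Vec n))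
    (f : X → ℝ) (j : Fin n) : ℝ :=
  inner ℝ (e j) (restr x f)

/-- The discrete Sobolev norm `‖f‖_{n,α}`. -/
def sobolevNorm {X : Type*} {n : ℕ} (x : Fin n → X) (e : OrthonormalBasis (Fin n) ℝ (Vec n))
    (α : ℝ) (f : X → ℝ) : ℝ :=
  Real.sqrt ((1 / (n : ℝ)) * ∑ j : Fin n, ((j : ℝ) + 1) ^ (2 * α) * coef x e f j ^ 2)

/-- The discrete hyperrectangle norm `‖f‖_{n,α,∞}`. -/
def hyperNorm {X : Type*} {n : ℕ} (x : Fin n → X) (e : OrthonormalBasis (Fin n) ℝ (Vec n))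
    (α : ℝ) (f : X → ℝ) : ℝ :=
  Real.sqrt ((1 / (n : ℝ)) * ⨆ j : Fin n, ((j : ℝ) + 1) ^ (1 + 2 * α) * coef x e f j ^ 2)

/-- The discrete polished tail condition with constants `L`, `ρ` and threshold `k₀`:
`∑_{k ≤ j ≤ n} f_{j,n}² ≤ L ∑_{k ≤ j ≤ ρ k ∧ n} f_{j,n}²` for all `k ≥ k₀`. -/
def PolishedTail {X : Type*} {n : ℕ} (x : Fin n → X) (e : OrthonormalBasis (Fin n) ℝ (Vec n))
    (L ρ : ℝ) (k₀ : ℕ) (f : X → ℝ) : Prop :=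
  ∀ k : ℕ, k₀ ≤ k →
    ∑ j ∈ Finset.univ.filter (fun j : Fin n => k ≤ (j : ℕ) + 1), coef x e f j ^ 2 ≤
      L * ∑ j ∈ Finset.univ.filter (fun j : Fin n => k ≤ (j : ℕ) + 1 ∧ (j : ℝ) + 1 ≤ ρ * k),
        coef x e f j ^ 2

/-- The class of discrete polished tail functions with `∑ f_{j,n}² ≤ d n`. -/
def polishedClass {X : Type*} {n : ℕ} (x : Fin n → X) (e : OrthonormalBasis (Fin n) ℝ (Vec n))
    (L ρ : ℝ) (k₀ : ℕ) (d : ℝ) : Set (X → ℝ) :=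
  {f | PolishedTail x e L ρ k₀ f ∧ ∑ j : Fin n, coef x e f j ^ 2 ≤ d * n}

/-- The union of the discrete Sobolev ball and the discrete hyperrectangle of order `α` and
radius `R`. -/
def smoothClass {X : Type*} {n : ℕ} (x : Fin n → X) (e : OrthonormalBasis (Fin n) ℝ (Vec n))
    (α R : ℝ) : Set (X → ℝ) :=
  {f | sobolevNorm x e α f ≤ R ∨ hyperNorm x e α f ≤ R}

/-- The diameter of a set of functions relative to the scaled Euclidean norm `‖·‖_{n,0}`. -/
def scaledDiam {X : Type*} {n : ℕ} (x : Fin n → X) (e : OrthonormalBasis (Fin n) ℝ (Vec n))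
    (C : Set (X → ℝ)) : ℝ≥0∞ :=
  ⨆ g ∈ C, ⨆ h ∈ C, ENNReal.ofReal (sobolevNorm x e 0 (g - h))

/-! ### The two conclusions, for a sequence of data-dependent sets of functions -/

/-- The coverage probability tends to one, uniformly over the classes `F n`. -/
def UniformCoverage {X : Type*} (x : ∀ n : ℕ, Fin n → X) (F : ∀ _ : ℕ, Set (X → ℝ))
    (C : ∀ n : ℕ, Vec n → Set (X → ℝ)) : Prop :=
  Tendsto (fun n : ℕ => ⨅ f ∈ F n, dataLaw (x n) f {y | f ∈ C n y}) atTop (𝓝 1)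

/-- The diameter is `O_{P_f}(n ^ (-α / (1 + 2α)))`, uniformly over the balls of order `α` and
radius `R`, for every `R`. -/
def UniformDiameterRate {X : Type*} (x : ∀ n : ℕ, Fin n → X)
    (e : ∀ n : ℕ, OrthonormalBasis (Fin n) ℝ (Vec n)) (α : ℝ)
    (C : ∀ n : ℕ, Vec n → Set (X → ℝ)) : Prop :=
  ∀ R : ℝ, 0 < R → ∀ ε : ℝ, 0 < ε → ∃ K : ℝ, 0 < K ∧ ∀ᶠ n : ℕ in atTop,
    ∀ f ∈ smoothClass (x n) (e n) α R,
      dataLaw (x n) f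
        {y | ENNReal.ofReal (K * (n : ℝ) ^ (-α / (1 + 2 * α))) < scaledDiam (x n) (e n) (C n y)}
        ≤ ENNReal.ofReal ε

end

end CredibleBalls

open CredibleBalls

/-! In the eigenbasis of `Uₙ` everything is diagonal. With data `f j + z j` and gains `g j = c λ_j /
(1 + c λ_j)`, the posterior has independent normal coordinates with means `g j * (f j + z j)` and
variances `g j`. Up to a term free of `c`, each empirical Bayes criterion is a sum of a bias
`biasSum`, which decreases in `c`, a deterministic variance part `varSum`, and a centered `noise`;
the exponent `p` is 1 for the likelihood and 2 for the risk. For both exponents the variance part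
has the order of the effective dimension `N(c) = (c n)^(1/m)` (`Spectrum.varSum_le`,
`Spectrum.varSum_ge`).

The noise is small uniformly in the scale: `|noise| ≤ δ (bias + N)` for all `c ≥ log n / n`, outside
an event of probability `O((log n)^(-1/m))` that is uniform in `f` (`Spectrum.stdPi_noise_le`). This
follows from second moments on dyadic blocks of scales, whose bounds add up to a geometric series.
On the good event an empirical minimizer minimizes the expected criterion `meanCrit` up to a factor
2, so the rest is deterministic.

Coverage: if the bias at `c` exceeded a large multiple of `N(c)`, then multiplying `c` by a constant
would shrink the bias of a polished tail signal by any given factor (`exists_biasSum_mul_le`), while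
the variance part would stay `O(N(c))`. This reduces `meanCrit` too much for `c` to be a near
minimizer (`exists_meanCrit_le`). Hence the bias at the selected scale is `O(N)`, so that the
squared estimation error is `O(N)`, whereas the squared radius is at least a constant times `N`
(`EigenModel.radius_sq_bounds`).

Diameter: comparison with `oracleScale`, where bias and variance are both of order `Q =
n^(1/(1+2α))`, gives bias and effective dimension `O(Q)` at the selected scale. For `m > 1` the
squared radius is `O(N)` as well, and `√(Q/n)` is the rate.

Hierarchical Bayes: the posterior density of `c` lies between constant multiples of `exp(-E)` and
`exp(-E/4)`, with `E` the expected criterion including a term `2l/c` from the prior. Hence scales at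
which `E` exceeds a constant times its value at any given scale have posterior mass at most `1/n`
(`exists_scalePosterior_contraction`). Such a set can neither contain all scales between the two
quantiles nor carry a fixed share of the mass on either side of such a scale. -/

/-! ### Gaussian vectors in eigenbasis coordinates. -/

/-- The vector with the given coordinates in an orthonormal basis. -/
noncomputable def coordMap {n : ℕ} (e : OrthonormalBasis (Fin n) ℝ (Vec n)) (z : Fin n → ℝ) :
    Vec n := ∑ i, z i • e i

@[fun_prop]
lemma measurable_coordMap {n : ℕ} (e : OrthonormalBasis (Fin n) ℝ (Vec n)) :
    Measurable (coordMap e) := by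
  unfold coordMap; fun_prop

lemma inner_coordMap {n : ℕ} (e : OrthonormalBasis (Fin n) ℝ (Vec n)) (z : Fin n → ℝ)
    (i : Fin n) : inner ℝ (e i) (coordMap e z) = z i := by
  unfold coordMap
  simp [inner_sum, inner_smul_right, e.inner_eq_ite]

lemma coordMap_inner {n : ℕ} (e : OrthonormalBasis (Fin n) ℝ (Vec n)) (y : Vec n) :
    coordMap e (fun i => inner ℝ (e i) y) = y := e.sum_repr' y

lemma coordMap_sub {n : ℕ} (e : OrthonormalBasis (Fin n) ℝ (Vec n)) (z w : Fin n → ℝ) :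
    coordMap e z - coordMap e w = coordMap e (z - w) := by
  simp [coordMap, sub_smul]

lemma norm_coordMap_sq {n : ℕ} (e : OrthonormalBasis (Fin n) ℝ (Vec n)) (z : Fin n → ℝ) :
    ‖coordMap e z‖ ^ 2 = ∑ i, z i ^ 2 := by
  rw [← e.sum_sq_inner_right]
  simp [inner_coordMap]

/-- The standard normal law is rotation invariant, so the noise has independent standard normal
coordinates in any orthonormal basis. -/
lemma dataLaw_eq_map {X : Type*} {n : ℕ} (x : Fin n → X) (f : X → ℝ)
    (e : OrthonormalBasis (Fin n) ℝ (Vec n)) :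
    dataLaw x f = (Measure.pi fun _ : Fin n => gaussianReal 0 1).map
      (fun z => restr x f + coordMap e z) := by
  unfold dataLaw multivariateGaussian
  rw [stdGaussian_eq_map_pi_orthonormalBasis e, Measure.map_map (by fun_prop) (by fun_prop)]
  simp [Function.comp_def, coordMap]

lemma charFun_map_coordMap {n : ℕ} (e : OrthonormalBasis (Fin n) ℝ (Vec n))
    (v : Fin n → NNReal) (t : Vec n) :
    charFun ((Measure.pi fun i => gaussianReal 0 (v i)).map (coordMap e)) t =
      Complex.exp (-((∑ i, v i * inner ℝ (e i) t ^ 2 : ℝ) : ℂ) / 2) := by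
  rw [charFun_apply, integral_map (Measurable.aemeasurable (by fun_prop))
    (Measurable.aestronglyMeasurable (by fun_prop))]
  simp_rw [coordMap, sum_inner, Complex.ofReal_sum, Finset.sum_mul, Complex.exp_sum,
    integral_fintype_prod_eq_prod
      (f := fun i x ↦ Complex.exp ((inner ℝ (x • e i) t : ℝ) * Complex.I)),
    real_inner_smul_left, mul_comm _ (inner ℝ (e _) t), Complex.ofReal_mul, ← charFun_apply_real,
    charFun_gaussianReal]
  rw [← Complex.exp_sum]
  congr 1
  push_cast
  rw [neg_div, Finset.sum_div, ← Finset.sum_neg_distrib]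
  exact Finset.sum_congr rfl fun i _ => by ring

lemma IsGaussianProcess.hasGaussianLaw_comp {X Ω : Type*} [MeasurableSpace Ω] {n : ℕ}
    {P : Measure Ω} {W : X → Ω → ℝ} (hW : IsGaussianProcess W P) (x : Fin n → X) (a : ℝ) :
    HasGaussianLaw (fun ω (i : Fin n) => a * W (x i) ω) P := by
  have h := ((hW.comp_right x).smul (fun _ => a)).hasGaussianLaw Finset.univ
  let T : (↥(Finset.univ : Finset (Fin n)) → ℝ) →L[ℝ] (Fin n → ℝ) :=
    ContinuousLinearMap.pi fun i => ContinuousLinearMap.proj ⟨i, Finset.mem_univ i⟩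
  exact h.map T

lemma dotProduct_mulVec_eq_sum {n : ℕ} (U : Matrix (Fin n) (Fin n) ℝ)
    (e : OrthonormalBasis (Fin n) ℝ (Vec n)) (lam : Fin n → ℝ)
    (h : ∀ j, U *ᵥ (e j).ofLp = lam j • (e j).ofLp) (t : Vec n) :
    t.ofLp ⬝ᵥ (U *ᵥ t.ofLp) = ∑ j, lam j * inner ℝ (e j) t ^ 2 := by
  have ht : t.ofLp = ∑ j, (inner ℝ (e j) t) • (e j).ofLp := by
    conv_lhs => rw [← e.sum_repr' t]
    simp
  have hU : U *ᵥ t.ofLp = ∑ j, (lam j * inner ℝ (e j) t) • (e j).ofLp := by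
    conv_lhs => rw [ht]
    rw [Matrix.mulVec_sum]
    refine Finset.sum_congr rfl fun j _ => ?_
    rw [Matrix.mulVec_smul, h, smul_smul, mul_comm]
  rw [hU, dotProduct_sum]
  refine Finset.sum_congr rfl fun j _ => ?_
  rw [dotProduct_smul]
  have : t.ofLp ⬝ᵥ (e j).ofLp = inner ℝ (e j) t := by
    rw [EuclideanSpace.inner_eq_star_dotProduct]; simp
  rw [this, smul_eq_mul]; ring

/-- Both laws are centered Gaussian, so it is enough that their covariance forms agree in the
characteristic function; the form of the process is diagonal in `e` because `e` consists of
eigenvectors. -/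
lemma priorLaw_eq_map {X Ω : Type*} [MeasurableSpace Ω] {n : ℕ} {P : Measure Ω}
    [IsProbabilityMeasure P] {W : X → Ω → ℝ} (hW : IsGaussianProcess W P)
    (hmean : ∀ t, ∫ ω, W t ω ∂P = 0) (x : Fin n → X)
    (e : OrthonormalBasis (Fin n) ℝ (Vec n)) (lam : Fin n → ℝ)
    (h : ∀ j, unitCov P W x *ᵥ (e j).ofLp = lam j • (e j).ofLp) (hlam : ∀ j, 0 ≤ lam j)
    {c : ℝ} (hc : 0 ≤ c) :
    priorLaw P W x c =
      (Measure.pi fun i => gaussianReal 0 (c * lam i).toNNReal).map (coordMap e) := by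
  have hG := IsGaussianProcess.hasGaussianLaw_comp hW x (Real.sqrt c)
  have hG' : HasGaussianLaw (fun ω => restr x fun t => Real.sqrt c * W t ω) P := hG.toLp_pi 2
  have hg1 : IsGaussian (priorLaw P W x c) := hG'.isGaussian_map
  have : IsProbabilityMeasure (priorLaw P W x c) := hg1.toIsProbabilityMeasure
  have hmem : ∀ i, MemLp (fun ω => Real.sqrt c * W (x i) ω) 2 P := fun i => (hG.eval i).memLp_two
  have : IsProbabilityMeasure ((Measure.pi fun i => gaussianReal 0 (c * lam i).toNNReal).map
      (coordMap e)) := Measure.isProbabilityMeasure_map (by fun_prop)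
  apply Measure.ext_of_charFun
  ext t
  rw [charFun_map_coordMap, IsGaussian.charFun_eq']
  have hm : ∫ y, id y ∂(priorLaw P W x c) = 0 := by
    unfold priorLaw
    rw [integral_map hG'.aemeasurable (by fun_prop)]
    have hI : Integrable (fun ω => restr x fun t => Real.sqrt c * W t ω) P := hG'.integrable
    ext i
    have := (EuclideanSpace.proj (𝕜 := ℝ) i).integral_comp_comm hI
    simp only [id_eq]
    change EuclideanSpace.proj (𝕜 := ℝ) i _ = _
    rw [← this]
    simp [restr, integral_const_mul, hmean]
  rw [hm]
  have hcov : covarianceBilin (priorLaw P W x c) t t =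
      ∑ i, (c * lam i).toNNReal * inner ℝ (e i) t ^ 2 := by
    have h1 := covarianceBilin_apply_pi hmem t t
    change covarianceBilin (priorLaw P W x c) t t = _ at h1
    rw [h1]
    have h2 := dotProduct_mulVec_eq_sum _ e lam h t
    calc _ = c * (t.ofLp ⬝ᵥ (unitCov P W x *ᵥ t.ofLp)) := by
          simp only [dotProduct, Matrix.mulVec, Finset.mul_sum, unitCov, Matrix.of_apply]
          refine Finset.sum_congr rfl fun i _ => Finset.sum_congr rfl fun j _ => ?_
          rw [covariance_const_mul_left, covariance_const_mul_right, ← mul_assoc √c,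
            Real.mul_self_sqrt hc]
          ring
      _ = _ := by
          rw [h2, Finset.mul_sum]
          refine Finset.sum_congr rfl fun i _ => ?_
          rw [Real.coe_toNNReal _ (mul_nonneg hc (hlam i))]
          ring
  rw [hcov]
  congr 1
  simp [neg_div]

/-! ### The posterior given the scale -/

/-- On boxes the integral of the product density factorizes by independence of the coordinates, and
boxes determine a product measure. -/
lemma pi_withDensity_prod {n : ℕ} (μ ν : Fin n → Measure ℝ) [∀ i, IsProbabilityMeasure (μ i)]
    [∀ i, IsProbabilityMeasure (ν i)] (f : Fin n → ℝ → ℝ≥0∞)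
    (hf : ∀ i, Measurable (f i)) (h : ∀ i, (μ i).withDensity (f i) = ν i) :
    (Measure.pi μ).withDensity (fun z => ∏ i, f i (z i)) = Measure.pi ν := by
  refine (Measure.pi_eq fun s hs => ?_).symm
  rw [withDensity_apply _ (MeasurableSet.univ_pi hs), ← lintegral_indicator
    (MeasurableSet.univ_pi hs)]
  have h1 : (fun z : Fin n → ℝ => (Set.univ.pi s).indicator (fun z => ∏ i, f i (z i)) z) =
      fun z => ∏ i, (s i).indicator (f i) (z i) := by
    funext z
    by_cases hz : z ∈ Set.univ.pi s
    · rw [Set.indicator_of_mem hz]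
      exact Finset.prod_congr rfl fun i _ => by
        rw [Set.indicator_of_mem (hz i (Set.mem_univ i))]
    · rw [Set.indicator_of_notMem hz]
      simp only [Set.mem_univ_pi, not_forall] at hz
      obtain ⟨i, hi⟩ := hz
      rw [Finset.prod_eq_zero (Finset.mem_univ i)]
      rw [Set.indicator_of_notMem hi]
  rw [h1]
  have hind : iIndepFun (fun i (z : Fin n → ℝ) => (s i).indicator (f i) (z i))
      (Measure.pi μ) :=
    iIndepFun_pi fun i => ((hf i).indicator (hs i)).aemeasurable
  have hm : ∀ i, Measurable fun z : Fin n → ℝ => (s i).indicator (f i) (z i) :=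
    fun i => ((hf i).indicator (hs i)).comp (measurable_pi_apply i)
  rw [lintegral_prod_eq_prod_lintegral_of_indepFun Finset.univ _ hind hm]
  refine Finset.prod_congr rfl fun i _ => ?_
  have h2 := (measurePreserving_eval μ i).lintegral_comp ((hf i).indicator (hs i))
  change ∫⁻ z, (s i).indicator (f i) (z i) ∂(Measure.pi μ) = _ at h2
  rw [h2, lintegral_indicator (hs i), ← withDensity_apply _ (hs i), h]

/-- Bayes' formula in one dimension, by completing the square. The first exponential is the
normalization that turns the density into one of total mass 1. -/
lemma gaussianReal_withDensity_likelihood {v : NNReal} (hv : v ≠ 0) (y : ℝ) :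
    (gaussianReal 0 v).withDensity (fun w => ENNReal.ofReal
      (Real.exp ((Real.log (1 + v) + y ^ 2 / (1 + v)) / 2) * Real.exp (-(y - w) ^ 2 / 2))) =
      gaussianReal (v / (1 + v) * y) (v / (1 + v)) := by
  have hv' : (v / (1 + v) : NNReal) ≠ 0 := by positivity
  have hv0 : (0 : ℝ) < v := by positivity
  rw [gaussianReal_of_var_ne_zero _ hv, gaussianReal_of_var_ne_zero _ hv',
    ← withDensity_mul _ (by fun_prop) (by fun_prop)]
  congr 1
  funext w
  simp only [Pi.mul_apply, gaussianPDF]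
  rw [← ENNReal.ofReal_mul (gaussianPDFReal_nonneg _ _ _)]
  congr 1
  simp only [gaussianPDFReal_def]
  have h1 : Real.exp ((Real.log (1 + v) + y ^ 2 / (1 + v)) / 2) =
      Real.sqrt (1 + v) * Real.exp (y ^ 2 / (2 * (1 + v))) := by
    rw [add_div, Real.exp_add, ← Real.log_sqrt (by positivity), Real.exp_log (by positivity)]
    congr 2
    field_simp
  have h2 : √(2 * Real.pi * ((v / (1 + v) : NNReal) : ℝ)) =
      √(2 * Real.pi * v) / √(1 + v) := by
    rw [← Real.sqrt_div (by positivity)]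
    push_cast
    congr 1
    ring
  rw [h1, h2, inv_div]
  have h3 : √(1 + (v : ℝ)) ≠ 0 := by positivity
  have h4 : √(2 * Real.pi * (v : ℝ)) ≠ 0 := by positivity
  rw [show (√(2 * Real.pi * (v : ℝ)))⁻¹ * Real.exp (-(w - 0) ^ 2 / (2 * v)) *
      (√(1 + (v : ℝ)) * Real.exp (y ^ 2 / (2 * (1 + v))) * Real.exp (-(y - w) ^ 2 / 2)) =
      √(1 + (v : ℝ)) / √(2 * Real.pi * (v : ℝ)) * (Real.exp (-(w - 0) ^ 2 / (2 * v)) *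
      (Real.exp (y ^ 2 / (2 * (1 + v))) * Real.exp (-(y - w) ^ 2 / 2))) by ring,
    ← Real.exp_add, ← Real.exp_add]
  congr 2
  push_cast
  field_simp
  ring

/-- Minus twice the logarithm of the marginal density, up to a constant, in coordinates. -/
noncomputable def likSum {n : ℕ} (lam yc : Fin n → ℝ) (c : ℝ) : ℝ :=
  ∑ i, (Real.log (1 + c * lam i) + yc i ^ 2 / (1 + c * lam i))

/-- The posterior law of the coordinates. -/
noncomputable def postPi {n : ℕ} (lam yc : Fin n → ℝ) (c : ℝ) : Measure (Fin n → ℝ) :=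
  Measure.pi fun i => gaussianReal (c * lam i / (1 + c * lam i) * yc i)
    (c * lam i / (1 + c * lam i)).toNNReal

instance {n : ℕ} (lam yc : Fin n → ℝ) (c : ℝ) : IsProbabilityMeasure (postPi lam yc c) := by
  unfold postPi; infer_instance

/-- Each factor of the product is normalized to integrate to 1 under the prior of its coordinate, so
the constant in front is the marginal density. -/
lemma likelihood_coordMap {n : ℕ} (e : OrthonormalBasis (Fin n) ℝ (Vec n)) (y : Vec n)
    (lam : Fin n → ℝ) (c : ℝ) (z : Fin n → ℝ) :
    likelihood y (coordMap e z) = ENNReal.ofReal ((2 * Real.pi) ^ (-(n : ℝ) / 2) *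
        Real.exp (-likSum lam (fun i => inner ℝ (e i) y) c / 2)) *
      ∏ i, ENNReal.ofReal (Real.exp ((Real.log (1 + c * lam i) +
        inner ℝ (e i) y ^ 2 / (1 + c * lam i)) / 2) *
          Real.exp (-(inner ℝ (e i) y - z i) ^ 2 / 2)) := by
  rw [← ENNReal.ofReal_prod_of_nonneg (fun i _ => by positivity), ← ENNReal.ofReal_mul
    (by positivity)]
  unfold likelihood
  congr 1
  rw [mul_assoc]
  congr 1
  have h1 : ‖y - coordMap e z‖ ^ 2 = ∑ i, (inner ℝ (e i) y - z i) ^ 2 := by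
    conv_lhs => rw [← coordMap_inner e y, coordMap_sub, norm_coordMap_sq]
    rfl
  simp_rw [← Real.exp_add]
  rw [← Real.exp_sum, ← Real.exp_add, h1]
  congr 1
  unfold likSum
  rw [neg_div, neg_div, Finset.sum_div, Finset.sum_div, ← Finset.sum_neg_distrib,
    ← Finset.sum_neg_distrib, ← Finset.sum_add_distrib]
  exact Finset.sum_congr rfl fun i _ => by ring

lemma withDensity_map {α β : Type*} [MeasurableSpace α] [MeasurableSpace β] (μ : Measure α)
    {S : α → β} (hS : Measurable S) {f : β → ℝ≥0∞} (hf : Measurable f) :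
    (μ.map S).withDensity f = (μ.withDensity (f ∘ S)).map S := by
  ext s hs
  rw [withDensity_apply _ hs, setLIntegral_map hs hf hS, Measure.map_apply hS hs,
    withDensity_apply _ (hS hs)]
  rfl

lemma measurable_likelihood {n : ℕ} (y : Vec n) : Measurable (likelihood y) := by
  unfold likelihood; fun_prop

/-- `W` is a centered Gaussian process for which the covariance matrix at the design points `x`
has the eigenbasis `e` with positive eigenvalues `lam`. -/
structure EigenModel {X Ω : Type*} [MeasurableSpace Ω] {n : ℕ} (P : Measure Ω) (W : X → Ω → ℝ)
    (x : Fin n → X) (e : OrthonormalBasis (Fin n) ℝ (Vec n)) (lam : Fin n → ℝ) : Prop where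
  gaussian : IsGaussianProcess W P
  mean : ∀ t, ∫ ω, W t ω ∂P = 0
  eig : ∀ j, unitCov P W x *ᵥ (e j).ofLp = lam j • (e j).ofLp
  pos : ∀ j, 0 < lam j

namespace EigenModel

variable {X Ω : Type*} [MeasurableSpace Ω] {n : ℕ} {P : Measure Ω}
    [IsProbabilityMeasure P] {W : X → Ω → ℝ} {x : Fin n → X}
    {e : OrthonormalBasis (Fin n) ℝ (Vec n)} {lam : Fin n → ℝ} {c : ℝ}

lemma priorLaw_withDensity (hM : EigenModel P W x e lam) (hc : 0 < c) (y : Vec n) :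
    (priorLaw P W x c).withDensity (likelihood y) =
      ENNReal.ofReal ((2 * Real.pi) ^ (-(n : ℝ) / 2) *
        Real.exp (-likSum lam (fun i => inner ℝ (e i) y) c / 2)) •
      (postPi lam (fun i => inner ℝ (e i) y) c).map (coordMap e) := by
  rw [priorLaw_eq_map hM.gaussian hM.mean x e lam hM.eig (fun j => (hM.pos j).le) hc.le,
    withDensity_map _ (by fun_prop) (measurable_likelihood y), ← Measure.map_smul]
  congr 1
  simp only [Function.comp_def, likelihood_coordMap e y lam c]
  refine (withDensity_smul _ (by fun_prop)).trans ?_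
  congr 1
  refine pi_withDensity_prod _ _ (fun i w => ENNReal.ofReal (Real.exp ((Real.log (1 + c * lam i) +
        inner ℝ (e i) y ^ 2 / (1 + c * lam i)) / 2) *
          Real.exp (-(inner ℝ (e i) y - w) ^ 2 / 2))) (by fun_prop) fun i => ?_
  have hp := mul_pos hc (hM.pos i)
  have := gaussianReal_withDensity_likelihood (v := (c * lam i).toNNReal)
    (by simpa using hp) (inner ℝ (e i) y)
  rw [Real.coe_toNNReal _ hp.le] at this
  rw [this]
  congr 1
  rw [Real.toNNReal_div hp.le, Real.toNNReal_add zero_le_one hp.le, Real.toNNReal_one]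

lemma marginal_eq (hM : EigenModel P W x e lam) (hc : 0 < c) (y : Vec n) :
    marginal P W x c y = ENNReal.ofReal ((2 * Real.pi) ^ (-(n : ℝ) / 2) *
        Real.exp (-likSum lam (fun i => inner ℝ (e i) y) c / 2)) := by
  have h1 : marginal P W x c y = (priorLaw P W x c).withDensity (likelihood y) Set.univ := by
    rw [withDensity_apply _ MeasurableSet.univ, Measure.restrict_univ]; rfl
  have : IsProbabilityMeasure ((postPi lam (fun i => inner ℝ (e i) y) c).map (coordMap e)) :=
    Measure.isProbabilityMeasure_map (by fun_prop)
  rw [h1, hM.priorLaw_withDensity hc y]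
  simp

lemma posterior_eq (hM : EigenModel P W x e lam) (hc : 0 < c) (y : Vec n) :
    CredibleBalls.posterior P W x c y = (postPi lam (fun i => inner ℝ (e i) y) c).map (coordMap e) := by
  unfold CredibleBalls.posterior
  rw [hM.marginal_eq hc y, hM.priorLaw_withDensity hc y,
    smul_smul, ENNReal.inv_mul_cancel, one_smul]
  · rw [Ne, ENNReal.ofReal_eq_zero, not_le]; positivity
  · exact ENNReal.ofReal_ne_top

lemma postMean_eq (hM : EigenModel P W x e lam) (hc : 0 < c) (y : Vec n) :
    postMean P W x c y =
      coordMap e fun i => c * lam i / (1 + c * lam i) * inner ℝ (e i) y := by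
  unfold postMean
  rw [hM.posterior_eq hc y, integral_map (by fun_prop) (by fun_prop)]
  unfold coordMap postPi
  have hI : ∀ i : Fin n, Integrable (fun z : Fin n → ℝ => z i) (Measure.pi fun i =>
      gaussianReal (c * lam i / (1 + c * lam i) * inner ℝ (e i) y)
      (c * lam i / (1 + c * lam i)).toNNReal) :=
    fun i => integrable_eval IsGaussian.integrable_id
  rw [integral_finsetSum _ fun i _ => (hI i).smul_const _]
  refine Finset.sum_congr rfl fun i _ => ?_
  rw [integral_smul_const, integral_eval]
  simp

end EigenModel

/-! ### The criteria in terms of the eigenvalues -/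

section Eigenbasis

variable {n : ℕ} {e : OrthonormalBasis (Fin n) ℝ (Vec n)} {A : Matrix (Fin n) (Fin n) ℝ}
  {a : Fin n → ℝ}

/-- The orthogonal matrix with the vectors of an orthonormal basis as columns. -/
noncomputable def basisMatrix (e : OrthonormalBasis (Fin n) ℝ (Vec n)) : Matrix (Fin n) (Fin n) ℝ :=
  Matrix.of fun i j => (e j).ofLp i

lemma transpose_basisMatrix_mul (e : OrthonormalBasis (Fin n) ℝ (Vec n)) :
    (basisMatrix e)ᵀ * basisMatrix e = 1 := by
  ext i j
  have h := e.inner_eq_ite i j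
  rw [PiLp.inner_apply] at h
  rw [Matrix.mul_apply, Matrix.one_apply, ← h]
  exact Finset.sum_congr rfl fun k _ => by simp [basisMatrix, mul_comm]

lemma eq_basisMatrix_mul (h : ∀ j, A *ᵥ (e j).ofLp = a j • (e j).ofLp) :
    A = basisMatrix e * Matrix.diagonal a * (basisMatrix e)ᵀ := by
  have h1 : A * basisMatrix e = basisMatrix e * Matrix.diagonal a := by
    ext i j
    have := congrFun (h j) i
    rw [Matrix.mul_diagonal]
    simp only [Matrix.mulVec, dotProduct, Pi.smul_apply, smul_eq_mul] at this
    rw [Matrix.mul_apply]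
    simp only [basisMatrix, Matrix.of_apply]
    rw [this, mul_comm]
  rw [← h1, Matrix.mul_assoc, mul_eq_one_comm.mp (transpose_basisMatrix_mul e), Matrix.mul_one]

lemma trace_eq_sum_of_eigenbasis (h : ∀ j, A *ᵥ (e j).ofLp = a j • (e j).ofLp) :
    A.trace = ∑ j, a j := by
  rw [eq_basisMatrix_mul h, Matrix.trace_mul_comm, ← Matrix.mul_assoc,
    transpose_basisMatrix_mul, Matrix.one_mul, Matrix.trace_diagonal]

lemma det_eq_prod_of_eigenbasis (h : ∀ j, A *ᵥ (e j).ofLp = a j • (e j).ofLp) :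
    A.det = ∏ j, a j := by
  rw [eq_basisMatrix_mul h, Matrix.det_mul_comm, ← Matrix.mul_assoc,
    transpose_basisMatrix_mul, Matrix.one_mul, Matrix.det_diagonal]

lemma sigmaMat_mulVec (h : ∀ j, A *ᵥ (e j).ofLp = a j • (e j).ofLp) (c : ℝ) (j : Fin n) :
    sigmaMat A c *ᵥ (e j).ofLp = (1 + c * a j) • (e j).ofLp := by
  rw [sigmaMat, Matrix.add_mulVec, Matrix.one_mulVec, Matrix.smul_mulVec, h, smul_smul, add_smul,
    one_smul]

lemma inv_mulVec_eigenbasis (h : ∀ j, A *ᵥ (e j).ofLp = a j • (e j).ofLp) (ha : ∀ j, a j ≠ 0)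
    (j : Fin n) : A⁻¹ *ᵥ (e j).ofLp = (a j)⁻¹ • (e j).ofLp := by
  have hdet : IsUnit A.det := by
    rw [det_eq_prod_of_eigenbasis h, isUnit_iff_ne_zero, Finset.prod_ne_zero_iff]
    exact fun i _ => ha i
  have h1 : (e j).ofLp = (a j)⁻¹ • (A *ᵥ (e j).ofLp) := by
    rw [h, smul_smul, inv_mul_cancel₀ (ha j), one_smul]
  conv_lhs => rw [h1]
  rw [Matrix.mulVec_smul, Matrix.mulVec_mulVec, Matrix.nonsing_inv_mul _ hdet, Matrix.one_mulVec]

lemma sq_mulVec_eigenbasis (h : ∀ j, A *ᵥ (e j).ofLp = a j • (e j).ofLp) (j : Fin n) :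
    (A ^ 2) *ᵥ (e j).ofLp = (a j ^ 2) • (e j).ofLp := by
  rw [sq, ← Matrix.mulVec_mulVec, h, Matrix.mulVec_smul, h, smul_smul, sq]

lemma one_sub_mulVec_eigenbasis (h : ∀ j, A *ᵥ (e j).ofLp = a j • (e j).ofLp) (j : Fin n) :
    (1 - A) *ᵥ (e j).ofLp = (1 - a j) • (e j).ofLp := by
  rw [Matrix.sub_mulVec, Matrix.one_mulVec, h, sub_smul, one_smul]

lemma likCriterion_eq (h : ∀ j, A *ᵥ (e j).ofLp = a j • (e j).ofLp) {c : ℝ}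
    (ha : ∀ j, 0 < 1 + c * a j) (y : Vec n) :
    likCriterion A y c = likSum a (fun i => inner ℝ (e i) y) c := by
  have h1 := sigmaMat_mulVec h c
  unfold likCriterion likSum
  rw [det_eq_prod_of_eigenbasis h1, Real.log_prod fun i _ => (ha i).ne',
    dotProduct_mulVec_eq_sum _ e _ (inv_mulVec_eigenbasis h1 fun j => (ha j).ne') y,
    ← Finset.sum_add_distrib]
  exact Finset.sum_congr rfl fun i _ => by rw [inv_mul_eq_div]

/-- All matrices involved are functions of `A` and share its eigenvectors, so traces and quadratic
forms become sums over eigenvalues. -/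
lemma riskCriterion_eq (h : ∀ j, A *ᵥ (e j).ofLp = a j • (e j).ofLp) {c : ℝ}
    (ha : ∀ j, 0 < 1 + c * a j) (y : Vec n) :
    riskCriterion A y c = ∑ j, ((1 - (1 + c * a j)⁻¹) ^ 2 - ((1 + c * a j)⁻¹) ^ 2 +
      ((1 + c * a j)⁻¹) ^ 2 * inner ℝ (e j) y ^ 2) := by
  have h1 := inv_mulVec_eigenbasis (sigmaMat_mulVec h c) fun j => (ha j).ne'
  unfold riskCriterion
  rw [trace_eq_sum_of_eigenbasis (sq_mulVec_eigenbasis (one_sub_mulVec_eigenbasis h1)),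
    trace_eq_sum_of_eigenbasis (sq_mulVec_eigenbasis h1),
    dotProduct_mulVec_eq_sum _ e _ (sq_mulVec_eigenbasis h1) y,
    ← Finset.sum_sub_distrib, ← Finset.sum_add_distrib]

end Eigenbasis

/-! ### Second moments of sums of independent variables -/

/-- The standard normal law on `ℝⁿ`. -/
noncomputable def stdPi (n : ℕ) : Measure (Fin n → ℝ) := Measure.pi fun _ => gaussianReal 0 1

instance (n : ℕ) : IsProbabilityMeasure (stdPi n) := by unfold stdPi; infer_instance

/-- A function of a standard normal variable that has mean zero and finite variance. -/
structure IsCentered (ξ : ℝ → ℝ) : Prop where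
  memLp : MemLp ξ 2 (gaussianReal 0 1)
  integral : ∫ t, ξ t ∂(gaussianReal 0 1) = 0
  continuous : Continuous ξ

lemma isCentered_id : IsCentered fun t => t where
  memLp := memLp_id_gaussianReal' 2 (by simp)
  integral := by simp
  continuous := continuous_id

lemma isCentered_sq_sub_one : IsCentered fun t => t ^ 2 - 1 where
  memLp := by
    refine MemLp.sub ?_ (memLp_const 1)
    have h : MemLp (id : ℝ → ℝ) 4 (gaussianReal 0 1) := memLp_id_gaussianReal' 4 (by simp)
    have := h.norm_rpow_div 2
    have h2 : (4 : ℝ≥0∞) / 2 = 2 := by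
      rw [show (4 : ℝ≥0∞) = 2 * 2 by norm_num, ENNReal.mul_div_cancel_right (by simp) (by simp)]
    rw [h2] at this
    refine this.congr_norm (by fun_prop) ?_
    filter_upwards with t
    simp
  integral := by
    have hv := variance_fun_id_gaussianReal (μ := 0) (v := 1)
    rw [variance_eq_integral measurable_id'.aemeasurable] at hv
    simp only [integral_id_gaussianReal, sub_zero, NNReal.coe_one] at hv
    have hI : Integrable (fun t : ℝ => t ^ 2) (gaussianReal 0 1) :=
      (memLp_id_gaussianReal' (μ := 0) (v := 1) 2 (by simp)).integrable_sq
    rw [integral_sub hI (integrable_const _), hv]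
    simp
  continuous := by fun_prop

/-- Variances of independent summands add. The form as a lower Lebesgue integral is the one to which
Tonelli and Markov apply directly. -/
lemma lintegral_sq_sum {ξ : ℝ → ℝ} (hξ : IsCentered ξ) {n : ℕ} (a : Fin n → ℝ) :
    ∫⁻ z, ENNReal.ofReal ((∑ j, a j * ξ (z j)) ^ 2) ∂(stdPi n) =
      ENNReal.ofReal (Var[ξ; gaussianReal 0 1] * ∑ j, a j ^ 2) := by
  have hm : ∀ j : Fin n, MemLp (fun t => a j * ξ t) 2 (gaussianReal 0 1) :=
    fun j => hξ.memLp.const_mul _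
  have hv := variance_sum_pi (μ := fun _ : Fin n => gaussianReal 0 1) hm
  have hS : MemLp (∑ j, fun z : Fin n → ℝ => a j * ξ (z j)) 2 (stdPi n) :=
    memLp_finsetSum' _ fun j _ =>
      (hm j).comp_measurePreserving (measurePreserving_eval (fun _ => gaussianReal 0 1) j)
  have h0 : ∫ z, (∑ j, fun z : Fin n → ℝ => a j * ξ (z j)) z ∂(stdPi n) = 0 := by
    simp only [Finset.sum_apply]
    rw [integral_finsetSum]
    · refine Finset.sum_eq_zero fun j _ => ?_
      have := integral_comp_eval (μ := fun _ : Fin n => gaussianReal 0 1) (i := j)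
        (f := fun t => a j * ξ t) (hm j).aestronglyMeasurable
      unfold stdPi
      rw [this, integral_const_mul, hξ.integral, mul_zero]
    · intro j _
      exact ((hm j).comp_measurePreserving
        (measurePreserving_eval (fun _ => gaussianReal 0 1) j)).integrable (by simp)
  have h1 := variance_of_integral_eq_zero hS.aestronglyMeasurable.aemeasurable h0
  unfold stdPi at h1 hS ⊢
  rw [hv] at h1
  simp only [variance_const_mul] at h1
  rw [mul_comm, Finset.sum_mul, h1, ofReal_integral_eq_lintegral_ofReal hS.integrable_sq
    (Eventually.of_forall fun _ => sq_nonneg _)]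
  simp

lemma measurable_sum_comp {ξ : ℝ → ℝ} (hξ : Continuous ξ) {n : ℕ} (a : Fin n → ℝ) :
    Measurable fun z : Fin n → ℝ => ∑ j, a j * ξ (z j) := by
  have := hξ.measurable
  fun_prop

lemma meas_le_of_lintegral_sq_le {α : Type*} [MeasurableSpace α] {μ : Measure α} {Z : α → ℝ}
    (hZ : Measurable Z) {v t : ℝ} (ht : 0 < t)
    (h : ∫⁻ z, ENNReal.ofReal (Z z ^ 2) ∂μ ≤ ENNReal.ofReal v) :
    μ {z | t ≤ |Z z|} ≤ ENNReal.ofReal (v / t ^ 2) := by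
  have h1 : {z | t ≤ |Z z|} ⊆ {z | ENNReal.ofReal (t ^ 2) ≤ ENNReal.ofReal (Z z ^ 2)} := by
    intro z hz
    refine ENNReal.ofReal_le_ofReal ?_
    rw [← sq_abs (Z z)]
    exact pow_le_pow_left₀ ht.le hz 2
  refine (measure_mono h1).trans ((meas_ge_le_lintegral_div (by fun_prop) ?_
    ENNReal.ofReal_ne_top).trans ?_)
  · rw [Ne, ENNReal.ofReal_eq_zero, not_le]; positivity
  · rw [ENNReal.ofReal_div_of_pos (by positivity)]
    gcongr

lemma stdPi_sum_ge_le {ξ : ℝ → ℝ} (hξ : IsCentered ξ) {n : ℕ} (a : Fin n → ℝ) {t : ℝ}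
    (ht : 0 < t) :
    stdPi n {z | t ≤ |∑ j, a j * ξ (z j)|} ≤
      ENNReal.ofReal (Var[ξ; gaussianReal 0 1] * (∑ j, a j ^ 2) / t ^ 2) :=
  meas_le_of_lintegral_sq_le (measurable_sum_comp hξ.continuous a) ht (lintegral_sq_sum hξ a).le

/-! ### The radius of the credible balls -/

/-- The variance of the chi-squared distribution with one degree of freedom. -/
noncomputable def chiVar : ℝ := Var[fun t => t ^ 2 - 1; gaussianReal 0 1]

lemma chiVar_nonneg : 0 ≤ chiVar := variance_nonneg _ _

lemma postPi_eq_map {n : ℕ} (lam yc : Fin n → ℝ) {c : ℝ} (h : ∀ i, 0 ≤ c * lam i) :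
    postPi lam yc c = (stdPi n).map fun z i => c * lam i / (1 + c * lam i) * yc i +
      √(c * lam i / (1 + c * lam i)) * z i := by
  unfold postPi stdPi
  rw [Measure.pi_map_pi (f := fun i t => c * lam i / (1 + c * lam i) * yc i +
    √(c * lam i / (1 + c * lam i)) * t) (fun i => by fun_prop)]
  congr 1
  funext i
  rw [show (fun x => c * lam i / (1 + c * lam i) * yc i + √(c * lam i / (1 + c * lam i)) * x) =
    (c * lam i / (1 + c * lam i) * yc i + ·) ∘ (√(c * lam i / (1 + c * lam i)) * ·) from rfl,
    ← Measure.map_map (by fun_prop) (by fun_prop), gaussianReal_map_const_mul,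
    gaussianReal_map_const_add]
  have h0 : 0 ≤ c * lam i / (1 + c * lam i) := div_nonneg (h i) (by linarith [h i])
  congr 1
  · simp
  · ext
    simp only [NNReal.coe_mk, mul_one, Real.sq_sqrt h0,
      Real.coe_toNNReal _ h0]

lemma sum_gain_sq_le_sum {n : ℕ} {lam : Fin n → ℝ} (hlam : ∀ j, 0 < lam j) {c : ℝ} (hc : 0 < c) :
    ∑ i, (c * lam i / (1 + c * lam i)) ^ 2 ≤ ∑ i, c * lam i / (1 + c * lam i) := by
  refine Finset.sum_le_sum fun i _ => ?_
  have h0 := mul_pos hc (hlam i)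
  have h1 : c * lam i / (1 + c * lam i) ≤ 1 := by rw [div_le_one (by linarith)]; linarith
  have h2 : 0 ≤ c * lam i / (1 + c * lam i) := by positivity
  nlinarith

namespace EigenModel

variable {X Ω : Type*} [MeasurableSpace Ω] {n : ℕ} {P : Measure Ω}
    [IsProbabilityMeasure P] {W : X → Ω → ℝ} {x : Fin n → X}
    {e : OrthonormalBasis (Fin n) ℝ (Vec n)} {lam : Fin n → ℝ} {c : ℝ}

lemma posterior_ball (hM : EigenModel P W x e lam) (hc : 0 < c) (y : Vec n) {r : ℝ}
    (hr : 0 ≤ r) :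
    CredibleBalls.posterior P W x c y (Metric.ball (postMean P W x c y) r) =
      stdPi n {z | ∑ i, c * lam i / (1 + c * lam i) * z i ^ 2 < r ^ 2} := by
  have h0 : ∀ i, 0 ≤ c * lam i := fun i => (mul_pos hc (hM.pos i)).le
  rw [hM.posterior_eq hc, hM.postMean_eq hc, postPi_eq_map _ _ h0,
    Measure.map_map (by fun_prop) (by fun_prop),
    Measure.map_apply (by fun_prop) measurableSet_ball]
  congr 1
  ext z
  simp only [Set.mem_preimage, Function.comp_apply, Metric.mem_ball, Set.mem_ofPred_eq,
    dist_eq_norm]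
  rw [coordMap_sub, ← sq_lt_sq₀ (norm_nonneg _) hr, norm_coordMap_sq]
  have : ∀ i, ((fun i => c * lam i / (1 + c * lam i) * inner ℝ (e i) y +
      √(c * lam i / (1 + c * lam i)) * z i) - fun i => c * lam i / (1 + c * lam i) *
        inner ℝ (e i) y) i ^ 2 = c * lam i / (1 + c * lam i) * z i ^ 2 := by
    intro i
    simp only [Pi.sub_apply, add_sub_cancel_left, mul_pow]
    rw [Real.sq_sqrt (div_nonneg (h0 i) (by linarith [h0 i]))]
  simp only [this]

/-- If the effective dimension is large, then the squared radius of the credible ball is of the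
order of the trace of the posterior covariance matrix. -/
lemma radius_sq_bounds (hM : EigenModel P W x e lam) (hc : 0 < c) (y : Vec n) {η S : ℝ}
    (hS : 0 < S) (hSs : S = ∑ i, c * lam i / (1 + c * lam i)) (h1 : 4 * chiVar / S < η)
    (h2 : 4 * chiVar / S < 1 - η) :
    0 ≤ radius P W x c η y ∧ S / 2 ≤ radius P W x c η y ^ 2 ∧
      radius P W x c η y ^ 2 ≤ 2 * S := by
  -- Chebyshev for the quadratic form around its mean `S`: its variance is `chiVar * ∑ g ^ 2 ≤
  -- chiVar * S`, as the gains are at most 1.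
  have hcheb : stdPi n {z | S / 2 ≤ |∑ j, c * lam j / (1 + c * lam j) * (z j ^ 2 - 1)|} ≤
      ENNReal.ofReal (4 * chiVar / S) := by
    refine (stdPi_sum_ge_le isCentered_sq_sub_one _ (half_pos hS)).trans
      (ENNReal.ofReal_le_ofReal ?_)
    have := sum_gain_sq_le_sum hM.pos hc
    rw [← hSs] at this
    change chiVar * _ / _ ≤ _
    rw [div_le_div_iff₀ (by positivity) hS]
    nlinarith [mul_le_mul_of_nonneg_left this (mul_nonneg chiVar_nonneg hS.le)]
  have hsum : ∀ z : Fin n → ℝ, ∑ j, c * lam j / (1 + c * lam j) * (z j ^ 2 - 1) =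
      ∑ j, c * lam j / (1 + c * lam j) * z j ^ 2 - S := by
    intro z
    rw [hSs, ← Finset.sum_sub_distrib]
    exact Finset.sum_congr rfl fun j _ => by ring
  simp only [hsum] at hcheb
  have hη : 0 < η := lt_of_le_of_lt (by have := chiVar_nonneg; positivity) h1
  set A := {r : ℝ | 0 ≤ r ∧ ENNReal.ofReal η ≤
    CredibleBalls.posterior P W x c y (Metric.ball (postMean P W x c y) r)} with hA
  -- A radius below `√(S / 2)` forces the quadratic form to deviate by `S / 2`, which has
  -- probability less than `η`.
  have hlow : ∀ r ∈ A, √(S / 2) ≤ r := by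
    rintro r ⟨hr0, hr⟩
    by_contra hlt
    rw [not_le, Real.lt_sqrt hr0] at hlt
    rw [hM.posterior_ball hc y hr0] at hr
    have : ENNReal.ofReal η ≤ ENNReal.ofReal (4 * chiVar / S) := by
      refine hr.trans ((measure_mono fun z hz => ?_).trans hcheb)
      simp only [Set.mem_ofPred_eq] at hz ⊢
      rw [abs_sub_comm]
      refine le_trans ?_ (le_abs_self _)
      linarith
    rw [ENNReal.ofReal_le_ofReal_iff (by have := chiVar_nonneg; positivity)] at this
    linarith
  -- Staying outside the ball of radius `√(2 * S)` is a deviation by `S`, of probability less than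
  -- `1 - η`.
  have hmem : √(2 * S) ∈ A := by
    refine ⟨Real.sqrt_nonneg _, ?_⟩
    rw [hM.posterior_ball hc y (Real.sqrt_nonneg _), Real.sq_sqrt (by positivity)]
    set B := {z : Fin n → ℝ | ∑ i, c * lam i / (1 + c * lam i) * z i ^ 2 < 2 * S}
    have hBm : MeasurableSet B := measurableSet_lt (by fun_prop) measurable_const
    have hBc : stdPi n Bᶜ ≤ ENNReal.ofReal (4 * chiVar / S) := by
      refine (measure_mono fun z hz => ?_).trans hcheb
      simp only [B, Set.mem_compl_iff, Set.mem_ofPred_eq, not_lt] at hz ⊢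
      refine le_trans ?_ (le_abs_self _)
      linarith
    rw [← compl_compl B, prob_compl_eq_one_sub hBm.compl]
    refine ENNReal.le_sub_of_add_le_right (measure_ne_top _ _) ?_
    calc ENNReal.ofReal η + stdPi n Bᶜ ≤ ENNReal.ofReal η + ENNReal.ofReal (4 * chiVar / S) := by
          gcongr
      _ = ENNReal.ofReal (η + 4 * chiVar / S) := by
          rw [ENNReal.ofReal_add hη.le (by have := chiVar_nonneg; positivity)]
      _ ≤ 1 := by rw [← ENNReal.ofReal_one]; exact ENNReal.ofReal_le_ofReal (by linarith)
  have hrad : radius P W x c η y = sInf A := rfl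
  have hl : √(S / 2) ≤ radius P W x c η y := by rw [hrad]; exact le_csInf ⟨_, hmem⟩ hlow
  have hu : radius P W x c η y ≤ √(2 * S) := by rw [hrad]; exact csInf_le ⟨_, hlow⟩ hmem
  refine ⟨(Real.sqrt_nonneg _).trans hl, ?_, ?_⟩
  · rw [← Real.sqrt_le_left ((Real.sqrt_nonneg _).trans hl)]; exact hl
  · rw [← Real.le_sqrt ((Real.sqrt_nonneg _).trans hl) (by positivity)]; exact hu

end EigenModel

/-! ### A maximal inequality for smooth random functions -/

/-- Cauchy–Schwarz, read off from the nonnegativity of the integrated squared deviation of `f` from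
its mean. -/
lemma sq_intervalIntegral_le {a b : ℝ} (hab : a ≤ b) {f : ℝ → ℝ} (hf : ContinuousOn f (Set.Icc a b)) :
    (∫ s in a..b, f s) ^ 2 ≤ (b - a) * ∫ s in a..b, f s ^ 2 := by
  rcases hab.eq_or_lt with rfl | hlt
  · simp
  have hi : IntervalIntegrable f volume a b := hf.intervalIntegrable_of_Icc hab
  have hi2 : IntervalIntegrable (fun s => f s ^ 2) volume a b :=
    (hf.pow 2).intervalIntegrable_of_Icc hab
  set I := ∫ s in a..b, f s with hI
  have h0 : 0 ≤ ∫ s in a..b, (f s - I / (b - a)) ^ 2 :=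
    intervalIntegral.integral_nonneg hab fun s _ => sq_nonneg _
  have h1 : ∫ s in a..b, (f s - I / (b - a)) ^ 2 =
      (∫ s in a..b, f s ^ 2) - I ^ 2 / (b - a) := by
    have : ∀ s, (f s - I / (b - a)) ^ 2 =
        f s ^ 2 - 2 * (I / (b - a)) * f s + (I / (b - a)) ^ 2 := fun s => by ring
    simp only [this]
    rw [intervalIntegral.integral_add (hi2.sub (hi.const_mul _)) (by simp),
      intervalIntegral.integral_sub hi2 (hi.const_mul _), intervalIntegral.integral_const_mul,
      intervalIntegral.integral_const, smul_eq_mul, ← hI]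
    have : b - a ≠ 0 := by linarith
    field_simp
    ring
  rw [h1, sub_nonneg, div_le_iff₀ (by linarith)] at h0
  linarith

lemma sq_le_of_hasDerivAt {a b : ℝ} {F F' : ℝ → ℝ}
    (hF : ∀ s ∈ Set.Icc a b, HasDerivAt F (F' s) s) (hF' : ContinuousOn F' (Set.Icc a b)) {c : ℝ}
    (hc : c ∈ Set.Icc a b) :
    F c ^ 2 ≤ 2 * F a ^ 2 + 2 * ((b - a) * ∫ s in a..b, F' s ^ 2) := by
  have hsub : Set.Icc a c ⊆ Set.Icc a b := Set.Icc_subset_Icc_right hc.2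
  have h1 : ∫ s in a..c, F' s = F c - F a := by
    refine intervalIntegral.integral_eq_sub_of_hasDerivAt (fun s hs => hF s ?_)
      ((hF'.mono hsub).intervalIntegrable_of_Icc hc.1)
    rw [Set.uIcc_of_le hc.1] at hs
    exact hsub hs
  have h2 := sq_intervalIntegral_le hc.1 (hF'.mono hsub)
  rw [h1] at h2
  have hi2 : IntervalIntegrable (fun s => F' s ^ 2) volume a b :=
    (hF'.pow 2).intervalIntegrable_of_Icc (hc.1.trans hc.2)
  have h3 : ∫ s in a..c, F' s ^ 2 ≤ ∫ s in a..b, F' s ^ 2 :=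
    intervalIntegral.integral_mono_interval le_rfl hc.1 hc.2
      (Eventually.of_forall fun s => sq_nonneg _) hi2
  have h4 : 0 ≤ ∫ s in a..c, F' s ^ 2 :=
    intervalIntegral.integral_nonneg hc.1 fun s _ => sq_nonneg _
  have h5 : (c - a) * ∫ s in a..c, F' s ^ 2 ≤ (b - a) * ∫ s in a..b, F' s ^ 2 :=
    mul_le_mul (by linarith [hc.2]) h3 h4 (by linarith [hc.1, hc.2])
  nlinarith [sq_nonneg (F c - 2 * F a)]

/-- The supremum over a dyadic block is controlled by the value at the left endpoint and the
integral of the squared derivative. A derivative of size `w / a` on a block of length `a`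
contributes as much as the endpoint, so a pointwise variance bound becomes uniform at the cost of a
constant. -/
lemma stdPi_exists_sum_ge_le {ξ : ℝ → ℝ} (hξ : IsCentered ξ) {n : ℕ} {h h' : Fin n → ℝ → ℝ}
    {w : Fin n → ℝ} {a t : ℝ} (ha : 0 < a) (ht : 0 < t)
    (hd : ∀ j, ∀ c ∈ Set.Icc a (2 * a), HasDerivAt (h j) (h' j c) c)
    (hcont : ∀ j, ContinuousOn (h' j) (Set.Icc a (2 * a))) (hmeas : ∀ j, Measurable (h' j))
    (hw : ∀ j, |h j a| ≤ w j) (hw' : ∀ j, ∀ c ∈ Set.Icc a (2 * a), |h' j c| ≤ w j / a) :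
    stdPi n {z | ∃ c ∈ Set.Icc a (2 * a), t ≤ |∑ j, h j c * ξ (z j)|} ≤
      ENNReal.ofReal (4 * Var[ξ; gaussianReal 0 1] * (∑ j, w j ^ 2) / t ^ 2) := by
  set V := Var[ξ; gaussianReal 0 1] with hV
  have hV0 : 0 ≤ V := variance_nonneg _ _
  have hξm := hξ.continuous.measurable
  have hw0 : ∀ j, 0 ≤ w j := fun j => (abs_nonneg _).trans (hw j)
  set D : (Fin n → ℝ) → ℝ≥0∞ := fun z =>
    ∫⁻ s in Set.Icc a (2 * a), ENNReal.ofReal ((∑ j, h' j s * ξ (z j)) ^ 2) with hD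
  set F : (Fin n → ℝ) → ℝ≥0∞ := fun z =>
    2 * ENNReal.ofReal ((∑ j, h j a * ξ (z j)) ^ 2) + ENNReal.ofReal (2 * a) * D z with hF
  have hjoint : Measurable fun p : (Fin n → ℝ) × ℝ =>
      ENNReal.ofReal ((∑ j, h' j p.2 * ξ (p.1 j)) ^ 2) := by fun_prop
  have hDm : Measurable D := hjoint.lintegral_prod_right'
  have hsub : {z | ∃ c ∈ Set.Icc a (2 * a), t ≤ |∑ j, h j c * ξ (z j)|} ⊆
      {z | ENNReal.ofReal (t ^ 2) ≤ F z} := by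
    rintro z ⟨c, hc, htc⟩
    have hder : ∀ s ∈ Set.Icc a (2 * a), HasDerivAt (fun c => ∑ j, h j c * ξ (z j))
        (∑ j, h' j s * ξ (z j)) s := fun s hs =>
      HasDerivAt.fun_sum fun j _ => (hd j s hs).mul_const _
    have hct : ContinuousOn (fun s => ∑ j, h' j s * ξ (z j)) (Set.Icc a (2 * a)) :=
      continuousOn_finsetSum _ fun j _ => (hcont j).mul continuousOn_const
    have h1 := sq_le_of_hasDerivAt hder hct hc
    have h2 : ENNReal.ofReal (∫ s in a..(2 * a), (∑ j, h' j s * ξ (z j)) ^ 2) = D z := by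
      rw [intervalIntegral.integral_of_le (by linarith), ← integral_Icc_eq_integral_Ioc,
        ofReal_integral_eq_lintegral_ofReal]
      · exact (hct.pow 2).integrableOn_Icc
      · exact Eventually.of_forall fun s => sq_nonneg _
    have hI0 : 0 ≤ ∫ s in a..(2 * a), (∑ j, h' j s * ξ (z j)) ^ 2 :=
      intervalIntegral.integral_nonneg (by linarith) fun s _ => sq_nonneg _
    have h3 : t ^ 2 ≤ (∑ j, h j c * ξ (z j)) ^ 2 := by
      rw [← sq_abs (∑ j, h j c * ξ (z j))]
      exact pow_le_pow_left₀ ht.le htc 2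
    refine (ENNReal.ofReal_le_ofReal (h3.trans h1)).trans ?_
    rw [ENNReal.ofReal_add (by positivity) (mul_nonneg zero_le_two
      (mul_nonneg (by linarith) hI0)), ENNReal.ofReal_mul zero_le_two, ← mul_assoc,
      ENNReal.ofReal_mul (by linarith), h2, hF]
    simp only [ENNReal.ofReal_ofNat]
    rw [show 2 * (2 * a - a) = 2 * a by ring]
  have hDint : ∫⁻ z, D z ∂(stdPi n) ≤ ENNReal.ofReal (V * (∑ j, w j ^ 2) / a) := by
    rw [hD, lintegral_lintegral_swap hjoint.aemeasurable]
    have hb : ∀ s ∈ Set.Icc a (2 * a),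
        ∫⁻ z, ENNReal.ofReal ((∑ j, h' j s * ξ (z j)) ^ 2) ∂(stdPi n) ≤
          ENNReal.ofReal (V * (∑ j, w j ^ 2) / a ^ 2) := by
      intro s hs
      rw [lintegral_sq_sum hξ]
      refine ENNReal.ofReal_le_ofReal ?_
      rw [mul_div_assoc, Finset.sum_div]
      refine mul_le_mul_of_nonneg_left (Finset.sum_le_sum fun j _ => ?_) hV0
      rw [← sq_abs, ← div_pow]
      exact pow_le_pow_left₀ (abs_nonneg _) (hw' j s hs) 2
    refine (setLIntegral_mono measurable_const hb).trans ?_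
    rw [setLIntegral_const, Real.volume_Icc, ← ENNReal.ofReal_mul (by positivity)]
    refine ENNReal.ofReal_le_ofReal (le_of_eq ?_)
    field_simp
    ring
  have hFint : ∫⁻ z, F z ∂(stdPi n) ≤ ENNReal.ofReal (4 * V * (∑ j, w j ^ 2)) := by
    have hm1 : Measurable fun z : Fin n → ℝ =>
      2 * ENNReal.ofReal ((∑ j, h j a * ξ (z j)) ^ 2) := by fun_prop
    rw [hF, lintegral_add_left hm1, lintegral_const_mul _ (by fun_prop),
      lintegral_const_mul _ hDm, lintegral_sq_sum hξ]
    have h1 : V * ∑ j, h j a ^ 2 ≤ V * ∑ j, w j ^ 2 := by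
      refine mul_le_mul_of_nonneg_left (Finset.sum_le_sum fun j _ => ?_) hV0
      rw [← sq_abs]
      exact pow_le_pow_left₀ (abs_nonneg _) (hw j) 2
    have hW : 0 ≤ V * ∑ j, w j ^ 2 := by positivity
    calc _ ≤ 2 * ENNReal.ofReal (V * ∑ j, w j ^ 2) +
          ENNReal.ofReal (2 * a) * ENNReal.ofReal (V * (∑ j, w j ^ 2) / a) := by gcongr
      _ = _ := by
        rw [← ENNReal.ofReal_mul (by positivity), ← ENNReal.ofReal_ofNat 2,
          ← ENNReal.ofReal_mul zero_le_two, ← ENNReal.ofReal_add (by positivity) (by positivity)]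
        congr 1
        field_simp
        ring
  refine (measure_mono hsub).trans ((meas_ge_le_lintegral_div (by fun_prop) ?_
    ENNReal.ofReal_ne_top).trans ?_)
  · rw [Ne, ENNReal.ofReal_eq_zero, not_le]; positivity
  · rw [ENNReal.ofReal_div_of_pos (by positivity)]
    gcongr

/-- A union bound over dyadic blocks of scales. -/
lemma stdPi_exists_sum_gt_le {ξ : ℝ → ℝ} (hξ : IsCentered ξ) {n : ℕ} {h h' : Fin n → ℝ → ℝ}
    {w : Fin n → ℝ → ℝ} {t τ : ℝ → ℝ} {a₀ θ B : ℝ} (ha₀ : 0 < a₀) (hθ : 0 < θ)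
    (hd : ∀ j, ∀ c, a₀ ≤ c → HasDerivAt (h j) (h' j c) c)
    (hcont : ∀ j, ContinuousOn (h' j) (Set.Ici a₀)) (hmeas : ∀ j, Measurable (h' j))
    (hw : ∀ j, ∀ a, a₀ ≤ a → |h j a| ≤ w j a)
    (hw' : ∀ j, ∀ a, a₀ ≤ a → ∀ c ∈ Set.Icc a (2 * a), |h' j c| ≤ w j a / a)
    (ht : ∀ a, a₀ ≤ a → 0 < t a)
    (hτ : ∀ a, a₀ ≤ a → ∀ c ∈ Set.Icc a (2 * a), t a ≤ τ c)
    (hB : ∀ a, a₀ ≤ a → (∑ j, w j a ^ 2) / t a ^ 2 ≤ B * (a₀ / a) ^ θ) :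
    stdPi n {z | ∃ c, a₀ ≤ c ∧ τ c < |∑ j, h j c * ξ (z j)|} ≤
      ENNReal.ofReal (4 * Var[ξ; gaussianReal 0 1] * B / (1 - (1 / 2 : ℝ) ^ θ)) := by
  set V := Var[ξ; gaussianReal 0 1] with hV
  have hV0 : 0 ≤ V := variance_nonneg _ _
  have hB0 : 0 ≤ B := by
    have := (div_nonneg (Finset.sum_nonneg fun j _ => sq_nonneg (w j a₀))
      (sq_nonneg (t a₀))).trans (hB a₀ le_rfl)
    simpa [ha₀.ne'] using this
  have hk : ∀ k : ℕ, a₀ ≤ 2 ^ k * a₀ := fun k =>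
    le_mul_of_one_le_left ha₀.le (one_le_pow₀ one_le_two)
  set r : ℝ := (1 / 2 : ℝ) ^ θ with hr
  have hr0 : 0 ≤ r := by positivity
  have hr1 : r < 1 := Real.rpow_lt_one (by norm_num) (by norm_num) hθ
  have hsub : {z : Fin n → ℝ | ∃ c, a₀ ≤ c ∧ τ c < |∑ j, h j c * ξ (z j)|} ⊆
      ⋃ k : ℕ, {z | ∃ c ∈ Set.Icc (2 ^ k * a₀) (2 * (2 ^ k * a₀)),
        t (2 ^ k * a₀) ≤ |∑ j, h j c * ξ (z j)|} := by
    rintro z ⟨c, hc, hcz⟩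
    -- The scale `c` lies in the block starting at `2 ^ k * a₀` with `2 ^ k ≤ c / a₀ < 2 ^ (k + 1)`.
    obtain ⟨k, hk1, hk2⟩ := exists_nat_pow_near ((one_le_div ha₀).mpr hc) one_lt_two
    rw [le_div_iff₀ ha₀] at hk1
    rw [div_lt_iff₀ ha₀] at hk2
    have hmem : c ∈ Set.Icc (2 ^ k * a₀) (2 * (2 ^ k * a₀)) :=
      ⟨hk1, by rw [← mul_assoc, ← pow_succ']; exact hk2.le⟩
    exact Set.mem_iUnion.mpr ⟨k, c, hmem, (hτ _ (hk k) c hmem).trans hcz.le⟩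
  refine (measure_mono hsub).trans ((measure_iUnion_le _).trans ?_)
  have hblock : ∀ k : ℕ, stdPi n {z | ∃ c ∈ Set.Icc (2 ^ k * a₀) (2 * (2 ^ k * a₀)),
        t (2 ^ k * a₀) ≤ |∑ j, h j c * ξ (z j)|} ≤ ENNReal.ofReal (4 * V * B * r ^ k) := by
    intro k
    refine (stdPi_exists_sum_ge_le hξ (by positivity) (ht _ (hk k))
      (fun j c hc => hd j c ((hk k).trans hc.1))
      (fun j => (hcont j).mono fun c hc => (hk k).trans hc.1) hmeas
      (fun j => hw j _ (hk k)) (fun j c hc => hw' j _ (hk k) c hc)).trans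
      (ENNReal.ofReal_le_ofReal ?_)
    rw [mul_div_assoc, mul_assoc (4 * V)]
    refine mul_le_mul_of_nonneg_left ((hB _ (hk k)).trans (le_of_eq ?_)) (by positivity)
    congr 1
    rw [hr, ← Real.rpow_natCast ((1 / 2 : ℝ) ^ θ), ← Real.rpow_mul (by norm_num),
      mul_comm θ, Real.rpow_mul (by norm_num), Real.rpow_natCast]
    congr 1
    rw [one_div, inv_pow]
    field_simp
  refine (ENNReal.tsum_le_tsum hblock).trans ?_
  rw [← ENNReal.ofReal_tsum_of_nonneg (fun k => by positivity)
    ((summable_geometric_of_lt_one hr0 hr1).mul_left _), tsum_mul_left,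
    tsum_geometric_of_lt_one hr0 hr1, div_eq_mul_inv]

/-! ### Power sums -/

lemma one_add_mul_le_rpow_neg {u v s : ℝ} (hu : 0 < u) (huv : u < v) (hs : 0 < s) :
    s * (v - u) * v ^ (-s - 1) ≤ u ^ (-s) - v ^ (-s) := by
  have hv : 0 < v := hu.trans huv
  have h1 : 1 + s * (1 - u / v) ≤ (u / v) ^ (-s) := by
    have hq : 0 < u / v := div_pos hu hv
    rw [Real.rpow_def_of_pos hq]
    have h2 := Real.add_one_le_exp (Real.log (u / v) * -s)
    have h3 := Real.log_le_sub_one_of_pos hq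
    nlinarith
  rw [Real.div_rpow hu.le hv.le, le_div_iff₀ (by positivity)] at h1
  rw [Real.rpow_sub_one hv.ne']
  have h4 : s * (v - u) * (v ^ (-s) / v) = s * (1 - u / v) * v ^ (-s) := by
    field_simp
  rw [h4]
  linarith

lemma rpow_sub_one_le_sub {t p : ℝ} (ht : 1 ≤ t) (hp : 0 < p) (hp1 : p ≤ 1) :
    p * t ^ (p - 1) ≤ t ^ p - (t - 1) ^ p := by
  have ht0 : 0 < t := by linarith
  have h1 : (1 + -(1 / t)) ^ p ≤ 1 + p * -(1 / t) :=
    rpow_one_add_le_one_add_mul_self (by rw [neg_le_neg_iff, div_le_one ht0]; exact ht)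
      hp.le hp1
  have h2 : (t - 1) ^ p = t ^ p * (1 + -(1 / t)) ^ p := by
    rw [← Real.mul_rpow ht0.le (by rw [← sub_eq_add_neg, sub_nonneg, div_le_one ht0]; exact ht)]
    congr 1
    field_simp
    ring
  rw [h2, Real.rpow_sub_one ht0.ne']
  have h3 : p * (t ^ p / t) = t ^ p * (p * (1 / t)) := by ring
  rw [h3]
  have := mul_le_mul_of_nonneg_left h1 (Real.rpow_nonneg ht0.le p)
  nlinarith

/-- A comparison with an integral, done by telescoping the differences of `t ^ (-(q - 1))`. The
shift by `N` makes one bound serve the indices beyond `N` without splitting the sum. -/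
lemma sum_shifted_rpow_le {N q : ℝ} (hN : 0 < N) (hq : 1 < q) (n : ℕ) :
    ∑ j : Fin n, (N / (N + ((j : ℝ) + 1))) ^ q ≤ N / (q - 1) := by
  rw [Fin.sum_univ_eq_sum_range (fun j : ℕ => (N / (N + ((j : ℝ) + 1))) ^ q) n]
  have hterm : ∀ j : ℕ, (N / (N + ((j : ℝ) + 1))) ^ q ≤
      N ^ q / (q - 1) * ((N + j) ^ (-(q - 1)) - (N + ((j + 1 : ℕ) : ℝ)) ^ (-(q - 1))) := by
    intro j
    have h1 := one_add_mul_le_rpow_neg (u := N + j) (v := N + ((j + 1 : ℕ) : ℝ)) (s := q - 1)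
      (by positivity) (by push_cast; linarith) (by linarith)
    have h2 : -(q - 1) - 1 = -q := by ring
    rw [h2] at h1
    push_cast at h1 ⊢
    rw [show (N + (j + 1 : ℝ)) - (N + j) = 1 by ring, mul_one] at h1
    rw [Real.div_rpow hN.le (by positivity), div_eq_mul_inv, ← Real.rpow_neg (by positivity),
      div_mul_eq_mul_div, mul_div_assoc]
    refine mul_le_mul_of_nonneg_left ?_ (by positivity)
    rw [le_div_iff₀ (by linarith)]
    linarith
  refine (Finset.sum_le_sum fun j _ => hterm j).trans ?_
  rw [← Finset.mul_sum, Finset.sum_range_sub']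
  have h3 : N ^ q * (N + ((0 : ℕ) : ℝ)) ^ (-(q - 1)) = N := by
    rw [Nat.cast_zero, add_zero, ← Real.rpow_add hN]
    simp
  have h4 : 0 ≤ (N + (n : ℝ)) ^ (-(q - 1)) := by positivity
  rw [div_mul_eq_mul_div]
  refine div_le_div_of_nonneg_right ?_ (by linarith)
  rw [mul_sub, h3]
  have : 0 ≤ N ^ q * (N + (n : ℝ)) ^ (-(q - 1)) := by positivity
  linarith

lemma sum_rpow_sub_one_le {N p : ℝ} (hN : 0 ≤ N) (hp : 0 < p) (hp1 : p ≤ 1) (n : ℕ) :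
    ∑ j : Fin n, (if (j : ℝ) + 1 ≤ N then ((j : ℝ) + 1) ^ (p - 1) else 0) ≤ N ^ p / p := by
  rw [Fin.sum_univ_eq_sum_range
    (fun j : ℕ => if (j : ℝ) + 1 ≤ N then ((j : ℝ) + 1) ^ (p - 1) else 0) n]
  have key : ∀ n : ℕ, ∑ j ∈ Finset.range n,
      (if (j : ℝ) + 1 ≤ N then ((j : ℝ) + 1) ^ (p - 1) else 0) ≤ (min (n : ℝ) N) ^ p / p := by
    intro n
    induction n with
    | zero => simp [hN, Real.zero_rpow hp.ne']
    | succ k ih =>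
      rw [Finset.sum_range_succ]
      split_ifs with h
      · have h1 := rpow_sub_one_le_sub (t := (k : ℝ) + 1) (by simp) hp hp1
        rw [min_eq_left (by linarith)] at ih
        rw [Nat.cast_succ, min_eq_left h]
        rw [le_div_iff₀ hp] at ih ⊢
        rw [add_sub_cancel_right] at h1
        linarith
      · rw [add_zero]
        refine ih.trans (div_le_div_of_nonneg_right (Real.rpow_le_rpow (by positivity) ?_ hp.le)
          hp.le)
        exact min_le_min_right _ (by simp)
  refine (key n).trans (div_le_div_of_nonneg_right (Real.rpow_le_rpow (by positivity)
    (min_le_right _ _) hp.le) hp.le)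

lemma div_rpow_le_shifted {N t q : ℝ} (hN : 0 < N) (ht : N < t) (hq : 0 ≤ q) :
    (N / t) ^ q ≤ 2 ^ q * (N / (N + t)) ^ q := by
  have ht0 : 0 < t := hN.trans ht
  rw [← Real.mul_rpow (by norm_num) (by positivity)]
  refine Real.rpow_le_rpow (by positivity) ?_ hq
  rw [mul_div_assoc', div_le_div_iff₀ ht0 (by positivity)]
  nlinarith

/-- Sums of terms that decay as a power of the index beyond the threshold `N`. -/
lemma sum_le_of_decay {n : ℕ} {N A q : ℝ} (hN : 0 < N) (hA : 0 ≤ A) (hq : 1 < q)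
    {a : Fin n → ℝ} (h1 : ∀ j : Fin n, (j : ℝ) + 1 ≤ N → a j ≤ A * (N / ((j : ℝ) + 1)) ^ (1 / 2 : ℝ))
    (h2 : ∀ j : Fin n, N < (j : ℝ) + 1 → a j ≤ A * (N / ((j : ℝ) + 1)) ^ q) :
    ∑ j, a j ≤ A * (2 + 2 ^ q / (q - 1)) * N := by
  -- The square root growth allowed below `N` is summable to order `N`; it leaves room for
  -- logarithmic terms there.
  have hterm : ∀ j : Fin n, a j ≤
      A * N ^ (1 / 2 : ℝ) * (if (j : ℝ) + 1 ≤ N then ((j : ℝ) + 1) ^ ((1 / 2 : ℝ) - 1) else 0) +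
        A * 2 ^ q * (N / (N + ((j : ℝ) + 1))) ^ q := by
    intro j
    have hj : (0 : ℝ) < (j : ℝ) + 1 := by positivity
    split_ifs with h
    · have h3 := h1 j h
      rw [Real.div_rpow hN.le hj.le, div_eq_mul_inv, ← Real.rpow_neg hj.le] at h3
      rw [show (1 / 2 : ℝ) - 1 = -(1 / 2) by norm_num]
      have : 0 ≤ A * 2 ^ q * (N / (N + ((j : ℝ) + 1))) ^ q := by positivity
      linarith
    · rw [mul_zero, zero_add, mul_assoc]
      rw [not_le] at h
      exact (h2 j h).trans (mul_le_mul_of_nonneg_left (div_rpow_le_shifted hN h (by linarith)) hA)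
  refine (Finset.sum_le_sum fun j _ => hterm j).trans ?_
  rw [Finset.sum_add_distrib, ← Finset.mul_sum, ← Finset.mul_sum]
  have h3 := sum_rpow_sub_one_le hN.le (p := 1 / 2) (by norm_num) (by norm_num) n
  have h4 := sum_shifted_rpow_le hN hq n
  have h5 : N ^ (1 / 2 : ℝ) * N ^ (1 / 2 : ℝ) = N := by
    rw [← Real.rpow_add hN]; norm_num
  calc _ ≤ A * N ^ (1 / 2 : ℝ) * (N ^ (1 / 2 : ℝ) / (1 / 2)) + A * 2 ^ q * (N / (q - 1)) := by
        gcongr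
    _ = A * 2 * (N ^ (1 / 2 : ℝ) * N ^ (1 / 2 : ℝ)) + A * 2 ^ q * (N / (q - 1)) := by ring
    _ = _ := by rw [h5]; ring

/-- Sums of hyperrectangle type, weighted by a truncated power. -/
lemma sum_hyperrectangle_le {s M : ℝ} (hs : 0 < s) (hM : s < M) :
    ∃ C : ℝ, 0 < C ∧ ∀ (n : ℕ) (N : ℝ) (β : Fin n → ℝ), 0 < N →
      (∀ j, 0 ≤ β j ∧ β j ≤ 1) → (∀ j : Fin n, β j ≤ (((j : ℝ) + 1) / N) ^ M) →
      ∑ j : Fin n, ((j : ℝ) + 1) ^ (-1 - s) * β j ≤ C * N ^ (-s) := by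
  -- `p ≤ M - s` lets the exponent `M` be lowered to `s + p`, and `p ≤ 1` is what
  -- `sum_rpow_sub_one_le` requires.
  set p := min 1 (M - s) with hp
  have hp0 : 0 < p := lt_min one_pos (by linarith)
  have hp1 : p ≤ 1 := min_le_left _ _
  refine ⟨1 / p + 2 ^ (1 + s) / s, by positivity, fun n N β hN hβ hβM => ?_⟩
  have hterm : ∀ j : Fin n, ((j : ℝ) + 1) ^ (-1 - s) * β j ≤
      N ^ (-s - p) * (if (j : ℝ) + 1 ≤ N then ((j : ℝ) + 1) ^ (p - 1) else 0) +
        N ^ (-1 - s) * 2 ^ (1 + s) * (N / (N + ((j : ℝ) + 1))) ^ (1 + s) := by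
    intro j
    have hj : (0 : ℝ) < (j : ℝ) + 1 := by positivity
    split_ifs with h
    · have h1 : (((j : ℝ) + 1) / N) ^ M ≤ (((j : ℝ) + 1) / N) ^ (s + p) :=
        Real.rpow_le_rpow_of_exponent_ge (by positivity) ((div_le_one hN).mpr h)
          (by linarith [min_le_right 1 (M - s)])
      have h2 : ((j : ℝ) + 1) ^ (-1 - s) * (((j : ℝ) + 1) / N) ^ (s + p) =
          N ^ (-s - p) * ((j : ℝ) + 1) ^ (p - 1) := by
        rw [Real.div_rpow hj.le hN.le, div_eq_mul_inv, ← Real.rpow_neg hN.le, ← mul_assoc,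
          ← Real.rpow_add hj, mul_comm]
        congr 2 <;> ring
      have h3 : ((j : ℝ) + 1) ^ (-1 - s) * β j ≤
          ((j : ℝ) + 1) ^ (-1 - s) * (((j : ℝ) + 1) / N) ^ (s + p) :=
        mul_le_mul_of_nonneg_left ((hβM j).trans h1) (by positivity)
      rw [h2] at h3
      have : 0 ≤ N ^ (-1 - s) * 2 ^ (1 + s) * (N / (N + ((j : ℝ) + 1))) ^ (1 + s) := by positivity
      linarith
    · rw [not_le] at h
      rw [mul_zero, zero_add, mul_assoc]
      have h1 := div_rpow_le_shifted hN h (q := 1 + s) (by linarith)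
      have h2 : ((j : ℝ) + 1) ^ (-1 - s) = N ^ (-1 - s) * (N / ((j : ℝ) + 1)) ^ (1 + s) := by
        rw [Real.div_rpow hN.le hj.le, div_eq_mul_inv, ← Real.rpow_neg hj.le, ← mul_assoc,
          ← Real.rpow_add hN]
        rw [show -1 - s + (1 + s) = 0 by ring, Real.rpow_zero, one_mul]
        congr 1; ring
      calc _ ≤ ((j : ℝ) + 1) ^ (-1 - s) * 1 :=
            mul_le_mul_of_nonneg_left (hβ j).2 (by positivity)
        _ = N ^ (-1 - s) * (N / ((j : ℝ) + 1)) ^ (1 + s) := by rw [mul_one, h2]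
        _ ≤ _ := mul_le_mul_of_nonneg_left h1 (by positivity)
  refine (Finset.sum_le_sum fun j _ => hterm j).trans ?_
  rw [Finset.sum_add_distrib, ← Finset.mul_sum, ← Finset.mul_sum]
  have h3 := sum_rpow_sub_one_le hN.le hp0 hp1 n
  have h4 := sum_shifted_rpow_le hN (q := 1 + s) (by linarith) n
  have h5 : N ^ (-s - p) * N ^ p = N ^ (-s) := by rw [← Real.rpow_add hN]; congr 1; ring
  have h6 : N ^ (-1 - s) * N = N ^ (-s) := by
    nth_rewrite 2 [← Real.rpow_one N]
    rw [← Real.rpow_add hN]; congr 1; ring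
  calc _ ≤ N ^ (-s - p) * (N ^ p / p) + N ^ (-1 - s) * 2 ^ (1 + s) * (N / (1 + s - 1)) := by
        gcongr
    _ = N ^ (-s - p) * N ^ p * (1 / p) + N ^ (-1 - s) * N * (2 ^ (1 + s) / s) := by
        rw [show 1 + s - 1 = s by ring]; ring
    _ = _ := by rw [h5, h6]; ring

/-! ### The deterministic parts of the criteria -/

/-- The contribution of a coordinate with signal-to-noise ratio `x` to the variance part of the
criterion: likelihood-based for `p = 1` and risk-based for `p = 2`. -/
noncomputable def varTerm (p : ℕ) (x : ℝ) : ℝ :=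
  if p = 1 then Real.log (1 + x) - x / (1 + x) else (x / (1 + x)) ^ 2

/-- The variance part of the criterion. -/
noncomputable def varSum {n : ℕ} (p : ℕ) (lam : Fin n → ℝ) (c : ℝ) : ℝ :=
  ∑ j, varTerm p (c * lam j)

/-- The bias part of the criterion. -/
noncomputable def biasSum {n : ℕ} (p : ℕ) (lam f : Fin n → ℝ) (c : ℝ) : ℝ :=
  ∑ j, f j ^ 2 * ((1 + c * lam j) ^ p)⁻¹

/-- The effective dimension of the posterior at scale `c`. -/
noncomputable def effDim (m : ℝ) (n : ℕ) (c : ℝ) : ℝ := (c * n) ^ (1 / m)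

/-- Polynomially decaying eigenvalues. -/
structure Spectrum (m δlo δhi : ℝ) {n : ℕ} (lam : Fin n → ℝ) : Prop where
  one_le : 1 ≤ m
  lo_pos : 0 < δlo
  hi_pos : 0 < δhi
  lower : ∀ j : Fin n, δlo * (n / ((j : ℝ) + 1) ^ m) ≤ lam j
  upper : ∀ j : Fin n, lam j ≤ δhi * (n / ((j : ℝ) + 1) ^ m)

/-- The inequality `log (1 + x) ≥ 2x / (x + 2)` puts the likelihood term above half the risk term,
so one lower bound serves both criteria. -/
lemma half_gain_sq_le_varTerm (p : ℕ) {x : ℝ} (hx : 0 ≤ x) :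
    (x / (1 + x)) ^ 2 / 2 ≤ varTerm p x := by
  unfold varTerm
  split_ifs
  · have h1 := Real.le_log_one_add_of_nonneg hx
    have h2 : 2 * x / (x + 2) - x / (1 + x) - (x / (1 + x)) ^ 2 / 2 =
        x ^ 3 / (2 * (x + 2) * (1 + x) ^ 2) := by
      field_simp
      ring
    have h3 : 0 ≤ x ^ 3 / (2 * (x + 2) * (1 + x) ^ 2) := by positivity
    linarith
  · have : 0 ≤ (x / (1 + x)) ^ 2 := sq_nonneg _
    linarith

lemma varTerm_nonneg (p : ℕ) {x : ℝ} (hx : 0 ≤ x) : 0 ≤ varTerm p x :=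
  le_trans (by positivity) (half_gain_sq_le_varTerm p hx)

lemma varTerm_le_sq (p : ℕ) {x : ℝ} (hx : 0 ≤ x) : varTerm p x ≤ x ^ 2 := by
  unfold varTerm
  split_ifs
  · have h1 := Real.log_le_sub_one_of_pos (show 0 < 1 + x by linarith)
    have h2 : x - x / (1 + x) = x ^ 2 / (1 + x) := by field_simp; ring
    have h3 : x ^ 2 / (1 + x) ≤ x ^ 2 := div_le_self (sq_nonneg _) (by linarith)
    linarith
  · exact pow_le_pow_left₀ (by positivity) (div_le_self hx (by linarith)) 2

lemma varTerm_le_log (p : ℕ) {x : ℝ} (hx : 0 ≤ x) : varTerm p x ≤ 1 + Real.log (1 + x) := by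
  have h0 : 0 ≤ Real.log (1 + x) := Real.log_nonneg (by linarith)
  unfold varTerm
  split_ifs
  · have : 0 ≤ x / (1 + x) := by positivity
    linarith
  · have : (x / (1 + x)) ^ 2 ≤ 1 :=
      pow_le_one₀ (by positivity) ((div_le_one (by linarith)).mpr (by linarith))
    linarith

lemma effDim_pos {m c : ℝ} {n : ℕ} (hc : 0 < c) (hn : 0 < n) : 0 < effDim m n c := by
  unfold effDim; positivity

lemma effDim_rpow {m c : ℝ} {n : ℕ} (hm : 1 ≤ m) (hc : 0 ≤ c) : effDim m n c ^ m = c * n := by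
  unfold effDim
  rw [← Real.rpow_mul (by positivity), one_div_mul_cancel (by linarith), Real.rpow_one]

lemma effDim_mono {m c c' : ℝ} {n : ℕ} (hm : 1 ≤ m) (hc : 0 ≤ c) (h : c ≤ c') :
    effDim m n c ≤ effDim m n c' :=
  Real.rpow_le_rpow (by positivity) (mul_le_mul_of_nonneg_right h (by positivity))
    (by positivity)

lemma effDim_mul {m K c : ℝ} {n : ℕ} (hK : 0 ≤ K) (hc : 0 ≤ c) :
    effDim m n (K * c) = K ^ (1 / m) * effDim m n c := by
  unfold effDim
  rw [mul_assoc, Real.mul_rpow hK (by positivity)]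

namespace Spectrum

variable {m δlo δhi : ℝ} {n : ℕ} {lam : Fin n → ℝ}

lemma ratio_rpow (h : Spectrum m δlo δhi lam) {c : ℝ} (hc : 0 < c) (j : Fin n) :
    (effDim m n c / ((j : ℝ) + 1)) ^ m = c * (n / ((j : ℝ) + 1) ^ m) := by
  rw [Real.div_rpow (effDim_pos hc j.pos).le (by positivity), effDim_rpow h.one_le hc.le]
  ring

lemma snr_ge (h : Spectrum m δlo δhi lam) {c : ℝ} (hc : 0 < c) (j : Fin n) :
    δlo * (effDim m n c / ((j : ℝ) + 1)) ^ m ≤ c * lam j := by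
  rw [h.ratio_rpow hc]
  have := mul_le_mul_of_nonneg_left (h.lower j) hc.le
  linarith

lemma snr_le (h : Spectrum m δlo δhi lam) {c : ℝ} (hc : 0 < c) (j : Fin n) :
    c * lam j ≤ δhi * (effDim m n c / ((j : ℝ) + 1)) ^ m := by
  rw [h.ratio_rpow hc]
  have := mul_le_mul_of_nonneg_left (h.upper j) hc.le
  linarith

lemma lam_pos (h : Spectrum m δlo δhi lam) (j : Fin n) : 0 < lam j := by
  have : 0 < n := j.pos
  have := h.lo_pos
  exact lt_of_lt_of_le (by positivity) (h.lower j)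

lemma snr_pos (h : Spectrum m δlo δhi lam) {c : ℝ} (hc : 0 < c) (j : Fin n) : 0 < c * lam j :=
  mul_pos hc (h.lam_pos j)

/-- Coordinates below `N` contribute at most a logarithm of `N / j`, those beyond it the square of a
signal-to-noise ratio, of order `(N / j) ^ (2 * m)`. Because of the square, the tail is summable
even for `m = 1`. -/
lemma varSum_le (h : Spectrum m δlo δhi lam) (p : ℕ) {c : ℝ} (hc : 0 < c) (hn : 0 < n) :
    varSum p lam c ≤ (1 + Real.log (1 + δhi) + 2 * m + δhi ^ 2) * 6 * effDim m n c := by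
  have hm := h.one_le
  have hN := effDim_pos (m := m) hc hn
  have hδ := h.hi_pos
  have hl : 0 ≤ Real.log (1 + δhi) := Real.log_nonneg (by linarith)
  set A := 1 + Real.log (1 + δhi) + 2 * m + δhi ^ 2 with hA
  have hA0 : 0 ≤ A := by positivity
  have key := sum_le_of_decay (n := n) (a := fun j => varTerm p (c * lam j)) (q := 2) hN hA0
    one_lt_two ?_ ?_
  · refine key.trans (le_of_eq ?_)
    norm_num
  · intro j hj
    have hj0 : (0 : ℝ) < (j : ℝ) + 1 := by positivity
    set t := effDim m n c / ((j : ℝ) + 1) with ht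
    have ht1 : 1 ≤ t := (one_le_div hj0).mpr hj
    have htm : 1 ≤ t ^ m := Real.one_le_rpow ht1 (by linarith)
    have hs1 : 1 ≤ t ^ (1 / 2 : ℝ) := Real.one_le_rpow ht1 (by norm_num)
    have hx := (h.snr_pos hc j).le
    have h1 : Real.log (1 + c * lam j) ≤ Real.log (1 + δhi) + 2 * m * t ^ (1 / 2 : ℝ) := by
      calc Real.log (1 + c * lam j) ≤ Real.log ((1 + δhi) * t ^ m) := by
            refine Real.log_le_log (by linarith) ?_
            have := h.snr_le hc j
            rw [← ht] at this
            linarith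
        _ = Real.log (1 + δhi) + m * Real.log t := by
            rw [Real.log_mul (by positivity) (by positivity), Real.log_rpow (by linarith)]
        _ ≤ _ := by
            have h2 := Real.log_le_sub_one_of_pos (show 0 < t ^ (1 / 2 : ℝ) by positivity)
            rw [Real.log_rpow (by linarith)] at h2
            -- The logarithm is traded for the square root that `sum_le_of_decay` tolerates.
            have h3 : Real.log t ≤ 2 * t ^ (1 / 2 : ℝ) := by linarith
            nlinarith
    have h2 := varTerm_le_log p hx
    have h3 : (1 + Real.log (1 + δhi)) * 1 ≤ (1 + Real.log (1 + δhi)) * t ^ (1 / 2 : ℝ) := by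
      gcongr
    have h4 : 0 ≤ δhi ^ 2 * t ^ (1 / 2 : ℝ) := by positivity
    rw [hA]
    nlinarith
  · intro j hj
    have hj0 : (0 : ℝ) < (j : ℝ) + 1 := by positivity
    set t := effDim m n c / ((j : ℝ) + 1) with ht
    have ht0 : 0 < t := by positivity
    have ht1 : t ≤ 1 := ((div_lt_one hj0).mpr hj).le
    have htm : t ^ m ≤ t := by
      simpa using Real.rpow_le_rpow_of_exponent_ge ht0 ht1 hm
    have hx := (h.snr_pos hc j).le
    have h1 : c * lam j ≤ δhi * t := (h.snr_le hc j).trans (by gcongr)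
    have h2 : (c * lam j) ^ 2 ≤ (δhi * t) ^ 2 := pow_le_pow_left₀ hx h1 2
    have h3 := varTerm_le_sq p hx
    rw [show t ^ (2 : ℝ) = t ^ 2 by norm_cast]
    rw [mul_pow] at h2
    have h4 : 0 ≤ (1 + Real.log (1 + δhi) + 2 * m) * t ^ 2 := by positivity
    rw [hA]
    nlinarith

/-- The first `⌊N⌋` coordinates exist because `N ≤ n`, and each has signal-to-noise ratio at least
`δlo`; `1 ≤ N` gives `⌊N⌋ ≥ N / 2`. -/
lemma varSum_ge (h : Spectrum m δlo δhi lam) (p : ℕ) {c : ℝ} (hc : 0 < c)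
    (h1 : 1 ≤ effDim m n c) (hn : effDim m n c ≤ n) :
    (δlo / (1 + δlo)) ^ 2 / 4 * effDim m n c ≤ varSum p lam c := by
  have hδ := h.lo_pos
  set N := effDim m n c with hN
  set S : Finset (Fin n) := Finset.univ.filter fun j : Fin n => (j : ℝ) + 1 ≤ N with hS
  have hcard : N / 2 ≤ (S.card : ℝ) := by
    have hfl : ⌊N⌋₊ ≤ n := Nat.floor_le_of_le hn
    have h2 : ⌊N⌋₊ ≤ S.card := by
      have : (Finset.univ.map (Fin.castLEEmb hfl)) ⊆ S := by
        intro j hj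
        simp only [Finset.mem_map, Finset.mem_univ, true_and] at hj
        obtain ⟨i, rfl⟩ := hj
        simp only [hS, Finset.mem_filter, Finset.mem_univ, true_and, Fin.castLEEmb_apply,
          Fin.val_castLE]
        have h3 : ((i : ℕ) + 1 : ℕ) ≤ ⌊N⌋₊ := i.2
        have h4 := (Nat.cast_le (α := ℝ)).mpr h3
        push_cast at h4
        exact h4.trans (Nat.floor_le (by linarith))
      simpa using Finset.card_le_card this
    have h3 := Nat.lt_floor_add_one N
    have h4 : (1 : ℝ) ≤ ⌊N⌋₊ := by
      exact_mod_cast (Nat.one_le_floor_iff N).mpr h1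
    have h5 : (⌊N⌋₊ : ℝ) ≤ S.card := by exact_mod_cast h2
    linarith
  have hterm : ∀ j ∈ S, (δlo / (1 + δlo)) ^ 2 / 2 ≤ varTerm p (c * lam j) := by
    intro j hj
    have hj0 : (0 : ℝ) < (j : ℝ) + 1 := by positivity
    have hjN : (j : ℝ) + 1 ≤ N := by simpa [hS] using hj
    have hx : δlo ≤ c * lam j := by
      refine le_trans ?_ (h.snr_ge hc j)
      exact le_mul_of_one_le_right hδ.le
        (Real.one_le_rpow ((one_le_div hj0).mpr hjN) (by linarith [h.one_le]))
    refine le_trans ?_ (half_gain_sq_le_varTerm p (hδ.le.trans hx))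
    gcongr ?_ ^ 2 / 2
    rw [div_le_div_iff₀ (by linarith) (by linarith)]
    nlinarith
  calc (δlo / (1 + δlo)) ^ 2 / 4 * N = (N / 2) * ((δlo / (1 + δlo)) ^ 2 / 2) := by ring
    _ ≤ S.card * ((δlo / (1 + δlo)) ^ 2 / 2) := by gcongr
    _ ≤ ∑ j ∈ S, varTerm p (c * lam j) := by
        rw [← nsmul_eq_mul]; exact Finset.card_nsmul_le_sum _ _ _ hterm
    _ ≤ varSum p lam c := Finset.sum_le_sum_of_subset_of_nonneg (Finset.subset_univ _)
        fun j _ _ => varTerm_nonneg p (h.snr_pos hc j).le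

/-- The trace involves the gains themselves and not their squares, so the tail decays only like `j ^
(-m)`. This is where `m > 1` enters the diameter bound. -/
lemma sum_gain_le (h : Spectrum m δlo δhi lam) (hm : 1 < m) {c : ℝ} (hc : 0 < c) (hn : 0 < n) :
    ∑ j, c * lam j / (1 + c * lam j) ≤ (1 + δhi) * (2 + 2 ^ m / (m - 1)) * effDim m n c := by
  have hN := effDim_pos (m := m) hc hn
  have hδ := h.hi_pos
  refine sum_le_of_decay hN (by positivity) hm (fun j hj => ?_) fun j hj => ?_
  · have hj0 : (0 : ℝ) < (j : ℝ) + 1 := by positivity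
    have hs1 : 1 ≤ (effDim m n c / ((j : ℝ) + 1)) ^ (1 / 2 : ℝ) :=
      Real.one_le_rpow ((one_le_div hj0).mpr hj) (by norm_num)
    have hx := h.snr_pos hc j
    have : c * lam j / (1 + c * lam j) ≤ 1 := (div_le_one (by linarith)).mpr (by linarith)
    nlinarith
  · have hx := h.snr_pos hc j
    have h1 : c * lam j / (1 + c * lam j) ≤ c * lam j := div_le_self hx.le (by linarith)
    have h2 := h.snr_le hc j
    have h3 : 0 ≤ (effDim m n c / ((j : ℝ) + 1)) ^ m := by positivity
    linarith

lemma sum_gain_sq_le (h : Spectrum m δlo δhi lam) {c : ℝ} (hc : 0 < c) (hn : 0 < n) :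
    ∑ j, (c * lam j / (1 + c * lam j)) ^ 2 ≤
      (1 + Real.log (1 + δhi) + 2 * m + δhi ^ 2) * 6 * effDim m n c := by
  simpa [varSum, varTerm] using h.varSum_le 2 hc hn

end Spectrum

/-! ### The stochastic part of the criteria -/

/-- The stochastic part of the criterion at scale `c`, for the signal `f` and the noise `z`. -/
noncomputable def noise {n : ℕ} (p : ℕ) (lam f : Fin n → ℝ) (c : ℝ) (z : Fin n → ℝ) : ℝ :=
  ∑ j, (((1 + c * lam j) ^ p)⁻¹ - 1) * (z j ^ 2 - 1) +
    2 * ∑ j, f j * ((1 + c * lam j) ^ p)⁻¹ * z j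

section Shrinkage

variable {p : ℕ}

lemma hasDerivAt_shrinkage {l c : ℝ} (hl : 0 < l) (hc : 0 < c) :
    HasDerivAt (fun c => ((1 + c * l) ^ p)⁻¹) (-(p * l / (1 + c * l) ^ (p + 1))) c := by
  have h0 : 1 + c * l ≠ 0 := by positivity
  have h1 : HasDerivAt (fun c => 1 + c * l) l c := by
    simpa using ((hasDerivAt_id c).mul_const l).const_add 1
  have h2 := (h1.pow p).inv (pow_ne_zero p h0)
  refine h2.congr_deriv ?_
  -- The power rule contains the truncated subtraction `p - 1`.
  rcases p with _ | p
  · simp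
  · simp only [Nat.add_sub_cancel]
    field_simp
    simp only [Pi.pow_apply]
    ring

lemma shrinkage_le_one {x : ℝ} (hx : 0 ≤ x) : ((1 + x) ^ p)⁻¹ ≤ 1 :=
  inv_le_one_of_one_le₀ (one_le_pow₀ (by linarith))

lemma shrinkage_anti {x y : ℝ} (hx : 0 ≤ x) (h : x ≤ y) : ((1 + y) ^ p)⁻¹ ≤ ((1 + x) ^ p)⁻¹ := by
  gcongr

lemma shrinkage_le_four_mul (hp : p ≤ 2) {x y : ℝ} (hx : 0 ≤ x) (hy : 0 ≤ y) (h : y ≤ 2 * x) :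
    ((1 + x) ^ p)⁻¹ ≤ 4 * ((1 + y) ^ p)⁻¹ := by
  rw [← div_eq_mul_inv, inv_eq_one_div, div_le_div_iff₀ (by positivity) (by positivity), one_mul]
  calc (1 + y) ^ p ≤ (2 * (1 + x)) ^ p := by gcongr; linarith
    _ = 2 ^ p * (1 + x) ^ p := mul_pow _ _ _
    _ ≤ 2 ^ 2 * (1 + x) ^ p := by gcongr; norm_num
    _ = 4 * (1 + x) ^ p := by norm_num

lemma abs_shrinkage_sub_one_le (hp : p ≤ 2) {x : ℝ} (hx : 0 ≤ x) :
    |((1 + x) ^ p)⁻¹ - 1| ≤ 2 * (x / (1 + x)) := by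
  rw [abs_sub_comm, abs_of_nonneg (by linarith [shrinkage_le_one (p := p) hx])]
  have h1 : ((1 + x) ^ 2)⁻¹ ≤ ((1 + x) ^ p)⁻¹ := by
    gcongr
    linarith
  have h2 : 1 - ((1 + x) ^ 2)⁻¹ = 2 * (x / (1 + x)) - (x / (1 + x)) ^ 2 := by
    field_simp
    ring
  nlinarith [sq_nonneg (x / (1 + x))]

/-- The bound involves only the left endpoint `a` and has the form `w / a` needed for the block
inequality, for the quadratic and for the linear part of the noise. -/
lemma abs_deriv_shrinkage_le (hp : p ≤ 2) {l a c : ℝ} (hl : 0 < l) (ha : 0 < a) (hc : a ≤ c) :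
    |(-(p * l / (1 + c * l) ^ (p + 1)))| ≤ 2 * (a * l / (1 + a * l)) * ((1 + a * l) ^ p)⁻¹ / a := by
  have hc0 : 0 < c := ha.trans_le hc
  rw [abs_neg, abs_of_nonneg (by positivity)]
  have h1 : 2 * (a * l / (1 + a * l)) * ((1 + a * l) ^ p)⁻¹ / a = 2 * l / (1 + a * l) ^ (p + 1) := by
    field_simp
    ring
  rw [h1]
  have : (p : ℝ) ≤ 2 := by exact_mod_cast hp
  gcongr

end Shrinkage

lemma biasSum_nonneg {n : ℕ} (p : ℕ) {lam : Fin n → ℝ} (hlam : ∀ j, 0 < lam j) (f : Fin n → ℝ)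
    {c : ℝ} (hc : 0 ≤ c) : 0 ≤ biasSum p lam f c :=
  Finset.sum_nonneg fun j _ => by have := hlam j; positivity

lemma biasSum_anti {n : ℕ} (p : ℕ) {lam : Fin n → ℝ} (hlam : ∀ j, 0 < lam j) (f : Fin n → ℝ)
    {c c' : ℝ} (hc : 0 ≤ c) (h : c ≤ c') : biasSum p lam f c' ≤ biasSum p lam f c := by
  refine Finset.sum_le_sum fun j _ => mul_le_mul_of_nonneg_left ?_ (sq_nonneg _)
  have := hlam j
  exact shrinkage_anti (by positivity) (by gcongr)

lemma biasSum_le_four_mul {n : ℕ} {p : ℕ} (hp : p ≤ 2) {lam : Fin n → ℝ} (hlam : ∀ j, 0 < lam j)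
    (f : Fin n → ℝ) {c c' : ℝ} (hc : 0 ≤ c) (hc' : 0 ≤ c') (h : c' ≤ 2 * c) :
    biasSum p lam f c ≤ 4 * biasSum p lam f c' := by
  unfold biasSum
  rw [Finset.mul_sum]
  refine Finset.sum_le_sum fun j _ => ?_
  have h0 := hlam j
  have := shrinkage_le_four_mul hp (x := c * lam j) (y := c' * lam j) (by positivity)
    (by positivity) (by nlinarith)
  nlinarith [sq_nonneg (f j)]

/-- The noise is a quadratic plus a linear form. At scale `a` the quadratic one has variance `O(N)`
against a squared threshold of order `N²`; the linear one has variance `O(bias)` against `(bias +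
N)²`. Both ratios are `O(1 / N)`, and `1 / N(a)` decays like `a ^ (-1/m)`, so the dyadic blocks sum
to `O(1 / N(a₀))`. -/
lemma Spectrum.stdPi_noise_le {m δlo δhi : ℝ} (p : ℕ) (hp : p ≤ 2) {δ : ℝ} (hδ : 0 < δ) :
    ∃ C : ℝ, ∀ (n : ℕ) (lam f : Fin n → ℝ) (a₀ : ℝ), 0 < n → 0 < a₀ →
      Spectrum m δlo δhi lam →
      stdPi n {z | ∃ c, a₀ ≤ c ∧
        δ * (biasSum p lam f c + effDim m n c) < |noise p lam f c z|} ≤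
        ENNReal.ofReal (C / effDim m n a₀) := by
  set A := (1 + Real.log (1 + δhi) + 2 * m + δhi ^ 2) * 6 with hA
  set V₁ := Var[fun t => t ^ 2 - 1; gaussianReal 0 1] with hV₁
  set V₂ := Var[fun t : ℝ => t; gaussianReal 0 1] with hV₂
  set r := 1 - (1 / 2 : ℝ) ^ (1 / m) with hr
  refine ⟨4 * V₁ * (16 * A / δ ^ 2) / r + 4 * V₂ * (1024 / δ ^ 2) / r,
    fun n lam f a₀ hn ha₀ hS => ?_⟩
  have hm := hS.one_le
  have hlam := hS.lam_pos
  have hA0 : 0 ≤ A := by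
    have := hS.hi_pos
    have : 0 ≤ Real.log (1 + δhi) := Real.log_nonneg (by linarith)
    positivity
  have hN₀ := effDim_pos (m := m) ha₀ hn
  have hθ : 0 < 1 / m := by positivity
  have hNa : ∀ a, a₀ ≤ a → 1 / effDim m n a = 1 / effDim m n a₀ * (a₀ / a) ^ (1 / m) := by
    intro a ha
    have ha0 : 0 < a := ha₀.trans_le ha
    have h1 := effDim_mul (m := m) (n := n) (K := a / a₀) (by positivity) ha₀.le
    rw [div_mul_cancel₀ _ ha₀.ne'] at h1
    rw [h1, one_div, mul_inv, ← Real.inv_rpow (by positivity), inv_div]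
    ring
  have hr0 : 0 < r := by
    rw [hr, sub_pos]; exact Real.rpow_lt_one (by norm_num) (by norm_num) hθ
  have hmono : ∀ a, a₀ ≤ a → ∀ c ∈ Set.Icc a (2 * a), effDim m n a ≤ effDim m n c :=
    fun a ha c hc => effDim_mono hm (ha₀.le.trans ha) hc.1
  have hdc : ∀ j, ContinuousOn (fun c => -((p : ℝ) * lam j / (1 + c * lam j) ^ (p + 1)))
      (Set.Ici a₀) := fun j => by
    refine ContinuousOn.neg (ContinuousOn.div continuousOn_const (by fun_prop) fun c hc => ?_)
    have : 0 < c := ha₀.trans_le hc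
    have := hlam j
    positivity
  have e1 := stdPi_exists_sum_gt_le (n := n) isCentered_sq_sub_one
    (h := fun j c => ((1 + c * lam j) ^ p)⁻¹ - 1)
    (h' := fun j c => -(p * lam j / (1 + c * lam j) ^ (p + 1)))
    (w := fun j a => 2 * (a * lam j / (1 + a * lam j)))
    (t := fun a => δ / 2 * effDim m n a) (τ := fun c => δ / 2 * effDim m n c)
    (a₀ := a₀) (θ := 1 / m) (B := 16 * A / δ ^ 2 * (1 / effDim m n a₀)) ha₀ hθ
    (fun j c hc => (hasDerivAt_shrinkage (hlam j) (ha₀.trans_le hc)).sub_const 1) hdc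
    (fun j => by fun_prop)
    (fun j a ha => abs_shrinkage_sub_one_le hp (mul_pos (ha₀.trans_le ha) (hlam j)).le)
    (fun j a ha c hc => by
      have ha0 := ha₀.trans_le ha
      have hx := mul_pos ha0 (hlam j)
      refine (abs_deriv_shrinkage_le hp (hlam j) ha0 hc.1).trans ?_
      refine div_le_div_of_nonneg_right ?_ ha0.le
      exact mul_le_of_le_one_right (by positivity) (shrinkage_le_one hx.le))
    (fun a ha => by have := effDim_pos (m := m) (ha₀.trans_le ha) hn; positivity)
    (fun a ha c hc => by have := hmono a ha c hc; gcongr)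
    (fun a ha => by
      have hN := effDim_pos (m := m) (ha₀.trans_le ha) hn
      rw [mul_assoc, ← hNa a ha]
      simp only [mul_pow]
      rw [← Finset.mul_sum]
      have := hS.sum_gain_sq_le (ha₀.trans_le ha) hn
      rw [← hA] at this
      rw [div_le_iff₀ (by positivity)]
      calc _ ≤ 2 ^ 2 * (A * effDim m n a) := by gcongr
        _ = _ := by field_simp; ring)
  have e2 := stdPi_exists_sum_gt_le (n := n) isCentered_id
    (h := fun j c => f j * ((1 + c * lam j) ^ p)⁻¹)
    (h' := fun j c => f j * -(p * lam j / (1 + c * lam j) ^ (p + 1)))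
    (w := fun j a => 2 * (|f j| * ((1 + a * lam j) ^ p)⁻¹))
    -- The bias can drop by a factor 4 across a block, whence 1/16 at the left endpoint and 1/4
    -- inside. The linear form enters the noise with a factor 2, so the two parts add up to at most
    -- `δ * (bias + N)`.
    (t := fun a => δ / 16 * (biasSum p lam f a + effDim m n a))
    (τ := fun c => δ / 4 * (biasSum p lam f c + effDim m n c))
    (a₀ := a₀) (θ := 1 / m) (B := 1024 / δ ^ 2 * (1 / effDim m n a₀)) ha₀ hθ
    (fun j c hc => (hasDerivAt_shrinkage (hlam j) (ha₀.trans_le hc)).const_mul _)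
    (fun j => continuousOn_const.mul (hdc j)) (fun j => by fun_prop)
    (fun j a ha => by
      have hx := mul_pos (ha₀.trans_le ha) (hlam j)
      rw [abs_mul, abs_of_nonneg (show 0 ≤ ((1 + a * lam j) ^ p)⁻¹ by positivity)]
      have : 0 ≤ |f j| * ((1 + a * lam j) ^ p)⁻¹ := by positivity
      linarith)
    (fun j a ha c hc => by
      have ha0 := ha₀.trans_le ha
      have hx := mul_pos ha0 (hlam j)
      rw [abs_mul]
      refine (mul_le_mul_of_nonneg_left (abs_deriv_shrinkage_le hp (hlam j) ha0 hc.1)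
        (abs_nonneg _)).trans ?_
      rw [mul_div_assoc']
      refine div_le_div_of_nonneg_right ?_ ha0.le
      have h1 : a * lam j / (1 + a * lam j) ≤ 1 := (div_le_one (by linarith)).mpr (by linarith)
      have h2 : 0 ≤ |f j| * ((1 + a * lam j) ^ p)⁻¹ := by positivity
      nlinarith)
    (fun a ha => by
      have := effDim_pos (m := m) (ha₀.trans_le ha) hn
      have := biasSum_nonneg p hlam f (ha₀.le.trans ha)
      positivity)
    (fun a ha c hc => by
      have h1 := hmono a ha c hc
      have ha0 := ha₀.trans_le ha
      have h2 := biasSum_le_four_mul hp hlam f ha0.le (ha0.le.trans hc.1) hc.2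
      have h3 := effDim_pos (m := m) ha0 hn
      nlinarith)
    (fun a ha => by
      have ha0 := ha₀.trans_le ha
      have hN := effDim_pos (m := m) ha0 hn
      have hD := biasSum_nonneg p hlam f ha0.le
      rw [mul_assoc, ← hNa a ha]
      have h1 : ∑ j, (2 * (|f j| * ((1 + a * lam j) ^ p)⁻¹)) ^ 2 ≤ 4 * biasSum p lam f a := by
        unfold biasSum
        rw [Finset.mul_sum]
        refine Finset.sum_le_sum fun j _ => ?_
        have hx := mul_pos ha0 (hlam j)
        have hb := shrinkage_le_one (p := p) hx.le
        have hb0 : 0 ≤ ((1 + a * lam j) ^ p)⁻¹ := by positivity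
        rw [mul_pow, mul_pow, sq_abs]
        have h4 : (((1 + a * lam j) ^ p)⁻¹) ^ 2 ≤ ((1 + a * lam j) ^ p)⁻¹ := by nlinarith
        nlinarith [mul_le_mul_of_nonneg_left h4 (sq_nonneg (f j))]
      rw [div_le_iff₀ (by positivity)]
      refine h1.trans ?_
      have h2 : 1024 / δ ^ 2 * (1 / effDim m n a) *
          (δ / 16 * (biasSum p lam f a + effDim m n a)) ^ 2 =
          4 * ((biasSum p lam f a + effDim m n a) ^ 2 / effDim m n a) := by
        field_simp
        ring
      rw [h2]
      refine mul_le_mul_of_nonneg_left ?_ (by norm_num)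
      rw [le_div_iff₀ hN]
      nlinarith)
  refine le_trans (measure_mono ?_) ((measure_union_le _ _).trans (add_le_add e1 e2) |>.trans
    (le_of_eq ?_))
  · rintro z ⟨c, hc, hcz⟩
    by_contra hcon
    simp only [Set.mem_union, Set.mem_ofPred_eq, not_or, not_exists, not_and, not_lt] at hcon
    have h1 := hcon.1 c hc
    have h2 := hcon.2 c hc
    have h3 : |noise p lam f c z| ≤ _ := abs_add_le _ _
    rw [abs_mul, abs_of_pos (show (0 : ℝ) < 2 by norm_num)] at h3
    have hN := effDim_pos (m := m) (ha₀.trans_le hc) hn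
    have hD := biasSum_nonneg p hlam f (ha₀.le.trans hc)
    have : 0 ≤ δ * biasSum p lam f c := by positivity
    nlinarith
  · have hV₁0 : 0 ≤ V₁ := variance_nonneg _ _
    have hV₂0 : 0 ≤ V₂ := variance_nonneg _ _
    rw [← ENNReal.ofReal_add (by positivity) (by positivity)]
    congr 1
    ring

/-! ### Polished tails -/

/-- The discrete polished tail condition for a vector of coordinates. -/
def IsPolished {n : ℕ} (L ρ : ℝ) (k₀ : ℕ) (f : Fin n → ℝ) : Prop :=
  ∀ k : ℕ, k₀ ≤ k →
    ∑ j ∈ Finset.univ.filter (fun j : Fin n => k ≤ (j : ℕ) + 1), f j ^ 2 ≤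
      L * ∑ j ∈ Finset.univ.filter (fun j : Fin n => k ≤ (j : ℕ) + 1 ∧ (j : ℝ) + 1 ≤ ρ * k),
        f j ^ 2

/-- The energy of the coordinates with number at least `k`. -/
noncomputable def tailSum {n : ℕ} (f : Fin n → ℝ) (k : ℕ) : ℝ :=
  ∑ j ∈ Finset.univ.filter (fun j : Fin n => k ≤ (j : ℕ) + 1), f j ^ 2

/-- The block from `k` to `ρ k` carries at least the fraction `1 / L` of the energy beyond `k`, and
all of this block lies before `R * k`. -/
lemma IsPolished.tailSum_mul_le {n : ℕ} {L ρ : ℝ} {k₀ : ℕ} {f : Fin n → ℝ}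
    (h : IsPolished L ρ k₀ f) (hL : 1 ≤ L) {R : ℕ} (hR1 : 1 ≤ R) (hR : ρ < R) {k : ℕ} (hk : k₀ ≤ k)
    (hk1 : 1 ≤ k) : tailSum f (R * k) ≤ (1 - 1 / L) * tailSum f k := by
  have h1 := h k hk
  have h2 : ∑ j ∈ Finset.univ.filter (fun j : Fin n => k ≤ (j : ℕ) + 1 ∧ (j : ℝ) + 1 ≤ ρ * k),
        f j ^ 2 + tailSum f (R * k) ≤ tailSum f k := by
    unfold tailSum
    rw [← Finset.sum_union]
    · refine Finset.sum_le_sum_of_subset_of_nonneg (fun j hj => ?_) fun _ _ _ => sq_nonneg _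
      simp only [Finset.mem_union, Finset.mem_filter, Finset.mem_univ, true_and] at hj ⊢
      rcases hj with hj | hj
      · exact hj.1
      · exact (Nat.le_mul_of_pos_left k hR1).trans hj
    · rw [Finset.disjoint_left]
      intro j hj hj'
      simp only [Finset.mem_filter, Finset.mem_univ, true_and] at hj hj'
      have h3 : ((R * k : ℕ) : ℝ) ≤ ((j + 1 : ℕ) : ℝ) := by exact_mod_cast hj'
      push_cast at h3
      have h4 : (0 : ℝ) < k := by exact_mod_cast hk1
      nlinarith [hj.2]
  have h5 : tailSum f k ≤ L * (tailSum f k - tailSum f (R * k)) := by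
    refine le_trans h1 (mul_le_mul_of_nonneg_left (by linarith) (by linarith))
  have hL0 : 0 < L := by linarith
  have : (1 - 1 / L) * tailSum f k = (L * tailSum f k - tailSum f k) / L := by field_simp
  rw [this, le_div_iff₀ hL0]
  linarith

lemma IsPolished.tailSum_pow_mul_le {n : ℕ} {L ρ : ℝ} {k₀ : ℕ} {f : Fin n → ℝ}
    (h : IsPolished L ρ k₀ f) (hL : 1 ≤ L) {R : ℕ} (hR1 : 1 ≤ R) (hR : ρ < R) {k : ℕ} (hk : k₀ ≤ k)
    (hk1 : 1 ≤ k) (r : ℕ) : tailSum f (R ^ r * k) ≤ (1 - 1 / L) ^ r * tailSum f k := by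
  induction r with
  | zero => simp
  | succ r ih =>
    have hkr : k ≤ R ^ r * k := Nat.le_mul_of_pos_left k (Nat.pow_pos hR1)
    have h1 := h.tailSum_mul_le hL hR1 hR (hk.trans hkr) (hk1.trans hkr)
    have h2 : 0 ≤ 1 - 1 / L := by
      rw [sub_nonneg, div_le_one (by linarith)]; exact hL
    calc tailSum f (R ^ (r + 1) * k) = tailSum f (R * (R ^ r * k)) := by ring_nf
      _ ≤ (1 - 1 / L) * tailSum f (R ^ r * k) := h1
      _ ≤ (1 - 1 / L) * ((1 - 1 / L) ^ r * tailSum f k) := by gcongr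
      _ = _ := by ring

/-- For polished tail signals, the bias decreases by any given factor if the scale is multiplied
by a sufficiently large constant. -/
lemma exists_biasSum_mul_le {m δlo δhi L ρ : ℝ} (hm : 1 ≤ m) (hδ : 0 < δlo) (hδhi : 0 < δhi)
    (hL : 1 ≤ L) (k₀ : ℕ) {p : ℕ} (hp : 1 ≤ p) {ε : ℝ} (hε : 0 < ε) (hε1 : ε ≤ 1) :
    ∃ K₀ : ℝ, 1 ≤ K₀ ∧ ∀ K, K₀ ≤ K → ∀ (n : ℕ) (lam f : Fin n → ℝ) (c : ℝ),
      Spectrum m δlo δhi lam → IsPolished L ρ k₀ f → 0 < c → 1 ≤ effDim m n c →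
      (k₀ : ℝ) ≤ effDim m n c → biasSum p lam f (K * c) ≤ ε * biasSum p lam f c := by
  obtain ⟨R₀, hR₀⟩ := exists_nat_gt ρ
  set R := R₀ + 1 with hRdef
  have hR1 : 1 ≤ R := by omega
  have hR : ρ < R := hR₀.trans (by simp [hRdef])
  have hq0 : 0 ≤ 1 - 1 / L := by
    rw [sub_nonneg, div_le_one (by linarith)]; exact hL
  have hq1 : 1 - 1 / L < 1 := by
    have : 0 < 1 / L := by positivity
    linarith
  -- After `r` blocks the remaining energy is negligible even after multiplication by `(1 + δhi) ^
  -- p`, the loss in comparing tail energy with the bias at scale `c`.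
  obtain ⟨r, hr⟩ := exists_pow_lt_of_lt_one
    (show 0 < ε / 2 / (1 + δhi) ^ p by positivity) hq1
  rw [lt_div_iff₀ (by positivity)] at hr
  -- Indices below `R ^ r * k` are at most `T * N`, since `k = ⌈N⌉ ≤ 2 * N`.
  set T : ℝ := 2 * R ^ r with hT
  have hT0 : 0 < T := by positivity
  refine ⟨max 1 ((1 + T ^ m / δlo) / (ε / 2)), le_max_left _ _,
    fun K hK n lam f c hS hf hc hN1 hNk => ?_⟩
  have hK1 : 1 ≤ K := (le_max_left _ _).trans hK
  have hK2 : (1 + T ^ m / δlo) ≤ ε / 2 * K := by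
    have := (le_max_right _ _).trans hK
    rw [div_le_iff₀ (by positivity)] at this
    linarith
  set N := effDim m n c with hN
  set k := ⌈N⌉₊ with hk
  have hkN : N ≤ k := Nat.le_ceil N
  have hk2 : (k : ℝ) ≤ 2 * N := by
    have := Nat.ceil_lt_add_one (show 0 ≤ N by linarith)
    linarith
  have hk1 : 1 ≤ k := by exact_mod_cast hN1.trans hkN
  have hkk : k₀ ≤ k := by exact_mod_cast hNk.trans hkN
  set S : Finset (Fin n) := Finset.univ.filter fun j : Fin n => R ^ r * k ≤ (j : ℕ) + 1 with hSdef
  have htail : ∑ j ∈ S, f j ^ 2 * ((1 + K * c * lam j) ^ p)⁻¹ ≤ ε / 2 * biasSum p lam f c := by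
    calc ∑ j ∈ S, f j ^ 2 * ((1 + K * c * lam j) ^ p)⁻¹ ≤ ∑ j ∈ S, f j ^ 2 := by
          refine Finset.sum_le_sum fun j _ => mul_le_of_le_one_right (sq_nonneg _) ?_
          exact shrinkage_le_one (by have := hS.lam_pos j; positivity)
      _ = tailSum f (R ^ r * k) := rfl
      _ ≤ (1 - 1 / L) ^ r * tailSum f k := hf.tailSum_pow_mul_le hL hR1 hR hkk hk1 r
      _ ≤ (1 - 1 / L) ^ r * ((1 + δhi) ^ p * biasSum p lam f c) := by
          refine mul_le_mul_of_nonneg_left ?_ (by positivity)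
          unfold tailSum biasSum
          rw [Finset.mul_sum]
          refine (Finset.sum_le_sum fun j hj => ?_).trans
            (Finset.sum_le_sum_of_subset_of_nonneg (Finset.subset_univ _) fun j _ _ => ?_)
          · simp only [Finset.mem_filter, Finset.mem_univ, true_and] at hj
            have hj0 : (0 : ℝ) < (j : ℝ) + 1 := by positivity
            -- Beyond `N` the signal-to-noise ratio is at most `δhi`, so there the bias at scale `c`
            -- still retains a fixed fraction of the energy.
            have hjN : N ≤ (j : ℝ) + 1 := hkN.trans (by exact_mod_cast hj)
            have hx : c * lam j ≤ δhi := by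
              refine (hS.snr_le hc j).trans (mul_le_of_le_one_right hδhi.le ?_)
              exact Real.rpow_le_one (by positivity) ((div_le_one hj0).mpr hjN) (by linarith)
            have hx0 := hS.snr_pos hc j
            have h1 : 1 ≤ (1 + δhi) ^ p * ((1 + c * lam j) ^ p)⁻¹ := by
              rw [← div_eq_mul_inv, one_le_div (by positivity)]
              gcongr
            nlinarith [sq_nonneg (f j)]
          · have := hS.snr_pos hc j
            positivity
      _ = (1 - 1 / L) ^ r * (1 + δhi) ^ p * biasSum p lam f c := by ring
      _ ≤ _ := mul_le_mul_of_nonneg_right hr.le (biasSum_nonneg p hS.lam_pos f hc.le)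
  have hhead : ∑ j ∈ Sᶜ, f j ^ 2 * ((1 + K * c * lam j) ^ p)⁻¹ ≤ ε / 2 * biasSum p lam f c := by
    unfold biasSum
    rw [Finset.mul_sum]
    refine (Finset.sum_le_sum fun j hj => ?_).trans
      (Finset.sum_le_sum_of_subset_of_nonneg (Finset.subset_univ _) fun j _ _ => ?_)
    · simp only [hSdef, Finset.mem_compl, Finset.mem_filter, Finset.mem_univ, true_and,
        not_le] at hj
      have hj0 : (0 : ℝ) < (j : ℝ) + 1 := by positivity
      have hjT : (j : ℝ) + 1 ≤ T * N := by
        have h1 : ((j + 1 : ℕ) : ℝ) ≤ ((R ^ r * k : ℕ) : ℝ) := by exact_mod_cast hj.le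
        push_cast at h1
        have h2 : (R : ℝ) ^ r * k ≤ R ^ r * (2 * N) := by gcongr
        rw [hT]; linarith
      have hx0 := hS.snr_pos hc j
      have hx : δlo / T ^ m ≤ c * lam j := by
        refine le_trans ?_ (hS.snr_ge hc j)
        rw [div_eq_mul_inv, ← Real.inv_rpow hT0.le]
        gcongr
        rw [inv_eq_one_div, div_le_div_iff₀ hT0 hj0]
        linarith
      have hTm : 0 < T ^ m := by positivity
      -- In the head the signal-to-noise ratio is at least `δlo / T ^ m`; `K₀` is chosen so that
      -- multiplying such a ratio by `K` beats the added 1.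
      have h1 : 1 + c * lam j ≤ ε / 2 * (1 + K * c * lam j) := by
        rw [div_le_iff₀ hTm] at hx
        have h2 : 1 ≤ T ^ m / δlo * (c * lam j) := by
          rw [div_mul_eq_mul_div, le_div_iff₀ hδ]; linarith
        have h3 := mul_le_mul_of_nonneg_right hK2 hx0.le
        nlinarith
      have h4 : (1 + c * lam j) ^ p ≤ ε / 2 * (1 + K * c * lam j) ^ p := by
        have hKx : 0 < K * c * lam j := by rw [mul_assoc]; positivity
        calc (1 + c * lam j) ^ p ≤ (ε / 2 * (1 + K * c * lam j)) ^ p := by gcongr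
          _ = (ε / 2) ^ p * (1 + K * c * lam j) ^ p := mul_pow _ _ _
          _ ≤ _ := by
            gcongr
            exact pow_le_of_le_one (by positivity) (by linarith) (by omega)
      have h5 : ((1 + K * c * lam j) ^ p)⁻¹ ≤ ε / 2 * ((1 + c * lam j) ^ p)⁻¹ := by
        have hKx : 0 < K * c * lam j := by rw [mul_assoc]; positivity
        rw [← div_eq_mul_inv, inv_eq_one_div, div_le_div_iff₀ (by positivity) (by positivity)]
        linarith
      nlinarith [sq_nonneg (f j)]
    · have := hS.snr_pos hc j
      positivity
  have hsplit : biasSum p lam f (K * c) = ∑ j ∈ S, f j ^ 2 * ((1 + K * c * lam j) ^ p)⁻¹ +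
      ∑ j ∈ Sᶜ, f j ^ 2 * ((1 + K * c * lam j) ^ p)⁻¹ := by
    rw [Finset.sum_add_sum_compl]; rfl
  rw [hsplit]
  linarith

/-! ### The expected criterion and its decrease at a larger scale. -/

/-- The expected criterion, up to a constant; the term with `l` stems from the prior of the
scale. -/
noncomputable def meanCrit {n : ℕ} (p : ℕ) (l : ℝ) (lam f : Fin n → ℝ) (c : ℝ) : ℝ :=
  biasSum p lam f c + l / c + varSum p lam c

/-- If the bias at a scale dominates the effective dimension, then another scale has a much
smaller expected criterion. -/
lemma exists_meanCrit_le {m δlo δhi L ρ l : ℝ} (hm : 1 ≤ m) (hδ : 0 < δlo) (hδhi : 0 < δhi)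
    (hL : 1 ≤ L) (hl : 0 ≤ l) (k₀ : ℕ) {p : ℕ} (hp : 1 ≤ p) {ε : ℝ} (hε : 0 < ε) (hε1 : ε ≤ 1) :
    ∃ A : ℝ, 0 < A ∧ ∀ (n : ℕ) (lam f : Fin n → ℝ) (c : ℝ),
      Spectrum m δlo δhi lam → IsPolished L ρ k₀ f → ∑ j, f j ^ 2 ≤ n → 0 < n → 0 < c →
      c ≤ (n : ℝ) ^ (m - 1) → 1 ≤ effDim m n c → (k₀ : ℝ) ≤ effDim m n c →
      A * effDim m n c < biasSum p lam f c + l / c →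
      ∃ c', c ≤ c' ∧ c' ≤ (n : ℝ) ^ (m - 1) ∧
        meanCrit p l lam f c' ≤ ε * meanCrit p l lam f c := by
  obtain ⟨K₀, hK₀, hdecay⟩ := exists_biasSum_mul_le (ρ := ρ) hm hδ hδhi hL k₀ hp (half_pos hε)
    (by linarith)
  set K := max K₀ (2 / ε) with hK
  have hK1 : 1 ≤ K := hK₀.trans (le_max_left _ _)
  have hK0 : 0 < K := by linarith
  set CV := (1 + Real.log (1 + δhi) + 2 * m + δhi ^ 2) * 6 with hCV
  have hCV0 : 0 < CV := by
    have : 0 ≤ Real.log (1 + δhi) := Real.log_nonneg (by linarith)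
    positivity
  -- The first two summands keep `K * c` inside the scale interval; the third makes the variance
  -- part at `K * c` at most `ε / 2` times the bias and prior terms at `c`.
  refine ⟨K ^ (1 / m) + l * K + CV * K ^ (1 / m) * (2 / ε), by positivity,
    fun n lam f c hS hf hfn hn hc hcn hN1 hNk hA => ?_⟩
  have hn1 : (1 : ℝ) ≤ n := by exact_mod_cast hn
  set N := effDim m n c with hN
  have hN0 : 0 < N := by linarith
  have hKm : 0 < K ^ (1 / m) := by positivity
  have hbias : biasSum p lam f c ≤ n := by
    refine le_trans (Finset.sum_le_sum fun j _ => ?_) hfn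
    exact mul_le_of_le_one_right (sq_nonneg _) (shrinkage_le_one (hS.snr_pos hc j).le)
  -- Otherwise `n ≤ K ^ (1/m) * N`. The bias is at most the total energy, hence at most `n`, and `l
  -- / c ≤ l * K * N`, which contradicts the assumed excess over `A * N`.
  have hKc : K * c ≤ (n : ℝ) ^ (m - 1) := by
    by_contra hcon
    rw [not_le] at hcon
    have h1 : (n : ℝ) ≤ K ^ (1 / m) * N := by
      rw [hN, ← effDim_mul hK0.le hc.le]
      unfold effDim
      have h2 : (n : ℝ) = ((n : ℝ) ^ (m - 1) * n) ^ (1 / m) := by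
        have hn0 : (0 : ℝ) < n := by linarith
        rw [← Real.rpow_add_one hn0.ne', sub_add_cancel, ← Real.rpow_mul hn0.le,
          mul_one_div_cancel (by linarith), Real.rpow_one]
      conv_lhs => rw [h2]
      gcongr
    have h3 : l / c ≤ l * K * N := by
      rw [div_le_iff₀ hc]
      have h4 : 1 ≤ K * c := by
        refine le_trans ?_ hcon.le
        exact Real.one_le_rpow hn1 (by linarith)
      have : l * 1 ≤ l * (K * c) := by gcongr
      have : l * (K * c) * 1 ≤ l * (K * c) * N := by gcongr
      linarith
    have h5 : 0 < CV * K ^ (1 / m) * (2 / ε) * N := by positivity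
    linarith
  refine ⟨K * c, le_mul_of_one_le_left hc.le hK1, hKc, ?_⟩
  have h1 := hdecay K (le_max_left _ _) n lam f c hS hf hc hN1 hNk
  have h2 : l / (K * c) ≤ ε / 2 * (l / c) := by
    rw [div_mul_eq_div_div_swap, div_le_iff₀ hK0]
    have h3 : 1 ≤ ε / 2 * K := by
      have := le_max_right K₀ (2 / ε)
      rw [← hK, div_le_iff₀ hε] at this
      linarith
    have h4 : 0 ≤ l / c := by positivity
    nlinarith
  have h3 := hS.varSum_le p (show 0 < K * c by positivity) hn
  rw [effDim_mul hK0.le hc.le, ← hCV, ← hN] at h3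
  have h4 : CV * (K ^ (1 / m) * N) ≤ ε / 2 * (biasSum p lam f c + l / c) := by
    have h5 : CV * K ^ (1 / m) * (2 / ε) * N ≤ biasSum p lam f c + l / c := by
      have : 0 ≤ (K ^ (1 / m) + l * K) * N := by positivity
      linarith
    have h6 : CV * (K ^ (1 / m) * N) = ε / 2 * (CV * K ^ (1 / m) * (2 / ε) * N) := by
      field_simp
    rw [h6]
    gcongr
  have h5 : 0 ≤ varSum p lam c :=
    Finset.sum_nonneg fun j _ => varTerm_nonneg p (hS.snr_pos hc j).le
  unfold meanCrit
  nlinarith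

/-! ### The good event -/

/-- The event that the stochastic parts of the criteria are uniformly small. -/
def GoodNoise (m : ℝ) (p : ℕ) (δ : ℝ) {n : ℕ} (lam f z : Fin n → ℝ) : Prop :=
  ∀ c, Real.log n / n ≤ c →
    |noise p lam f c z| ≤ δ * (biasSum p lam f c + effDim m n c) ∧
    |noise 1 lam 0 c z| ≤ effDim m n c ∧ |noise 2 lam 0 c z| ≤ effDim m n c

lemma effDim_log_div (m : ℝ) {n : ℕ} (hn : 0 < n) :
    effDim m n (Real.log n / n) = Real.log n ^ (1 / m) := by
  unfold effDim
  rw [div_mul_cancel₀]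
  positivity

/-- The left endpoint `log n / n` has effective dimension `(log n) ^ (1/m)`, which tends to infinity
and makes the bound of `Spectrum.stdPi_noise_le` vanish. -/
lemma Spectrum.stdPi_not_goodNoise_le {m δlo δhi : ℝ} (p : ℕ) (hp : p ≤ 2) {δ : ℝ} (hδ : 0 < δ) :
    ∃ C : ℝ, ∀ (n : ℕ) (lam f : Fin n → ℝ), 2 ≤ n → Spectrum m δlo δhi lam →
      stdPi n {z | ¬ GoodNoise m p δ lam f z} ≤ ENNReal.ofReal (C / Real.log n ^ (1 / m)) := by
  obtain ⟨C₁, h₁⟩ := Spectrum.stdPi_noise_le (m := m) (δlo := δlo) (δhi := δhi) p hp hδ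
  obtain ⟨C₂, h₂⟩ := Spectrum.stdPi_noise_le (m := m) (δlo := δlo) (δhi := δhi) 1 one_le_two
    one_pos
  obtain ⟨C₃, h₃⟩ := Spectrum.stdPi_noise_le (m := m) (δlo := δlo) (δhi := δhi) 2 le_rfl
    one_pos
  refine ⟨max C₁ 0 + max C₂ 0 + max C₃ 0, fun n lam f hn hS => ?_⟩
  have hn0 : 0 < n := by omega
  have hlog : 0 < Real.log n := Real.log_pos (by exact_mod_cast hn)
  have ha : 0 < Real.log n / n := by positivity
  have e₁ := h₁ n lam f _ hn0 ha hS
  have e₂ := h₂ n lam 0 _ hn0 ha hS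
  have e₃ := h₃ n lam 0 _ hn0 ha hS
  have hD : 0 < Real.log n ^ (1 / m) := by positivity
  rw [effDim_log_div m hn0] at e₁ e₂ e₃
  refine (measure_mono (t := ({z | ∃ c, Real.log n / n ≤ c ∧
        δ * (biasSum p lam f c + effDim m n c) < |noise p lam f c z|} ∪
      {z | ∃ c, Real.log n / n ≤ c ∧
        1 * (biasSum 1 lam 0 c + effDim m n c) < |noise 1 lam 0 c z|}) ∪
      {z | ∃ c, Real.log n / n ≤ c ∧
        1 * (biasSum 2 lam 0 c + effDim m n c) < |noise 2 lam 0 c z|}) fun z hz => ?_).trans ?_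
  · by_contra hcon
    simp only [Set.mem_union, Set.mem_ofPred_eq, not_or, not_exists, not_and, not_lt] at hcon
    refine hz fun c hc => ⟨hcon.1.1 c hc, ?_, ?_⟩
    · simpa [biasSum] using hcon.1.2 c hc
    · simpa [biasSum] using hcon.2 c hc
  · refine (measure_union_le _ _).trans ((add_le_add ((measure_union_le _ _).trans
      (add_le_add e₁ e₂)) e₃).trans ?_)
    calc _ ≤ ENNReal.ofReal (max C₁ 0 / Real.log n ^ (1 / m)) +
          ENNReal.ofReal (max C₂ 0 / Real.log n ^ (1 / m)) +
          ENNReal.ofReal (max C₃ 0 / Real.log n ^ (1 / m)) := by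
            gcongr <;> exact le_max_left _ _
      _ = _ := by
        rw [← ENNReal.ofReal_add (by positivity) (by positivity),
          ← ENNReal.ofReal_add (by positivity) (by positivity)]
        congr 1
        ring

lemma GoodNoise.sum_gain_sq_mul_le {m δlo δhi δ : ℝ} {p n : ℕ} {lam f z : Fin n → ℝ}
    (h : GoodNoise m p δ lam f z) (hS : Spectrum m δlo δhi lam) (hn : 0 < n) {c : ℝ}
    (hc : Real.log n / n ≤ c) (hc0 : 0 < c) :
    ∑ j, (c * lam j / (1 + c * lam j)) ^ 2 * z j ^ 2 ≤
      ((1 + Real.log (1 + δhi) + 2 * m + δhi ^ 2) * 6 + 3) * effDim m n c := by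
  -- With `s = (1 + c λ)⁻¹`, the squared gain is `(s² - 1) - 2 (s - 1)`, so the fluctuation of this
  -- sum is a combination of the two noises for zero signal. The good event controls these for this
  -- purpose.
  have h1 : ∑ j, (c * lam j / (1 + c * lam j)) ^ 2 * z j ^ 2 =
      ∑ j, (c * lam j / (1 + c * lam j)) ^ 2 + (noise 2 lam 0 c z - 2 * noise 1 lam 0 c z) := by
    unfold noise
    simp only [Pi.zero_apply, zero_mul, Finset.sum_const_zero, mul_zero, add_zero]
    rw [Finset.mul_sum, ← Finset.sum_sub_distrib, ← Finset.sum_add_distrib]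
    refine Finset.sum_congr rfl fun j _ => ?_
    have := hS.snr_pos hc0 j
    field_simp
    ring
  rw [h1]
  have h2 := hS.sum_gain_sq_le hc0 hn
  have h3 := abs_le.mp (h c hc).2.1
  have h4 := abs_le.mp (h c hc).2.2
  linarith [h3.1, h4.2]

/-! ### The criteria as functions of the noise -/

/-- The noise contributes `(1 + c λ)⁻¹` on average, that is, 1 minus the gain. The gain is
subtracted from the logarithm in `varTerm`, and the 1 joins the part free of `c`. -/
lemma likSum_add {n : ℕ} {lam : Fin n → ℝ} (hlam : ∀ j, 0 < lam j) (f z : Fin n → ℝ) {c : ℝ}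
    (hc : 0 < c) :
    likSum lam (fun j => f j + z j) c = (n + ∑ j, (z j ^ 2 - 1)) +
      (biasSum 1 lam f c + varSum 1 lam c + noise 1 lam f c z) := by
  have hn : (n : ℝ) = ∑ j : Fin n, 1 := by simp
  unfold likSum biasSum varSum noise varTerm
  rw [hn, Finset.mul_sum, ← Finset.sum_add_distrib, ← Finset.sum_add_distrib,
    ← Finset.sum_add_distrib, ← Finset.sum_add_distrib, ← Finset.sum_add_distrib]
  refine Finset.sum_congr rfl fun j _ => ?_
  have := mul_pos hc (hlam j)
  simp only [if_true, pow_one]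
  field_simp
  ring

lemma riskSum_add {n : ℕ} {lam : Fin n → ℝ} (hlam : ∀ j, 0 < lam j) (f z : Fin n → ℝ) {c : ℝ}
    (hc : 0 < c) :
    ∑ j, ((1 - (1 + c * lam j)⁻¹) ^ 2 - ((1 + c * lam j)⁻¹) ^ 2 +
      ((1 + c * lam j)⁻¹) ^ 2 * (f j + z j) ^ 2) = ∑ j, (z j ^ 2 - 1) +
      (biasSum 2 lam f c + varSum 2 lam c + noise 2 lam f c z) := by
  unfold biasSum varSum noise varTerm
  rw [Finset.mul_sum, ← Finset.sum_add_distrib, ← Finset.sum_add_distrib,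
    ← Finset.sum_add_distrib, ← Finset.sum_add_distrib]
  refine Finset.sum_congr rfl fun j _ => ?_
  have := mul_pos hc (hlam j)
  rw [if_neg (by norm_num)]
  field_simp
  ring

lemma inner_restr_add {X : Type*} {n : ℕ} (x : Fin n → X) (f : X → ℝ)
    (e : OrthonormalBasis (Fin n) ℝ (Vec n)) (z : Fin n → ℝ) (j : Fin n) :
    inner ℝ (e j) (restr x f + coordMap e z) = coef x e f j + z j := by
  rw [inner_add_right, inner_coordMap]; rfl

/-- The affine coordinate map is a measurable embedding, so the identity holds for every set. No
measurability of the coverage or diameter events is needed. -/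
lemma dataLaw_apply {X : Type*} {n : ℕ} (x : Fin n → X) (f : X → ℝ)
    (e : OrthonormalBasis (Fin n) ℝ (Vec n)) (s : Set (Vec n)) :
    dataLaw x f s = stdPi n {z | restr x f + coordMap e z ∈ s} := by
  have hemb : MeasurableEmbedding fun z => restr x f + coordMap e z := by
    refine MeasurableEmbedding.of_measurable_inverse (g := fun y j => inner ℝ (e j) (y - restr x f))
      (by fun_prop) ?_ (by fun_prop) fun z => ?_
    · rw [Set.range_eq_univ.mpr]
      · exact MeasurableSet.univ
      · intro y
        refine ⟨fun j => inner ℝ (e j) (y - restr x f), ?_⟩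
        simp only [coordMap_inner, add_sub_cancel]
    · funext j
      simp [inner_coordMap]
  rw [dataLaw_eq_map x f e, hemb.map_apply]
  rfl

/-! ### The scale interval -/

lemma scale_pos {m c : ℝ} {n : ℕ} (hn : 2 ≤ n) (hc : c ∈ scaleInterval m n) : 0 < c := by
  have hlog : 0 < Real.log n := Real.log_pos (by exact_mod_cast hn)
  have hn0 : (0 : ℝ) < n := by positivity
  exact lt_of_lt_of_le (by positivity) hc.1

lemma effDim_le_of_le {m c : ℝ} {n : ℕ} (hm : 1 ≤ m) (hn : 0 < n) (hc0 : 0 < c)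
    (hc : c ≤ (n : ℝ) ^ (m - 1)) : effDim m n c ≤ n := by
  have hn0 : (0 : ℝ) < n := by exact_mod_cast hn
  have h2 : (n : ℝ) = ((n : ℝ) ^ (m - 1) * n) ^ (1 / m) := by
    rw [← Real.rpow_add_one hn0.ne', sub_add_cancel, ← Real.rpow_mul hn0.le,
      mul_one_div_cancel (by linarith), Real.rpow_one]
  conv_rhs => rw [h2]
  unfold effDim
  gcongr

lemma log_rpow_le_effDim {m c : ℝ} {n : ℕ} (hm : 1 ≤ m) (hn : 2 ≤ n)
    (hc : Real.log n / n ≤ c) : Real.log n ^ (1 / m) ≤ effDim m n c := by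
  rw [← effDim_log_div m (show 0 < n by omega)]
  have hlog : 0 < Real.log n := Real.log_pos (by exact_mod_cast hn)
  exact effDim_mono hm (by positivity) hc

/-! ### Estimation error and credible balls -/

namespace EigenModel

variable {X Ω : Type*} [MeasurableSpace Ω] {n : ℕ} {P : Measure Ω}
    [IsProbabilityMeasure P] {W : X → Ω → ℝ} {x : Fin n → X}
    {e : OrthonormalBasis (Fin n) ℝ (Vec n)} {lam : Fin n → ℝ} {c : ℝ}

lemma norm_restr_sub_postMean_sq_le (hM : EigenModel P W x e lam) (hc : 0 < c) (f : X → ℝ)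
    (z : Fin n → ℝ) :
    ‖restr x f - postMean P W x c (restr x f + coordMap e z)‖ ^ 2 ≤
      2 * biasSum 2 lam (coef x e f) c +
        2 * ∑ j, (c * lam j / (1 + c * lam j)) ^ 2 * z j ^ 2 := by
  have h1 : restr x f = coordMap e (coef x e f) := (coordMap_inner e _).symm
  rw [hM.postMean_eq hc]
  simp only [inner_restr_add]
  conv_lhs => rw [h1]
  rw [coordMap_sub, norm_coordMap_sq]
  unfold biasSum
  rw [Finset.mul_sum, Finset.mul_sum, ← Finset.sum_add_distrib]
  refine Finset.sum_le_sum fun j _ => ?_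
  have hx := mul_pos hc (hM.pos j)
  simp only [Pi.sub_apply]
  have h2 : coef x e f j - c * lam j / (1 + c * lam j) * (coef x e f j + z j) =
      coef x e f j * (1 + c * lam j)⁻¹ - c * lam j / (1 + c * lam j) * z j := by
    field_simp
    ring
  rw [h2, ← inv_pow, ← mul_pow, ← mul_pow]
  nlinarith [sq_nonneg (coef x e f j * (1 + c * lam j)⁻¹ + c * lam j / (1 + c * lam j) * z j)]

end EigenModel

/-- The estimation error always involves the bias with exponent 2; the bias in either criterion
dominates it. -/
lemma biasSum_two_le {n : ℕ} {p : ℕ} (hp : p ≤ 2) {lam : Fin n → ℝ} (hlam : ∀ j, 0 < lam j)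
    (f : Fin n → ℝ) {c : ℝ} (hc : 0 < c) : biasSum 2 lam f c ≤ biasSum p lam f c := by
  refine Finset.sum_le_sum fun j _ => mul_le_mul_of_nonneg_left ?_ (sq_nonneg _)
  have := mul_pos hc (hlam j)
  gcongr
  linarith

/-- If the bias is dominated by the effective dimension, then the true function belongs to the
credible ball, on the good event. -/
lemma exists_forall_mem_ballSet {m δlo δhi A : ℝ} (hm : 1 ≤ m) (hδ : 0 < δlo) (hδhi : 0 < δhi)
    (hA : 0 ≤ A) :
    ∃ M₀ : ℝ, 0 < M₀ ∧ ∀ M, M₀ ≤ M → ∀ η, 0 < η → η < 1 → ∃ N₀ : ℝ,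
      ∀ {X Ω : Type*} [MeasurableSpace Ω] {n : ℕ} {P : Measure Ω} [IsProbabilityMeasure P]
        {W : X → Ω → ℝ} {x : Fin n → X} {e : OrthonormalBasis (Fin n) ℝ (Vec n)}
        {lam : Fin n → ℝ} {c δ : ℝ} {p : ℕ} (f : X → ℝ) (z : Fin n → ℝ),
        EigenModel P W x e lam → Spectrum m δlo δhi lam → 2 ≤ n → c ∈ scaleInterval m n →
        p ≤ 2 → 1 ≤ effDim m n c → N₀ ≤ effDim m n c →
        GoodNoise m p δ lam (coef x e f) z →
        biasSum p lam (coef x e f) c ≤ A * effDim m n c →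
        f ∈ ballSet P W x M η c (restr x f + coordMap e z) := by
  set CV := (1 + Real.log (1 + δhi) + 2 * m + δhi ^ 2) * 6 with hCV
  have hCV0 : 0 < CV := by
    have : 0 ≤ Real.log (1 + δhi) := Real.log_nonneg (by linarith)
    positivity
  set a := (δlo / (1 + δlo)) ^ 2 / 4 with ha
  have ha0 : 0 < a := by positivity
  set Q := 2 * A + 2 * (CV + 3) with hQ
  have hQ0 : 0 < Q := by positivity
  -- The squared error is at most `Q * N` and the squared radius at least `a * N / 2`. Neither
  -- constant depends on `η`, so neither does `M₀`.
  refine ⟨√(2 * Q / a) + 1, by positivity, fun M hMM η hη hη1 => ?_⟩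
  have hmin : 0 < min η (1 - η) := lt_min hη (by linarith)
  have hchi := chiVar_nonneg
  -- Only the size of `N` from which the radius bounds hold depends on `η`.
  refine ⟨4 * chiVar / (a * min η (1 - η)) + 1, ?_⟩
  intro X Ω _ n P _ W x e lam c δ p f z hM hS hn hc hp hN1 hN₀ hG hb
  have hc0 := scale_pos hn hc
  set N := effDim m n c with hN
  set T := ∑ i, c * lam i / (1 + c * lam i) with hT
  have hTN : a * N ≤ T := by
    have h1 := hS.varSum_ge 2 hc0 hN1 (effDim_le_of_le hm (by omega) hc0 hc.2)
    refine h1.trans (le_trans (le_of_eq ?_) (sum_gain_sq_le_sum hM.pos hc0))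
    simp [varSum, varTerm]
  have hT0 : 0 < T := lt_of_lt_of_le (by positivity) hTN
  have hsmall : 4 * chiVar / T < min η (1 - η) := by
    rw [div_lt_iff₀ hT0]
    have h1 : 4 * chiVar / (a * min η (1 - η)) < N := by linarith
    rw [div_lt_iff₀ (by positivity)] at h1
    nlinarith
  obtain ⟨hr0, hr1, -⟩ := hM.radius_sq_bounds hc0 (restr x f + coordMap e z) hT0 hT
    (hsmall.trans_le (min_le_left _ _)) (hsmall.trans_le (min_le_right _ _))
  set r := radius P W x c η (restr x f + coordMap e z) with hr
  have herr := hM.norm_restr_sub_postMean_sq_le hc0 f z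
  have h2 := hG.sum_gain_sq_mul_le hS (by omega) hc.1 hc0
  rw [← hCV, ← hN] at h2
  have h3 := (biasSum_two_le hp hM.pos (coef x e f) hc0).trans hb
  have hMM0 : 0 ≤ M := le_trans (by positivity) hMM
  have hM2 : 2 * Q / a < M ^ 2 := by
    have h4 : √(2 * Q / a) < M := by linarith
    rwa [Real.sqrt_lt' (lt_of_le_of_lt (Real.sqrt_nonneg _) h4)] at h4
  rw [div_lt_iff₀ ha0] at hM2
  have hlt : ‖restr x f - postMean P W x c (restr x f + coordMap e z)‖ ^ 2 < (M * r) ^ 2 := by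
    have h5 : ‖restr x f - postMean P W x c (restr x f + coordMap e z)‖ ^ 2 ≤ Q * N := by
      rw [hQ]; linarith
    have h6 : M ^ 2 * (a * N / 2) ≤ M ^ 2 * r ^ 2 :=
      mul_le_mul_of_nonneg_left (by linarith) (sq_nonneg _)
    rw [mul_pow]
    nlinarith
  exact lt_of_pow_lt_pow_left₀ 2 (mul_nonneg hMM0 hr0) hlt

lemma sobolevNorm_zero_eq {X : Type*} {n : ℕ} (x : Fin n → X)
    (e : OrthonormalBasis (Fin n) ℝ (Vec n)) (f : X → ℝ) :
    sobolevNorm x e 0 f = √(1 / (n : ℝ)) * ‖restr x f‖ := by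
  unfold sobolevNorm coef
  simp only [mul_zero, Real.rpow_zero, one_mul]
  rw [e.sum_sq_inner_right, Real.sqrt_mul (by positivity), Real.sqrt_sq (norm_nonneg _)]

/-- A bound on the diameter of a union of credible balls, on the good event. -/
lemma exists_scaledDiam_le {m δlo δhi K M η : ℝ} (hm : 1 < m) (hδ : 0 < δlo) (hδhi : 0 < δhi)
    (hK : 0 < K) (hMM : 0 < M) (hη : 0 < η) (hη1 : η < 1) :
    ∃ D N₀ : ℝ, 0 < D ∧
      ∀ {X Ω : Type*} [MeasurableSpace Ω] {n : ℕ} {P : Measure Ω} [IsProbabilityMeasure P]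
        {W : X → Ω → ℝ} {x : Fin n → X} {e : OrthonormalBasis (Fin n) ℝ (Vec n)}
        {lam : Fin n → ℝ} {δ Q : ℝ} {p : ℕ} (f : X → ℝ) (z : Fin n → ℝ) (S : Set ℝ)
        (C : Set (X → ℝ)),
        EigenModel P W x e lam → Spectrum m δlo δhi lam → 2 ≤ n → p ≤ 2 →
        GoodNoise m p δ lam (coef x e f) z → 0 ≤ Q →
        (∀ c ∈ S, c ∈ scaleInterval m n ∧ 1 ≤ effDim m n c ∧ N₀ ≤ effDim m n c ∧
          effDim m n c ≤ K * Q ∧ biasSum p lam (coef x e f) c ≤ K * Q) →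
        (∀ g ∈ C, ∃ c ∈ S, g ∈ ballSet P W x M η c (restr x f + coordMap e z)) →
        scaledDiam x e C ≤ ENNReal.ofReal (D * √(Q / n)) := by
  set CV := (1 + Real.log (1 + δhi) + 2 * m + δhi ^ 2) * 6 with hCV
  have hCV0 : 0 < CV := by
    have : 0 ≤ Real.log (1 + δhi) := Real.log_nonneg (by linarith)
    positivity
  set a := (δlo / (1 + δlo)) ^ 2 / 4 with ha
  have ha0 : 0 < a := by positivity
  set CT := (1 + δhi) * (2 + 2 ^ m / (m - 1)) with hCT
  have hm1 : 0 < m - 1 := by linarith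
  have hCT0 : 0 < CT := by positivity
  have hmin : 0 < min η (1 - η) := lt_min hη (by linarith)
  have hchi := chiVar_nonneg
  -- The first summand bounds the enlarged radius and the second the estimation error, both in units
  -- of `√Q`. Passing through `f` doubles the sum.
  set D := M * √(2 * CT * K) + √(2 * K + 2 * (CV + 3) * K) with hD
  refine ⟨2 * D, 4 * chiVar / (a * min η (1 - η)) + 1, by positivity, ?_⟩
  intro X Ω _ n P _ W x e lam δ Q p f z S C hM hS hn hp hG hQ hSc hC
  have key : ∀ g ∈ C, ‖restr x g - restr x f‖ ≤ D * √Q := by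
    intro g hg
    obtain ⟨c, hcS, hgc⟩ := hC g hg
    obtain ⟨hc, hN1, hN₀, hNQ, hbQ⟩ := hSc c hcS
    have hc0 := scale_pos hn hc
    set N := effDim m n c with hN
    set T := ∑ i, c * lam i / (1 + c * lam i) with hT
    have hTN : a * N ≤ T := by
      have h1 := hS.varSum_ge 2 hc0 hN1 (effDim_le_of_le hm.le (by omega) hc0 hc.2)
      refine h1.trans (le_trans (le_of_eq ?_) (sum_gain_sq_le_sum hM.pos hc0))
      simp [varSum, varTerm]
    have hT0 : 0 < T := lt_of_lt_of_le (by positivity) hTN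
    have hsmall : 4 * chiVar / T < min η (1 - η) := by
      rw [div_lt_iff₀ hT0]
      have h1 : 4 * chiVar / (a * min η (1 - η)) < N := by linarith
      rw [div_lt_iff₀ (by positivity)] at h1
      nlinarith
    obtain ⟨hr0, -, hr2⟩ := hM.radius_sq_bounds hc0 (restr x f + coordMap e z) hT0 hT
      (hsmall.trans_le (min_le_left _ _)) (hsmall.trans_le (min_le_right _ _))
    have hr3 : radius P W x c η (restr x f + coordMap e z) ≤ √(2 * CT * K) * √Q := by
      rw [← Real.sqrt_mul (by positivity)]
      refine Real.le_sqrt_of_sq_le (hr2.trans ?_)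
      have h1 := hS.sum_gain_le hm hc0 (show 0 < n by omega)
      rw [← hCT, ← hT, ← hN] at h1
      have h2 : CT * N ≤ CT * (K * Q) := by gcongr
      linarith
    have herr := hM.norm_restr_sub_postMean_sq_le hc0 f z
    have h2 := hG.sum_gain_sq_mul_le hS (by omega) hc.1 hc0
    rw [← hCV, ← hN] at h2
    have h3 := (biasSum_two_le hp hM.pos (coef x e f) hc0).trans hbQ
    have h4 : ‖restr x f - postMean P W x c (restr x f + coordMap e z)‖ ≤
        √(2 * K + 2 * (CV + 3) * K) * √Q := by
      rw [← Real.sqrt_mul (by positivity)]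
      refine Real.le_sqrt_of_sq_le (herr.trans ?_)
      have h5 : (CV + 3) * N ≤ (CV + 3) * (K * Q) := by gcongr
      linarith
    have h6 : ‖restr x g - postMean P W x c (restr x f + coordMap e z)‖ <
      M * radius P W x c η (restr x f + coordMap e z) := hgc
    have h7 := norm_sub_le_norm_sub_add_norm_sub (restr x g)
      (postMean P W x c (restr x f + coordMap e z)) (restr x f)
    rw [norm_sub_rev (postMean P W x c _) (restr x f)] at h7
    have h8 := mul_le_mul_of_nonneg_left hr3 hMM.le
    rw [hD, add_mul]
    linarith
  unfold scaledDiam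
  refine iSup₂_le fun g hg => iSup₂_le fun h hh => ENNReal.ofReal_le_ofReal ?_
  rw [sobolevNorm_zero_eq]
  have h1 : restr x (g - h) = restr x g - restr x h := by
    ext i; simp [restr]
  have h2 := norm_sub_le_norm_sub_add_norm_sub (restr x g) (restr x f) (restr x h)
  rw [norm_sub_rev (restr x f)] at h2
  have h3 := key g hg
  have h4 := key h hh
  have hn0 : (0 : ℝ) < n := by positivity
  have h5 : √(Q / n) = √(1 / (n : ℝ)) * √Q := by
    rw [← Real.sqrt_mul (by positivity)]; congr 1; ring
  rw [h1, h5]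
  have h6 := mul_le_mul_of_nonneg_left (show ‖restr x g - restr x h‖ ≤ 2 * D * √Q by linarith)
    (Real.sqrt_nonneg (1 / (n : ℝ)))
  linarith

/-! ### Uniform probability statements -/

lemma tendsto_log_rpow_atTop {m : ℝ} (hm : 1 ≤ m) :
    Tendsto (fun n : ℕ => Real.log n ^ (1 / m)) atTop atTop :=
  (tendsto_rpow_atTop (by positivity)).comp
    (Real.tendsto_log_atTop.comp tendsto_natCast_atTop_atTop)

section Uniform

variable {X : Type*} {x : ∀ n : ℕ, Fin n → X} {e : ∀ n : ℕ, OrthonormalBasis (Fin n) ℝ (Vec n)}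
  {lam : ∀ n : ℕ, Fin n → ℝ} {m δlo δhi δ : ℝ} {p : ℕ} {C : ∀ n : ℕ, Vec n → Set (X → ℝ)}

lemma uniformCoverage_of_goodNoise {F : ∀ _ : ℕ, Set (X → ℝ)} (hm : 1 ≤ m) (hp : p ≤ 2)
    (hδ : 0 < δ) (hS : ∀ n, Spectrum m δlo δhi (lam n)) (hF : ∀ n, (F n).Nonempty)
    (h : ∀ᶠ n in atTop, ∀ f ∈ F n, ∀ z, GoodNoise m p δ (lam n) (coef (x n) (e n) f) z →
      f ∈ C n (restr (x n) f + coordMap (e n) z)) : UniformCoverage x F C := by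
  obtain ⟨B, hB⟩ := Spectrum.stdPi_not_goodNoise_le (m := m) (δlo := δlo) (δhi := δhi) p hp hδ
  have hlim : Tendsto (fun n : ℕ => (1 : ℝ≥0∞) - ENNReal.ofReal (B / Real.log n ^ (1 / m))) atTop
      (𝓝 1) := by
    have h1 := ENNReal.tendsto_ofReal ((tendsto_log_rpow_atTop hm).const_div_atTop B)
    have h2 := ENNReal.Tendsto.sub (tendsto_const_nhds (x := (1 : ℝ≥0∞)) (f := atTop)) h1
      (Or.inl ENNReal.one_ne_top)
    simpa using h2
  refine tendsto_of_tendsto_of_tendsto_of_le_of_le' hlim tendsto_const_nhds ?_ ?_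
  · filter_upwards [h, eventually_ge_atTop 2] with n hn hn2
    refine le_iInf₂ fun f hf => ?_
    rw [tsub_le_iff_right, dataLaw_apply (x n) f (e n)]
    calc (1 : ℝ≥0∞) = stdPi n Set.univ := measure_univ.symm
      _ ≤ stdPi n ({z | restr (x n) f + coordMap (e n) z ∈ {y | f ∈ C n y}} ∪
          {z | ¬ GoodNoise m p δ (lam n) (coef (x n) (e n) f) z}) := by
            refine measure_mono fun z _ => ?_
            by_cases hz : GoodNoise m p δ (lam n) (coef (x n) (e n) f) z
            · exact Or.inl (hn f hf z hz)
            · exact Or.inr hz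
      _ ≤ _ := (measure_union_le _ _).trans (add_le_add le_rfl
        (hB n (lam n) (coef (x n) (e n) f) hn2 (hS n)))
  · refine Eventually.of_forall fun n => ?_
    -- An infimum over the empty class would be `∞`, so the upper bound 1 needs a member of the
    -- class.
    obtain ⟨f, hf⟩ := hF n
    refine (iInf₂_le f hf).trans ?_
    rw [dataLaw_apply (x n) f (e n)]
    exact prob_le_one

lemma uniformDiameterRate_of_goodNoise {α : ℝ} (hm : 1 ≤ m) (hp : p ≤ 2) (hδ : 0 < δ)
    (hS : ∀ n, Spectrum m δlo δhi (lam n))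
    (h : ∀ R : ℝ, 0 < R → ∃ K : ℝ, 0 < K ∧ ∀ᶠ n : ℕ in atTop, ∀ f ∈ smoothClass (x n) (e n) α R,
      ∀ z, GoodNoise m p δ (lam n) (coef (x n) (e n) f) z →
      scaledDiam (x n) (e n) (C n (restr (x n) f + coordMap (e n) z)) ≤
        ENNReal.ofReal (K * (n : ℝ) ^ (-α / (1 + 2 * α)))) : UniformDiameterRate x e α C := by
  intro R hR ε hε
  obtain ⟨B, hB⟩ := Spectrum.stdPi_not_goodNoise_le (m := m) (δlo := δlo) (δhi := δhi) p hp hδ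
  obtain ⟨K, hK, hev⟩ := h R hR
  refine ⟨K, hK, ?_⟩
  have hlim := (tendsto_log_rpow_atTop hm).const_div_atTop B
  filter_upwards [hev, eventually_ge_atTop 2, hlim.eventually (eventually_le_nhds hε)]
    with n hn hn2 hnε f hf
  rw [dataLaw_apply (x n) f (e n)]
  refine (measure_mono fun z hz => ?_).trans ((hB n (lam n) (coef (x n) (e n) f) hn2 (hS n)).trans
    (ENNReal.ofReal_le_ofReal hnε))
  intro hgood
  exact absurd (hn f hf z hgood) (not_le.mpr hz)

end Uniform

/-! ### Comparison of the criterion with its expectation -/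

/-- The constant of the good event is a third of the one in `Spectrum.varSum_ge`, and it is also
below 1/3. -/
lemma GoodNoise.abs_noise_le {m δlo δhi : ℝ} {p n : ℕ} {lam f z : Fin n → ℝ}
    (h : GoodNoise m p ((δlo / (1 + δlo)) ^ 2 / 12) lam f z) (hS : Spectrum m δlo δhi lam)
    (hn : 2 ≤ n) {c : ℝ} (hc : c ∈ scaleInterval m n) (hN1 : 1 ≤ effDim m n c) :
    |noise p lam f c z| ≤ (biasSum p lam f c + varSum p lam c) / 3 := by
  have hc0 := scale_pos hn hc
  have hδ := hS.lo_pos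
  have h1 := hS.varSum_ge p hc0 hN1 (effDim_le_of_le hS.one_le (by omega) hc0 hc.2)
  have h2 := biasSum_nonneg p hS.lam_pos f hc0.le
  have h3 : (δlo / (1 + δlo)) ^ 2 ≤ 1 :=
    pow_le_one₀ (by positivity) ((div_le_one (by linarith)).mpr (by linarith))
  refine (h c hc.1).1.trans ?_
  nlinarith

/-- Each criterion, without its constant, lies between 2/3 and 4/3 of its expectation, whence the
factor 2. -/
lemma meanCrit_le_of_criterion_le {m δlo δhi b : ℝ} {p n : ℕ} {lam f z : Fin n → ℝ} {crit : ℝ → ℝ}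
    (h : GoodNoise m p ((δlo / (1 + δlo)) ^ 2 / 12) lam f z) (hS : Spectrum m δlo δhi lam)
    (hn : 2 ≤ n) (hlog : 1 ≤ Real.log n ^ (1 / m))
    (hcrit : ∀ c, 0 < c → crit c = b + (biasSum p lam f c + varSum p lam c + noise p lam f c z))
    {c c' : ℝ} (hc : c ∈ scaleInterval m n) (hc' : c' ∈ scaleInterval m n)
    (hle : crit c ≤ crit c') : meanCrit p 0 lam f c ≤ 2 * meanCrit p 0 lam f c' := by
  have h1 := abs_le.mp (h.abs_noise_le hS hn hc (hlog.trans (log_rpow_le_effDim hS.one_le hn hc.1)))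
  have h2 := abs_le.mp
    (h.abs_noise_le hS hn hc' (hlog.trans (log_rpow_le_effDim hS.one_le hn hc'.1)))
  rw [hcrit c (scale_pos hn hc), hcrit c' (scale_pos hn hc')] at hle
  unfold meanCrit
  rw [zero_div, zero_div]
  linarith [h1.1, h2.2]

/-! ### The bias over smoothness classes -/

/-- The shrinkage factor is at most a constant times `min 1 ((j / N) ^ (m * p))`. If `2 * α < m *
p`, this suppresses low frequencies enough for smoothness `α`. Hence the ranges `α < m / 2` for `p =
1` and `α < m` for `p = 2`. -/
lemma exists_biasSum_le_of_smooth {m δlo α R : ℝ} {p : ℕ} (hδ : 0 < δlo)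
    (hα : 0 < α) (hαm : 2 * α < m * p) (hR : 0 < R) :
    ∃ C : ℝ, 0 < C ∧ ∀ {X : Type*} {n : ℕ} {x : Fin n → X}
      {e : OrthonormalBasis (Fin n) ℝ (Vec n)} {lam : Fin n → ℝ} {δhi : ℝ} (f : X → ℝ) (c : ℝ),
      Spectrum m δlo δhi lam → 0 < n → 0 < c → f ∈ smoothClass x e α R →
      biasSum p lam (coef x e f) c ≤ C * (n * effDim m n c ^ (-(2 * α))) := by
  obtain ⟨C, hC, hsum⟩ := sum_hyperrectangle_le (s := 2 * α) (M := m * p) (by linarith) hαm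
  set D := max 1 (δlo⁻¹ ^ p) with hD
  have hD1 : 1 ≤ D := le_max_left _ _
  refine ⟨D * (R ^ 2 * (1 + C)), by positivity, fun {X n x e lam δhi} f c hS hn hc hf => ?_⟩
  have hn0 : (0 : ℝ) < n := by exact_mod_cast hn
  set N := effDim m n c with hN
  have hN0 : 0 < N := effDim_pos hc hn
  set F := coef x e f with hF
  set β : Fin n → ℝ := fun j => min 1 ((((j : ℝ) + 1) / N) ^ (m * p)) with hβ
  have hβ0 : ∀ j, 0 ≤ β j := fun j => le_min zero_le_one (by positivity)
  have hβ1 : ∀ j, β j ≤ 1 := fun j => min_le_left _ _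
  have hβ2 : ∀ j : Fin n, β j ≤ (((j : ℝ) + 1) / N) ^ (m * p) := fun j => min_le_right _ _
  have hb : ∀ j, ((1 + c * lam j) ^ p)⁻¹ ≤ D * β j := by
    intro j
    have hx := hS.snr_pos hc j
    have hj0 : (0 : ℝ) < (j : ℝ) + 1 := by positivity
    rw [hβ]
    simp only
    rw [mul_min_of_nonneg _ _ (by linarith), mul_one]
    refine le_min ((shrinkage_le_one hx.le).trans hD1) ?_
    have h1 := hS.snr_ge hc j
    rw [← hN] at h1
    have h2 : ((1 + c * lam j) ^ p)⁻¹ ≤ ((δlo * (N / ((j : ℝ) + 1)) ^ m) ^ p)⁻¹ := by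
      gcongr
      linarith
    refine h2.trans ?_
    rw [mul_pow, mul_inv, ← inv_pow, ← inv_pow, ← Real.inv_rpow (by positivity), inv_div,
      ← Real.rpow_natCast ((((j : ℝ) + 1) / N) ^ m), ← Real.rpow_mul (by positivity)]
    gcongr
    exact le_max_right _ _
  have hmain : ∑ j, F j ^ 2 * β j ≤ R ^ 2 * (1 + C) * (n * N ^ (-(2 * α))) := by
    have hNα : 0 ≤ n * N ^ (-(2 * α)) := by positivity
    rcases hf with hf | hf
    · have h1 : ∑ j : Fin n, ((j : ℝ) + 1) ^ (2 * α) * F j ^ 2 ≤ n * R ^ 2 := by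
        unfold sobolevNorm at hf
        rw [Real.sqrt_le_left hR.le, div_mul_eq_mul_div, one_mul, div_le_iff₀ hn0] at hf
        linarith
      have h2 : ∀ j : Fin n, F j ^ 2 * β j ≤
          ((j : ℝ) + 1) ^ (2 * α) * F j ^ 2 * N ^ (-(2 * α)) := by
        intro j
        have hj0 : (0 : ℝ) < (j : ℝ) + 1 := by positivity
        have h3 : β j ≤ (((j : ℝ) + 1) / N) ^ (2 * α) := by
          rcases le_total ((j : ℝ) + 1) N with hjN | hjN
          · exact (hβ2 j).trans (Real.rpow_le_rpow_of_exponent_ge (by positivity)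
              ((div_le_one hN0).mpr hjN) hαm.le)
          · exact (hβ1 j).trans (Real.one_le_rpow ((one_le_div hN0).mpr hjN) (by linarith))
        rw [Real.div_rpow hj0.le hN0.le, div_eq_mul_inv, ← Real.rpow_neg hN0.le] at h3
        nlinarith [mul_le_mul_of_nonneg_left h3 (sq_nonneg (F j))]
      refine (Finset.sum_le_sum fun j _ => h2 j).trans ?_
      rw [← Finset.sum_mul]
      calc _ ≤ n * R ^ 2 * N ^ (-(2 * α)) := by gcongr
        _ = R ^ 2 * 1 * (n * N ^ (-(2 * α))) := by ring
        _ ≤ _ := by gcongr; linarith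
    · have h1 : ∀ j : Fin n, F j ^ 2 ≤ n * R ^ 2 * ((j : ℝ) + 1) ^ (-1 - 2 * α) := by
        intro j
        have hj0 : (0 : ℝ) < (j : ℝ) + 1 := by positivity
        unfold hyperNorm at hf
        rw [Real.sqrt_le_left hR.le, div_mul_eq_mul_div, one_mul, div_le_iff₀ hn0] at hf
        have h2 := (le_ciSup (f := fun j : Fin n => ((j : ℝ) + 1) ^ (1 + 2 * α) * F j ^ 2)
          (Set.finite_range _).bddAbove j).trans hf
        rw [show -1 - 2 * α = -(1 + 2 * α) by ring, Real.rpow_neg hj0.le, ← div_eq_mul_inv,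
          le_div_iff₀ (by positivity)]
        linarith
      calc ∑ j, F j ^ 2 * β j
          ≤ ∑ j : Fin n, n * R ^ 2 * (((j : ℝ) + 1) ^ (-1 - 2 * α) * β j) := by
            refine Finset.sum_le_sum fun j _ => ?_
            have := mul_le_mul_of_nonneg_right (h1 j) (hβ0 j)
            linarith
        _ ≤ n * R ^ 2 * (C * N ^ (-(2 * α))) := by
            rw [← Finset.mul_sum]
            gcongr
            exact hsum n N β hN0 (fun j => ⟨hβ0 j, hβ1 j⟩) hβ2
        _ = R ^ 2 * C * (n * N ^ (-(2 * α))) := by ring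
        _ ≤ _ := by gcongr; linarith
  calc biasSum p lam F c ≤ ∑ j, D * (F j ^ 2 * β j) := by
        refine Finset.sum_le_sum fun j _ => ?_
        have := mul_le_mul_of_nonneg_left (hb j) (sq_nonneg (F j))
        linarith
    _ = D * ∑ j, F j ^ 2 * β j := by rw [Finset.mul_sum]
    _ ≤ D * (R ^ 2 * (1 + C) * (n * N ^ (-(2 * α)))) := by gcongr
    _ = _ := by ring

/-- The scale that balances squared bias and variance at smoothness level `α`. -/
noncomputable def oracleScale (m α : ℝ) (n : ℕ) : ℝ := ((n : ℝ) ^ (1 / (1 + 2 * α))) ^ m / n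

lemma effDim_oracleScale {m α : ℝ} {n : ℕ} (hm : 1 ≤ m) (hn : 0 < n) :
    effDim m n (oracleScale m α n) = (n : ℝ) ^ (1 / (1 + 2 * α)) := by
  have hn0 : (0 : ℝ) < n := by exact_mod_cast hn
  unfold effDim oracleScale
  rw [div_mul_cancel₀ _ hn0.ne', ← Real.rpow_mul (by positivity),
    mul_one_div_cancel (by linarith), Real.rpow_one]

lemma oracleScale_pos {m α : ℝ} {n : ℕ} (hn : 0 < n) : 0 < oracleScale m α n := by
  unfold oracleScale; positivity

/-- The factor 1/2 at the upper end also shows that the scale interval has room for a dyadic block.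
-/
lemma eventually_oracleScale_mem {m α : ℝ} (hm : 1 ≤ m) (hα : 0 < α) :
    ∀ᶠ n : ℕ in atTop, Real.log n / n ≤ oracleScale m α n ∧
      oracleScale m α n ≤ (n : ℝ) ^ (m - 1) / 2 := by
  have hθ : 0 < 1 / (1 + 2 * α) * m := by positivity
  have hθm : 1 / (1 + 2 * α) * m < m := by
    have : 1 / (1 + 2 * α) < 1 := by rw [div_lt_one (by positivity)]; linarith
    nlinarith
  have h1 := (isLittleO_log_rpow_atTop hθ).bound one_pos
  have h2 := (tendsto_rpow_atTop (sub_pos.mpr hθm)).eventually_ge_atTop 2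
  filter_upwards [tendsto_natCast_atTop_atTop.eventually h1,
    tendsto_natCast_atTop_atTop.eventually h2, eventually_ge_atTop 1] with n hn1 hn2 hn
  have hn0 : (0 : ℝ) < n := by exact_mod_cast hn
  unfold oracleScale
  rw [← Real.rpow_mul hn0.le]
  constructor
  · refine div_le_div_of_nonneg_right ?_ hn0.le
    rw [one_mul, Real.norm_eq_abs, Real.norm_eq_abs] at hn1
    exact (le_abs_self _).trans (hn1.trans (abs_of_nonneg (by positivity)).le)
  · have h3 : (n : ℝ) ^ (m - 1) / 2 * n = (n : ℝ) ^ m / 2 := by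
      rw [div_mul_eq_mul_div ((n : ℝ) ^ (m - 1)), ← Real.rpow_add_one hn0.ne', sub_add_cancel]
    rw [div_le_iff₀ hn0, h3, le_div_iff₀ two_pos]
    calc _ ≤ (n : ℝ) ^ (1 / (1 + 2 * α) * m) * (n : ℝ) ^ (m - 1 / (1 + 2 * α) * m) := by gcongr
      _ = _ := by rw [← Real.rpow_add hn0]; congr 1; ring

lemma exists_meanCrit_oracleScale_le {m δlo δhi α R l : ℝ} {p : ℕ} (hm : 1 ≤ m) (hδ : 0 < δlo)
    (hδhi : 0 < δhi) (hα : 0 < α) (hαm : 2 * α < m * p) (hR : 0 < R) (hl : 0 ≤ l)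
    (hlα : l = 0 ∨ 2 * α ≤ m) :
    ∃ C : ℝ, 0 < C ∧ ∀ {X : Type*} {n : ℕ} {x : Fin n → X}
      {e : OrthonormalBasis (Fin n) ℝ (Vec n)} {lam : Fin n → ℝ} (f : X → ℝ),
      Spectrum m δlo δhi lam → 0 < n → f ∈ smoothClass x e α R →
      meanCrit p l lam (coef x e f) (oracleScale m α n) ≤ C * (n : ℝ) ^ (1 / (1 + 2 * α)) := by
  obtain ⟨C, hC, hb⟩ := exists_biasSum_le_of_smooth (p := p) hδ hα hαm hR
  set CV := (1 + Real.log (1 + δhi) + 2 * m + δhi ^ 2) * 6 with hCV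
  have hCV0 : 0 < CV := by
    have : 0 ≤ Real.log (1 + δhi) := Real.log_nonneg (by linarith)
    positivity
  refine ⟨C + l + CV, by positivity, fun {X n x e lam} f hS hn hf => ?_⟩
  have hn0 : (0 : ℝ) < n := by exact_mod_cast hn
  have hn1 : (1 : ℝ) ≤ n := by exact_mod_cast hn
  have hc := oracleScale_pos (m := m) (α := α) hn
  have h1 := hb f _ hS hn hc hf
  have h2 := hS.varSum_le p hc hn
  rw [effDim_oracleScale hm hn] at h1 h2
  rw [← hCV] at h2
  have h3 : n * ((n : ℝ) ^ (1 / (1 + 2 * α))) ^ (-(2 * α)) = (n : ℝ) ^ (1 / (1 + 2 * α)) := by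
    rw [← Real.rpow_mul hn0.le]
    nth_rewrite 1 [← Real.rpow_one (n : ℝ)]
    rw [← Real.rpow_add hn0]
    congr 1
    field_simp
    ring
  rw [h3] at h1
  -- With `Q` the effective dimension at this scale, `1 / oracleScale = n / Q ^ m`; this is at most
  -- `Q` exactly when `2 * α ≤ m` (for `n > 1`).
  have h4 : l / oracleScale m α n ≤ l * (n : ℝ) ^ (1 / (1 + 2 * α)) := by
    rcases hlα with rfl | hlα
    · simp
    · rw [div_eq_mul_inv]
      refine mul_le_mul_of_nonneg_left ?_ hl
      unfold oracleScale
      rw [inv_div, ← Real.rpow_mul hn0.le, div_le_iff₀ (by positivity), ← Real.rpow_add hn0]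
      nth_rewrite 1 [← Real.rpow_one (n : ℝ)]
      refine Real.rpow_le_rpow_of_exponent_le hn1 ?_
      rw [← mul_one_add, div_mul_eq_mul_div, one_mul, one_le_div (by positivity)]
      linarith
  unfold meanCrit
  linarith

lemma sqrt_oracle_rate {α : ℝ} (hα : 0 < α) {n : ℕ} (hn : 0 < n) :
    √((n : ℝ) ^ (1 / (1 + 2 * α)) / n) = (n : ℝ) ^ (-α / (1 + 2 * α)) := by
  have hn0 : (0 : ℝ) < n := by exact_mod_cast hn
  nth_rewrite 2 [← Real.rpow_one (n : ℝ)]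
  rw [← Real.rpow_sub hn0, Real.sqrt_eq_rpow, ← Real.rpow_mul hn0.le]
  congr 1
  field_simp
  ring

/-! ### Empirical Bayes -/

lemma IsPolished.mono {n : ℕ} {L L' ρ : ℝ} {k₀ : ℕ} {f : Fin n → ℝ} (hL : L ≤ L')
    (h : IsPolished L ρ k₀ f) : IsPolished L' ρ k₀ f := fun k hk =>
  (h k hk).trans (mul_le_mul_of_nonneg_right hL (Finset.sum_nonneg fun _ _ => sq_nonneg _))

lemma coef_zero {X : Type*} {n : ℕ} (x : Fin n → X) (e : OrthonormalBasis (Fin n) ℝ (Vec n))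
    (j : Fin n) : coef x e 0 j = 0 := by
  have h : restr x (0 : X → ℝ) = 0 := rfl
  rw [coef, h, inner_zero_right]

lemma polishedClass_nonempty {X : Type*} {n : ℕ} (x : Fin n → X)
    (e : OrthonormalBasis (Fin n) ℝ (Vec n)) (L ρ : ℝ) (k₀ : ℕ) {d : ℝ} (hd : 0 ≤ d) :
    (polishedClass x e L ρ k₀ d).Nonempty := by
  refine ⟨0, fun k _ => ?_, ?_⟩
  · simp [coef_zero]
  · simp only [coef_zero]
    norm_num
    positivity

lemma Spectrum.varSum_pos {m δlo δhi c : ℝ} {n : ℕ} {lam : Fin n → ℝ}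
    (h : Spectrum m δlo δhi lam) (p : ℕ) (hc : 0 < c) (h1 : 1 ≤ effDim m n c)
    (hn : effDim m n c ≤ n) : 0 < varSum p lam c := by
  have h2 := h.varSum_ge p hc h1 hn
  have := h.lo_pos
  exact lt_of_lt_of_le (by positivity) h2

section EmpiricalBayes

variable {X Ω : Type*} [MeasurableSpace Ω] {P : Measure Ω} [IsProbabilityMeasure P]
  {W : X → Ω → ℝ} {x : ∀ n : ℕ, Fin n → X} {e : ∀ n : ℕ, OrthonormalBasis (Fin n) ℝ (Vec n)}
  {lam : ∀ n : ℕ, Fin n → ℝ} {m δlo δhi : ℝ} {p : ℕ} {crit : ∀ n : ℕ, Vec n → ℝ → ℝ}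

theorem exists_uniformCoverage_argmin (hm : 1 ≤ m) (hδ : 0 < δlo) (hδhi : 0 < δhi)
    (hM : ∀ n, EigenModel P W (x n) (e n) (lam n)) (hS : ∀ n, Spectrum m δlo δhi (lam n))
    (hp1 : 1 ≤ p) (hp : p ≤ 2)
    (hcrit : ∀ n (f : X → ℝ) (z : Fin n → ℝ), ∃ b, ∀ c, 0 < c →
      crit n (restr (x n) f + coordMap (e n) z) c = b + (biasSum p (lam n) (coef (x n) (e n) f) c +
        varSum p (lam n) c + noise p (lam n) (coef (x n) (e n) f) c z)) (L ρ : ℝ) (k₀ : ℕ) :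
    ∃ M₀ : ℝ, ∀ M, M₀ ≤ M → ∀ η, 0 < η → η < 1 → ∀ chat : ∀ n : ℕ, Vec n → ℝ,
      (∀ n, IsArgminEstimator (crit n) (scaleInterval m n) (chat n)) →
      UniformCoverage x (fun n => polishedClass (x n) (e n) L ρ k₀ 1)
        (fun n y => ballSet P W (x n) M η (chat n y) y) := by
  -- A reduction by 1/4 contradicts near minimality up to a factor 2, as the expected criterion is
  -- positive. Replacing `L` by `max L 1` only weakens the tail condition.
  obtain ⟨A, hA, hpol⟩ := exists_meanCrit_le (l := 0) (L := max L 1) (ρ := ρ) hm hδ hδhi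
    (le_max_right _ _) le_rfl k₀ hp1 (ε := 1 / 4) (by norm_num) (by norm_num)
  obtain ⟨M₀, -, hball⟩ := exists_forall_mem_ballSet hm hδ hδhi hA.le
  refine ⟨M₀, fun M hMM η hη hη1 chat hchat => ?_⟩
  obtain ⟨N₀, hN₀⟩ := hball M hMM η hη hη1
  refine uniformCoverage_of_goodNoise (e := e) (p := p) (δ := (δlo / (1 + δlo)) ^ 2 / 12) hm hp
    (by positivity) hS (fun n => polishedClass_nonempty _ _ _ _ _ zero_le_one) ?_
  filter_upwards [eventually_ge_atTop 2,
    (tendsto_log_rpow_atTop hm).eventually_ge_atTop (max (max 1 (k₀ : ℝ)) N₀)]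
    with n hn hlog f hf z hz
  obtain ⟨b, hb⟩ := hcrit n f z
  set y := restr (x n) f + coordMap (e n) z with hy
  obtain ⟨hcI, hmin⟩ := (hchat n).2 y
  set c := chat n y with hc
  have hc0 := scale_pos hn hcI
  have hlogN := hlog.trans (log_rpow_le_effDim hm hn hcI.1)
  have hN1 : 1 ≤ effDim m n c := (le_max_left _ _).trans ((le_max_left _ _).trans hlogN)
  have hNk : (k₀ : ℝ) ≤ effDim m n c := (le_max_right _ _).trans ((le_max_left _ _).trans hlogN)
  refine hN₀ f z (hM n) (hS n) hn hcI hp hN1 ((le_max_right _ _).trans hlogN) hz ?_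
  by_contra! hlt
  have hf2 : ∑ j, coef (x n) (e n) f j ^ 2 ≤ n := by simpa using hf.2
  obtain ⟨c', hcc', hc'n, hle⟩ := hpol n (lam n) (coef (x n) (e n) f) c (hS n)
    (IsPolished.mono (le_max_left _ _) hf.1) hf2 (by omega) hc0 hcI.2 hN1 hNk (by simpa using hlt)
  have hc'I : c' ∈ scaleInterval m n := ⟨hcI.1.trans hcc', hc'n⟩
  have h1 := meanCrit_le_of_criterion_le hz (hS n) hn
    ((le_max_left _ _).trans ((le_max_left _ _).trans hlog)) hb hcI hc'I (hmin hc'I)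
  have h2 := (hS n).varSum_pos p hc0 hN1 (effDim_le_of_le hm (by omega) hc0 hcI.2)
  have h3 := biasSum_nonneg p (hS n).lam_pos (coef (x n) (e n) f) hc0.le
  have h4 : 0 < meanCrit p 0 (lam n) (coef (x n) (e n) f) c := by
    unfold meanCrit
    rw [zero_div]
    linarith
  linarith

theorem uniformDiameterRate_argmin {α M η : ℝ} (hm : 1 < m) (hδ : 0 < δlo) (hδhi : 0 < δhi)
    (hM : ∀ n, EigenModel P W (x n) (e n) (lam n)) (hS : ∀ n, Spectrum m δlo δhi (lam n))
    (hp : p ≤ 2)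
    (hcrit : ∀ n (f : X → ℝ) (z : Fin n → ℝ), ∃ b, ∀ c, 0 < c →
      crit n (restr (x n) f + coordMap (e n) z) c = b + (biasSum p (lam n) (coef (x n) (e n) f) c +
        varSum p (lam n) c + noise p (lam n) (coef (x n) (e n) f) c z))
    (hα : 0 < α) (hαm : 2 * α < m * p) (hMM : 0 < M) (hη : 0 < η) (hη1 : η < 1)
    {chat : ∀ n : ℕ, Vec n → ℝ}
    (hchat : ∀ n, IsArgminEstimator (crit n) (scaleInterval m n) (chat n)) :
    UniformDiameterRate x e α (fun n y => ballSet P W (x n) M η (chat n y) y) := by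
  refine uniformDiameterRate_of_goodNoise (p := p) (δ := (δlo / (1 + δlo)) ^ 2 / 12) hm.le hp
    (by positivity) hS fun R hR => ?_
  obtain ⟨C, hC, horacle⟩ := exists_meanCrit_oracleScale_le hm.le hδ hδhi hα hαm hR le_rfl
    (Or.inl rfl)
  set a := (δlo / (1 + δlo)) ^ 2 / 4 with ha
  have ha0 : 0 < a := by positivity
  -- The expected criterion at the minimizer is at most `2 * C * Q`. It dominates the bias and `a`
  -- times the effective dimension, which gives the two entries of the maximum.
  obtain ⟨D, N₀, hD, hdiam⟩ := exists_scaledDiam_le (K := max (2 * C / a) (2 * C)) hm hδ hδhi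
    (by positivity) hMM hη hη1
  refine ⟨D, hD, ?_⟩
  filter_upwards [eventually_ge_atTop 2, eventually_oracleScale_mem hm.le hα,
    (tendsto_log_rpow_atTop hm.le).eventually_ge_atTop (max 1 N₀)] with n hn hmem hlog f hf z hz
  have hn0 : 0 < n := by omega
  obtain ⟨b, hb⟩ := hcrit n f z
  set y := restr (x n) f + coordMap (e n) z with hy
  obtain ⟨hcI, hmin⟩ := (hchat n).2 y
  set c := chat n y with hc
  have hc0 := scale_pos hn hcI
  have hlogN := hlog.trans (log_rpow_le_effDim hm.le hn hcI.1)
  have hN1 : 1 ≤ effDim m n c := (le_max_left _ _).trans hlogN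
  have hoI : oracleScale m α n ∈ scaleInterval m n :=
    ⟨hmem.1, hmem.2.trans (half_le_self (by positivity))⟩
  have h1 := meanCrit_le_of_criterion_le hz (hS n) hn ((le_max_left _ _).trans hlog) hb hcI hoI
    (hmin hoI)
  have h2 := horacle f (hS n) hn0 hf
  have h3 := biasSum_nonneg p (hS n).lam_pos (coef (x n) (e n) f) hc0.le
  have h4 := (hS n).varSum_ge p hc0 hN1 (effDim_le_of_le hm.le hn0 hc0 hcI.2)
  have hQ : 0 ≤ (n : ℝ) ^ (1 / (1 + 2 * α)) := by positivity
  set Q := (n : ℝ) ^ (1 / (1 + 2 * α)) with hQdef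
  have h5 : biasSum p (lam n) (coef (x n) (e n) f) c + varSum p (lam n) c ≤ 2 * C * Q := by
    rw [meanCrit, zero_div] at h1
    linarith
  rw [← ha] at h4
  rw [← sqrt_oracle_rate hα hn0]
  refine hdiam f z {c} _ (hM n) (hS n) hn hp hz hQ ?_ (fun g hg => ⟨c, rfl, hg⟩)
  rintro _ rfl
  refine ⟨hcI, hN1, (le_max_right _ _).trans hlogN, ?_, ?_⟩
  · have h6 : effDim m n c ≤ 2 * C / a * Q := by
      rw [div_mul_eq_mul_div, le_div_iff₀ ha0]
      nlinarith
    exact h6.trans (mul_le_mul_of_nonneg_right (le_max_left _ _) hQ)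
  · have h6 : 0 ≤ a * effDim m n c := by positivity
    exact (show _ ≤ 2 * C * Q by linarith).trans
      (mul_le_mul_of_nonneg_right (le_max_right _ _) hQ)

end EmpiricalBayes

/-! ### Quantiles -/

section Quantile

variable {μ : Measure ℝ} {a b p : ℝ}

lemma measure_Iic_eq_zero_of_lt (h : μ (Set.Icc a b)ᶜ = 0) {t : ℝ} (ht : t < a) :
    μ (Set.Iic t) = 0 :=
  measure_mono_null (t := (Set.Icc a b)ᶜ)
    (fun _ hs hs' => absurd (hs'.1.trans hs) (not_le.mpr ht)) h

lemma le_of_ofReal_le_measure_Iic (h : μ (Set.Icc a b)ᶜ = 0) (hp : 0 < p) {t : ℝ}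
    (ht : ENNReal.ofReal p ≤ μ (Set.Iic t)) : a ≤ t := by
  by_contra! hlt
  rw [measure_Iic_eq_zero_of_lt h hlt] at ht
  simp only [nonpos_iff_eq_zero, ENNReal.ofReal_eq_zero] at ht
  linarith

lemma measure_Iic_lt_of_lt_quantile (h : μ (Set.Icc a b)ᶜ = 0) (hp : 0 < p) {t : ℝ}
    (ht : t < quantile μ p) : μ (Set.Iic t) < ENNReal.ofReal p := by
  by_contra! hle
  exact absurd (csInf_le ⟨a, fun s hs => le_of_ofReal_le_measure_Iic h hp hs⟩ hle)
    (not_le.mpr ht)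

lemma ofReal_le_measure_Iic_right [IsProbabilityMeasure μ] (h : μ (Set.Icc a b)ᶜ = 0)
    (hp1 : p ≤ 1) : ENNReal.ofReal p ≤ μ (Set.Iic b) := by
  have h1 : μ (Set.Iic b) = 1 := by
    rw [← prob_compl_eq_zero_iff measurableSet_Iic]
    exact measure_mono_null (Set.compl_subset_compl.mpr fun _ hs => hs.2) h
  rw [h1]
  exact ENNReal.ofReal_le_one.mpr hp1

lemma ofReal_le_measure_Iic_of_quantile_lt [IsProbabilityMeasure μ] (h : μ (Set.Icc a b)ᶜ = 0)
    (hp1 : p ≤ 1) {t : ℝ} (ht : quantile μ p < t) : ENNReal.ofReal p ≤ μ (Set.Iic t) := by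
  obtain ⟨s, hs, hst⟩ := exists_lt_of_csInf_lt ⟨b, ofReal_le_measure_Iic_right h hp1⟩ ht
  exact le_trans hs (measure_mono (Set.Iic_subset_Iic.mpr hst.le))

lemma left_le_quantile [IsProbabilityMeasure μ] (h : μ (Set.Icc a b)ᶜ = 0) (hp : 0 < p)
    (hp1 : p ≤ 1) : a ≤ quantile μ p :=
  le_csInf ⟨b, ofReal_le_measure_Iic_right h hp1⟩
    fun _ hs => le_of_ofReal_le_measure_Iic h hp hs

lemma quantile_le_right [IsProbabilityMeasure μ] (h : μ (Set.Icc a b)ᶜ = 0) (hp : 0 < p)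
    (hp1 : p ≤ 1) : quantile μ p ≤ b :=
  csInf_le ⟨a, fun _ hs => le_of_ofReal_le_measure_Iic h hp hs⟩ (ofReal_le_measure_Iic_right h hp1)

lemma measure_Iio_quantile_le (h : μ (Set.Icc a b)ᶜ = 0) (hp : 0 < p) :
    μ (Set.Iio (quantile μ p)) ≤ ENNReal.ofReal p := by
  obtain ⟨u, hu, hlt, hlim⟩ := exists_seq_strictMono_tendsto (quantile μ p)
  rw [← iUnion_Iic_eq_Iio_of_lt_of_tendsto hlt hlim,
    Monotone.measure_iUnion fun i j hij => Set.Iic_subset_Iic.mpr (hu.monotone hij)]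
  exact iSup_le fun i => (measure_Iic_lt_of_lt_quantile h hp (hlt i)).le

/-- The inequality holds at every point to the right of the quantile and passes to the limit by
right continuity of the distribution function. -/
lemma le_measure_Iic_quantile [IsProbabilityMeasure μ] (h : μ (Set.Icc a b)ᶜ = 0)
    (hp1 : p ≤ 1) : ENNReal.ofReal p ≤ μ (Set.Iic (quantile μ p)) := by
  rw [← ofReal_cdf]
  refine ENNReal.ofReal_le_ofReal ?_
  have h1 : Tendsto (cdf μ) (𝓝[>] (quantile μ p)) (𝓝 (cdf μ (quantile μ p))) :=
    ((cdf μ).right_continuous _).mono_left (nhdsWithin_mono _ Set.Ioi_subset_Ici_self)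
  refine ge_of_tendsto h1 ?_
  filter_upwards [self_mem_nhdsWithin] with t ht
  have h2 := ofReal_le_measure_Iic_of_quantile_lt h hp1 ht
  rw [← ofReal_cdf] at h2
  exact (ENNReal.ofReal_le_ofReal_iff (cdf_nonneg μ t)).mp h2

/-- Without atoms the open interval between the quantiles has mass at least `p₂ - p₁`; stated as a
sum, this avoids subtraction in `ℝ≥0∞`. -/
lemma ofReal_le_add_measure_Ioo_quantile [IsProbabilityMeasure μ] (h : μ (Set.Icc a b)ᶜ = 0)
    (hμ : ∀ t, μ {t} = 0) {p₁ p₂ : ℝ} (hp₁ : 0 < p₁) (hp₂ : p₂ ≤ 1) :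
    ENNReal.ofReal p₂ ≤ ENNReal.ofReal p₁ + μ (Set.Ioo (quantile μ p₁) (quantile μ p₂)) := by
  calc ENNReal.ofReal p₂ ≤ μ (Set.Iic (quantile μ p₂)) := le_measure_Iic_quantile h hp₂
    _ ≤ μ ((Set.Iio (quantile μ p₁) ∪ {quantile μ p₁}) ∪
          (Set.Ioo (quantile μ p₁) (quantile μ p₂) ∪ {quantile μ p₂})) := by
        refine measure_mono fun t (ht : t ≤ _) => ?_
        rcases lt_trichotomy t (quantile μ p₁) with h1 | h1 | h1
        · exact Or.inl (Or.inl h1)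
        · exact Or.inl (Or.inr h1)
        · rcases ht.lt_or_eq with h2 | h2
          · exact Or.inr (Or.inl ⟨h1, h2⟩)
          · exact Or.inr (Or.inr h2)
    _ ≤ (μ (Set.Iio (quantile μ p₁)) + μ {quantile μ p₁}) +
          (μ (Set.Ioo (quantile μ p₁) (quantile μ p₂)) + μ {quantile μ p₂}) :=
        (measure_union_le _ _).trans (add_le_add (measure_union_le _ _) (measure_union_le _ _))
    _ ≤ _ := by
        rw [hμ, hμ, add_zero, add_zero]
        exact add_le_add (measure_Iio_quantile_le h hp₁) le_rfl

end Quantile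

/-! ### Measures with density on an interval -/

section IntervalDensity

variable {a b K T : ℝ} {d : ℝ → ℝ≥0∞}

lemma withDensity_Icc_le {s : Set ℝ} (hs : MeasurableSet s) (hK : 0 ≤ K)
    (h : ∀ c ∈ Set.Icc a b, c ∈ s → d c ≤ ENNReal.ofReal K) :
    (volume.restrict (Set.Icc a b)).withDensity d s ≤ ENNReal.ofReal (K * (b - a)) := by
  rw [withDensity_apply _ hs, Measure.restrict_restrict hs]
  calc ∫⁻ c in s ∩ Set.Icc a b, d c ≤ ∫⁻ _ in s ∩ Set.Icc a b, ENNReal.ofReal K :=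
        setLIntegral_mono' (hs.inter measurableSet_Icc) fun c hc => h c hc.2 hc.1
    _ = ENNReal.ofReal K * volume (s ∩ Set.Icc a b) := by rw [setLIntegral_const]
    _ ≤ ENNReal.ofReal K * volume (Set.Icc a b) := by
        gcongr
        exact Set.inter_subset_right
    _ = _ := by rw [Real.volume_Icc, ENNReal.ofReal_mul hK]

lemma le_withDensity_Icc {u v : ℝ} (hK : 0 ≤ K) (hu : a ≤ u) (hv : v ≤ b)
    (h : ∀ c ∈ Set.Icc u v, ENNReal.ofReal K ≤ d c) :
    ENNReal.ofReal (K * (v - u)) ≤ (volume.restrict (Set.Icc a b)).withDensity d Set.univ := by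
  rw [withDensity_apply _ MeasurableSet.univ, Measure.restrict_univ]
  calc ENNReal.ofReal (K * (v - u)) = ∫⁻ _ in Set.Icc u v, ENNReal.ofReal K := by
        rw [setLIntegral_const, Real.volume_Icc, ENNReal.ofReal_mul hK]
    _ ≤ ∫⁻ c in Set.Icc u v, d c := setLIntegral_mono' measurableSet_Icc h
    _ ≤ _ := lintegral_mono_set (Set.Icc_subset_Icc hu hv)

end IntervalDensity

/-! ### The mean criterion of the hierarchical method -/

section MeanCrit

variable {m δlo δhi l : ℝ} {n : ℕ} {lam f : Fin n → ℝ}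

lemma measurable_meanCrit (p : ℕ) (l : ℝ) (lam f : Fin n → ℝ) :
    Measurable (meanCrit p l lam f) := by
  unfold meanCrit biasSum varSum varTerm
  refine Measurable.add (Measurable.add ?_ ?_) ?_
  · fun_prop
  · fun_prop
  · refine Finset.measurable_fun_sum _ fun j _ => ?_
    split_ifs <;> fun_prop

lemma Spectrum.le_meanCrit (hS : Spectrum m δlo δhi lam) (p : ℕ) {c : ℝ} (hc : 0 < c)
    (h1 : 1 ≤ effDim m n c) (hn : effDim m n c ≤ n) :
    (δlo / (1 + δlo)) ^ 2 / 4 * effDim m n c + biasSum p lam f c + l / c ≤ meanCrit p l lam f c := by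
  have h2 := hS.varSum_ge p hc h1 hn
  unfold meanCrit
  linarith

/-- The mean criterion is stable under multiplication of the scale by a bounded factor. -/
lemma exists_meanCrit_le_mul (hm : 1 ≤ m) (hδ : 0 < δlo) (hδhi : 0 < δhi) :
    ∃ C : ℝ, 0 < C ∧ ∀ {n p : ℕ} {lam f : Fin n → ℝ} {l c c' : ℝ}, Spectrum m δlo δhi lam →
      p ≤ 2 → 0 ≤ l → 0 < n → 0 < c → 0 < c' → c ≤ 2 * c' → c' ≤ 2 * c → 1 ≤ effDim m n c' →
      effDim m n c' ≤ n → meanCrit p l lam f c ≤ C * meanCrit p l lam f c' := by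
  set CV := (1 + Real.log (1 + δhi) + 2 * m + δhi ^ 2) * 6 with hCV
  have hCV0 : 0 < CV := by
    have : 0 ≤ Real.log (1 + δhi) := Real.log_nonneg (by linarith)
    positivity
  set a := (δlo / (1 + δlo)) ^ 2 / 4 with ha
  have ha0 : 0 < a := by positivity
  refine ⟨4 + 2 * CV / a, by positivity,
    fun {n p lam f l c c'} hS hp hl hn hc hc' hcc' hc'c h1 hN => ?_⟩
  have hb := biasSum_le_four_mul hp hS.lam_pos f hc.le hc'.le hc'c
  have hb0 := biasSum_nonneg p hS.lam_pos f hc'.le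
  have hv := hS.varSum_le p hc hn
  have hv' := hS.varSum_ge p hc' h1 hN
  rw [← hCV] at hv
  rw [← ha] at hv'
  have hN2 : effDim m n c ≤ 2 * effDim m n c' := by
    refine (effDim_mono hm hc.le hcc').trans ?_
    rw [effDim_mul two_pos.le hc'.le]
    have : (2 : ℝ) ^ (1 / m) ≤ 2 ^ (1 : ℝ) :=
      Real.rpow_le_rpow_of_exponent_le one_le_two ((div_le_one (by linarith)).mpr hm)
    rw [Real.rpow_one] at this
    gcongr
  have hll : l / c ≤ 4 * (l / c') := by
    have h2 : l / c ≤ l / (c' / 2) := div_le_div_of_nonneg_left hl (by positivity) (by linarith)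
    have h3 : l / (c' / 2) = 2 * (l / c') := by field_simp
    have h4 : 0 ≤ l / c' := by positivity
    linarith
  have hl0 : 0 ≤ l / c' := by positivity
  have hvv : varSum p lam c ≤ 2 * CV / a * varSum p lam c' := by
    rw [div_mul_eq_mul_div, le_div_iff₀ ha0]
    calc varSum p lam c * a ≤ CV * (2 * effDim m n c') * a := by
          gcongr
          exact hv.trans (by gcongr)
      _ = 2 * CV * (a * effDim m n c') := by ring
      _ ≤ _ := by gcongr
  have hv0 : 0 ≤ varSum p lam c' := (by positivity : 0 ≤ a * effDim m n c').trans hv'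
  have hq : 0 ≤ 2 * CV / a := by positivity
  unfold meanCrit
  nlinarith [mul_nonneg hq hb0, mul_nonneg hq hl0]

lemma abs_log_le {c : ℝ} (hm : 1 ≤ m) (hn : 2 ≤ n) (hlog : 1 ≤ Real.log n)
    (hc : c ∈ scaleInterval m n) : |Real.log c| ≤ m * Real.log n := by
  have hn0 : (0 : ℝ) < n := by positivity
  have hc0 := scale_pos hn hc
  rw [abs_le]
  constructor
  · have h1 : (n : ℝ)⁻¹ ≤ c := le_trans (by rw [inv_eq_one_div]; gcongr) hc.1
    have h2 := Real.log_le_log (by positivity) h1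
    rw [Real.log_inv] at h2
    nlinarith
  · have h2 := Real.log_le_log hc0 hc.2
    rw [Real.log_rpow hn0] at h2
    nlinarith

/-- The mean criterion dominates every multiple of `log n`. -/
lemma eventually_mul_log_le_meanCrit (hm : 1 ≤ m) (hδ : 0 < δlo) (hl : 0 < l) (T : ℝ) :
    ∀ᶠ n : ℕ in atTop, ∀ (p : ℕ) (lam f : Fin n → ℝ), Spectrum m δlo δhi lam →
      ∀ c ∈ scaleInterval m n, T * Real.log n ≤ meanCrit p l lam f c := by
  set a := (δlo / (1 + δlo)) ^ 2 / 4 with ha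
  have ha0 : 0 < a := by positivity
  have hθ : 0 < 1 / (m + 1) := by positivity
  have hmin : 0 < min a l := lt_min ha0 hl
  have h1 := (isLittleO_log_rpow_atTop hθ).bound (c := min a l / (|T| + 1)) (by positivity)
  filter_upwards [tendsto_natCast_atTop_atTop.eventually h1, eventually_ge_atTop 2,
    (tendsto_log_rpow_atTop hm).eventually_ge_atTop 1] with n hn1 hn hlog p lam f hS c hc
  have hn0 : (0 : ℝ) < n := by positivity
  have hlogn : 0 < Real.log n := Real.log_pos (by exact_mod_cast hn)
  have hc0 := scale_pos hn hc
  have hN1 := hlog.trans (log_rpow_le_effDim hm hn hc.1)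
  have h2 := hS.le_meanCrit (f := f) (l := l) p hc0 hN1 (effDim_le_of_le hm (by omega) hc0 hc.2)
  have h3 := biasSum_nonneg p hS.lam_pos f hc0.le
  rw [← ha] at h2
  have hlc : 0 < l / c := by positivity
  have haN : 0 < a * effDim m n c := by positivity
  have h4 : min a l * (n : ℝ) ^ (1 / (m + 1)) ≤ meanCrit p l lam f c := by
    have hx : 0 ≤ (n : ℝ) ^ (1 / (m + 1)) := by positivity
    -- At `n ^ (-(1/(m+1)))` the prior term `1 / c` and the effective dimension are both `n ^
    -- (1/(m+1))`. Below this scale the prior term is larger than that, above it the effective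
    -- dimension.
    rcases le_total c ((n : ℝ) ^ (-(1 / (m + 1)))) with h | h
    · have h5 : (n : ℝ) ^ (1 / (m + 1)) ≤ c⁻¹ := by
        rw [le_inv_comm₀ (by positivity) hc0, ← Real.rpow_neg hn0.le]
        exact h
      calc min a l * (n : ℝ) ^ (1 / (m + 1)) ≤ l * c⁻¹ := by
            gcongr
            exact min_le_right _ _
        _ ≤ _ := by rw [← div_eq_mul_inv]; linarith
    · have h5 : (n : ℝ) ^ (1 / (m + 1)) ≤ effDim m n c := by
        unfold effDim
        have h6 : (n : ℝ) ^ (1 / (m + 1)) = ((n : ℝ) ^ (-(1 / (m + 1))) * n) ^ (1 / m) := by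
          rw [← Real.rpow_add_one hn0.ne', ← Real.rpow_mul hn0.le]
          congr 1
          field_simp
          ring
        rw [h6]
        gcongr
      calc min a l * (n : ℝ) ^ (1 / (m + 1)) ≤ a * effDim m n c := by
            gcongr
            exact min_le_left _ _
        _ ≤ _ := by linarith
  refine le_trans ?_ h4
  rw [Real.norm_eq_abs, abs_of_pos hlogn, Real.norm_eq_abs,
    abs_of_nonneg (show 0 ≤ (n : ℝ) ^ (1 / (m + 1)) by positivity),
    div_mul_eq_mul_div, le_div_iff₀ (by positivity)] at hn1
  nlinarith [le_abs_self T]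

end MeanCrit

/-! ### Contraction of the posterior law of the scale -/

lemma scalePosterior_apply {X Ω : Type*} [MeasurableSpace Ω] {P : Measure Ω} {W : X → Ω → ℝ}
    {m κ l : ℝ} {n : ℕ} (x : Fin n → X) (y : Vec n) (s : Set ℝ) :
    scalePosterior P W x m κ l y s =
      (scalePosteriorAux P W x m κ l y Set.univ)⁻¹ * scalePosteriorAux P W x m κ l y s := rfl

section ScalePosterior

variable {X Ω : Type*} [MeasurableSpace Ω] {P : Measure Ω} [IsProbabilityMeasure P]
  {W : X → Ω → ℝ} {m δlo δhi κ l : ℝ}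

/-- On the scale of minus twice the logarithm, the prior factor `exp (-l / c)` becomes the term `2 *
l / c` of `meanCrit`, and the power of `c` a logarithm. -/
lemma EigenModel.marginal_mul_invGammaDensity {n : ℕ} {x : Fin n → X}
    {e : OrthonormalBasis (Fin n) ℝ (Vec n)} {lam : Fin n → ℝ} (hM : EigenModel P W x e lam)
    (hlam : ∀ j, 0 < lam j) (f : X → ℝ) (z : Fin n → ℝ) (κ l : ℝ) {c : ℝ} (hc : 0 < c) :
    marginal P W x c (restr x f + coordMap e z) * invGammaDensity κ l c =
      ENNReal.ofReal ((2 * Real.pi) ^ (-(n : ℝ) / 2) *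
        Real.exp (-(n + ∑ j, (z j ^ 2 - 1)) / 2) *
        Real.exp (-(meanCrit 1 (2 * l) lam (coef x e f) c + noise 1 lam (coef x e f) c z +
          2 * (1 + κ) * Real.log c) / 2)) := by
  rw [hM.marginal_eq hc, invGammaDensity, ← ENNReal.ofReal_mul (by positivity)]
  simp only [inner_restr_add]
  rw [likSum_add hlam _ _ hc, Real.rpow_def_of_pos hc, ← Real.exp_add, mul_assoc, mul_assoc,
    ← Real.exp_add, ← Real.exp_add]
  congr 3
  unfold meanCrit
  field_simp
  ring

/-- The density is at most `K exp (-E / 4)` where `E` is large. The total mass is at least `K exp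
(-C E c₀) / n`, since `E` is at most `C * E c₀` on a dyadic block comparable to `c₀` of length at
least `1 / n`. The remaining factor `exp (-E c₀)` beats all powers of `n` lost, because `E`
dominates multiples of `log n`. -/
lemma exists_scalePosterior_contraction (hm : 1 ≤ m) (hδ : 0 < δlo) (hδhi : 0 < δhi) (hκ : 0 < κ)
    (hl : 0 < l) :
    ∃ B : ℝ, 0 < B ∧ ∀ᶠ n : ℕ in atTop, ∀ (x : Fin n → X)
      (e : OrthonormalBasis (Fin n) ℝ (Vec n)) (lam : Fin n → ℝ) (f : X → ℝ) (z : Fin n → ℝ),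
      EigenModel P W x e lam → Spectrum m δlo δhi lam →
      GoodNoise m 1 ((δlo / (1 + δlo)) ^ 2 / 12) lam (coef x e f) z →
      IsProbabilityMeasure (scalePosterior P W x m κ l (restr x f + coordMap e z)) ∧
      scalePosterior P W x m κ l (restr x f + coordMap e z) (scaleInterval m n)ᶜ = 0 ∧
      (∀ t, scalePosterior P W x m κ l (restr x f + coordMap e z) {t} = 0) ∧
      ∀ c₀ ∈ scaleInterval m n, scalePosterior P W x m κ l (restr x f + coordMap e z)
        {c | B * meanCrit 1 (2 * l) lam (coef x e f) c₀ ≤ meanCrit 1 (2 * l) lam (coef x e f) c} ≤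
          ENNReal.ofReal (1 / n) := by
  obtain ⟨C, hC, hstable⟩ := exists_meanCrit_le_mul hm hδ hδhi
  have hl2 : 0 < 2 * l := by positivity
  -- The 4 undoes the quarter in the upper bound of the density; `C` cancels the lower bound on the
  -- total mass and the extra 1 leaves `exp (-E c₀)`.
  refine ⟨4 * C + 4, by positivity, ?_⟩
  filter_upwards [eventually_ge_atTop 2, eventually_oracleScale_mem hm one_pos,
    -- With this multiple, `2 * (1 + κ) * |log c| ≤ E / 6`. Together with the noise, at most `E /
    -- 3`, the perturbation is at most `E / 2`.
    eventually_mul_log_le_meanCrit (δhi := δhi) hm hδ hl2 (12 * (1 + κ) * m),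
    eventually_mul_log_le_meanCrit (δhi := δhi) hm hδ hl2 (m + 1),
    (tendsto_log_rpow_atTop hm).eventually_ge_atTop 1,
    (Real.tendsto_log_atTop.comp tendsto_natCast_atTop_atTop).eventually_ge_atTop 1]
    with n hn hmem hT hT' hlogN hlog x e lam f z hM hS hz
  have hn0 : (0 : ℝ) < n := by positivity
  have hn1 : 0 < n := by omega
  have hlog1 : 1 ≤ Real.log n := hlog
  set E := meanCrit 1 (2 * l) lam (coef x e f) with hE
  set y := restr x f + coordMap e z with hy
  set a := Real.log n / n with ha
  set b := (n : ℝ) ^ (m - 1) with hb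
  have ha0 : 0 < a := by positivity
  have hab : a ≤ b / 2 := hmem.1.trans hmem.2
  have hb0 : 0 < b := by positivity
  have hI : scaleInterval m n = Set.Icc a b := rfl
  set K := (2 * Real.pi) ^ (-(n : ℝ) / 2) * Real.exp (-(n + ∑ j, (z j ^ 2 - 1)) / 2) with hK
  have hK0 : 0 < K := by positivity
  set d : ℝ → ℝ≥0∞ := fun c => marginal P W x c y * invGammaDensity κ l c with hd
  have haux : scalePosteriorAux P W x m κ l y = (volume.restrict (Set.Icc a b)).withDensity d := rfl
  have hdev : ∀ c ∈ Set.Icc a b, |noise 1 lam (coef x e f) c z + 2 * (1 + κ) * Real.log c| ≤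
      E c / 2 := by
    intro c hc
    have hc0 := scale_pos hn hc
    have h1 := hz.abs_noise_le hS hn hc (hlogN.trans (log_rpow_le_effDim hm hn hc.1))
    have h2 := abs_log_le hm hn hlog1 hc
    have h3 := hT 1 lam (coef x e f) hS c hc
    rw [← hE] at h3
    have h4 : biasSum 1 lam (coef x e f) c + varSum 1 lam c ≤ E c := by
      have : 0 ≤ 2 * l / c := by positivity
      rw [hE]
      unfold meanCrit
      linarith
    refine (abs_add_le _ _).trans ?_
    rw [abs_mul, abs_of_pos (show 0 < 2 * (1 + κ) by positivity)]
    nlinarith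
  have hE0 : ∀ c ∈ Set.Icc a b, 0 ≤ E c := fun c hc => by
    have := (abs_nonneg _).trans (hdev c hc)
    linarith
  have hup : ∀ c ∈ Set.Icc a b, d c ≤ ENNReal.ofReal (K * Real.exp (-E c / 4)) := by
    intro c hc
    rw [hd]
    simp only
    rw [hy, hM.marginal_mul_invGammaDensity hS.lam_pos f z κ l (scale_pos hn hc), ← hE, ← hK]
    have := abs_le.mp (hdev c hc)
    refine ENNReal.ofReal_le_ofReal (mul_le_mul_of_nonneg_left (Real.exp_le_exp.mpr ?_) hK0.le)
    linarith
  have hlow : ∀ c ∈ Set.Icc a b, ENNReal.ofReal (K * Real.exp (-E c)) ≤ d c := by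
    intro c hc
    rw [hd]
    simp only
    rw [hy, hM.marginal_mul_invGammaDensity hS.lam_pos f z κ l (scale_pos hn hc), ← hE, ← hK]
    have := abs_le.mp (hdev c hc)
    refine ENNReal.ofReal_le_ofReal (mul_le_mul_of_nonneg_left (Real.exp_le_exp.mpr ?_) hK0.le)
    linarith
  have hmass : ∀ c₀ ∈ Set.Icc a b, ∃ u, (n : ℝ)⁻¹ ≤ u ∧
      ENNReal.ofReal (K * Real.exp (-(C * E c₀)) * u) ≤ scalePosteriorAux P W x m κ l y Set.univ := by
    intro c₀ hc₀
    have hc₀0 := scale_pos hn hc₀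
    -- The block from `u` to `2 * u` stays in the scale interval, has length `u`, and each of its
    -- points is within a factor 2 of `c₀`.
    refine ⟨min c₀ (b / 2), ?_, ?_⟩
    · have h1 : (n : ℝ)⁻¹ ≤ a := by rw [inv_eq_one_div, ha]; gcongr
      exact le_min (h1.trans hc₀.1) (h1.trans hab)
    set u := min c₀ (b / 2) with hu
    have hu0 : 0 < u := lt_min hc₀0 (by positivity)
    have hu1 : u ≤ c₀ := min_le_left _ _
    have hu2 : u ≤ b / 2 := min_le_right _ _
    have hu3 : c₀ ≤ 2 * u := by
      rcases min_choice c₀ (b / 2) with h | h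
      · rw [hu, h]; linarith
      · rw [hu, h]; linarith [hc₀.2]
    have hu4 : u = 2 * u - u := by ring
    rw [haux]
    conv_lhs => rw [hu4]
    have hau : a ≤ u := le_min hc₀.1 hab
    refine le_withDensity_Icc (by positivity) hau (by linarith) fun c hc => ?_
    refine le_trans ?_ (hlow c ⟨hau.trans hc.1, by linarith [hc.2]⟩)
    have h2 := hstable (f := coef x e f) hS one_le_two hl2.le hn1 (hu0.trans_le hc.1) hc₀0
      (by linarith [hc.2]) (by linarith [hc.1]) (hlogN.trans (log_rpow_le_effDim hm hn hc₀.1))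
      (effDim_le_of_le hm hn1 hc₀0 hc₀.2)
    rw [← hE] at h2
    gcongr
  have hpos : scalePosteriorAux P W x m κ l y Set.univ ≠ 0 := by
    obtain ⟨u, hu, hle⟩ := hmass a ⟨le_rfl, by linarith⟩
    have : 0 < u := lt_of_lt_of_le (by positivity) hu
    refine (lt_of_lt_of_le ?_ hle).ne'
    rw [ENNReal.ofReal_pos]
    positivity
  have hfin : scalePosteriorAux P W x m κ l y Set.univ ≠ ∞ := by
    rw [haux]
    refine ((withDensity_Icc_le (K := K) MeasurableSet.univ hK0.le fun c hc _ =>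
      (hup c hc).trans ?_).trans_lt ENNReal.ofReal_lt_top).ne
    refine ENNReal.ofReal_le_ofReal (mul_le_of_le_one_right hK0.le (Real.exp_le_one_iff.mpr ?_))
    linarith [hE0 c hc]
  have hac : ∀ s, volume.restrict (Set.Icc a b) s = 0 → scalePosterior P W x m κ l y s = 0 := by
    intro s hs
    rw [scalePosterior_apply, haux, withDensity_absolutelyContinuous _ _ hs, mul_zero]
  refine ⟨⟨?_⟩, ?_, ?_, fun c₀ hc₀ => ?_⟩
  · rw [scalePosterior_apply, ENNReal.inv_mul_cancel hpos hfin]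
  · refine hac _ ?_
    rw [hI, Measure.restrict_apply measurableSet_Icc.compl, Set.compl_inter_self, measure_empty]
  · exact fun t => hac _ (measure_singleton t)
  · obtain ⟨u, hu, hle⟩ := hmass c₀ hc₀
    have hu0 : 0 < u := lt_of_lt_of_le (by positivity) hu
    have h1 : scalePosteriorAux P W x m κ l y {c | (4 * C + 4) * E c₀ ≤ E c} ≤
        ENNReal.ofReal (K * Real.exp (-((4 * C + 4) * E c₀) / 4) * (b - a)) := by
      rw [haux]
      refine withDensity_Icc_le
        (measurableSet_le measurable_const (measurable_meanCrit _ _ _ _)) (by positivity)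
        fun c hc hcs => (hup c hc).trans ?_
      have : (4 * C + 4) * E c₀ ≤ E c := hcs
      gcongr
    have h2 := hT' 1 lam (coef x e f) hS c₀ hc₀
    rw [← hE] at h2
    rw [scalePosterior_apply]
    calc _ ≤ (ENNReal.ofReal (K * Real.exp (-(C * E c₀)) * u))⁻¹ *
          ENNReal.ofReal (K * Real.exp (-((4 * C + 4) * E c₀) / 4) * (b - a)) := by gcongr
      _ = ENNReal.ofReal ((K * Real.exp (-(C * E c₀)) * u)⁻¹ *
          (K * Real.exp (-((4 * C + 4) * E c₀) / 4) * (b - a))) := by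
          rw [← ENNReal.ofReal_inv_of_pos (by positivity), ← ENNReal.ofReal_mul (by positivity)]
      _ ≤ _ := by
          refine ENNReal.ofReal_le_ofReal ?_
          rw [inv_mul_le_iff₀ (by positivity)]
          have h3 : Real.exp (-((4 * C + 4) * E c₀) / 4) =
              Real.exp (-(C * E c₀)) * Real.exp (-E c₀) := by
            rw [← Real.exp_add]; congr 1; ring
          have h4 : Real.exp (-E c₀) ≤ (n : ℝ) ^ (-(m + 1)) := by
            rw [Real.rpow_def_of_pos hn0]
            gcongr
            linarith
          have h5 : (n : ℝ) ^ (-(m + 1)) * b = (n : ℝ)⁻¹ * (1 / n) := by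
            rw [hb, ← Real.rpow_add hn0, one_div, ← Real.rpow_neg_one, ← Real.rpow_add hn0]
            congr 1; ring
          have h6 : Real.exp (-E c₀) * (b - a) ≤ u * (1 / n) := by
            calc _ ≤ (n : ℝ) ^ (-(m + 1)) * b := by
                  gcongr
                  · linarith
                  · linarith
              _ = (n : ℝ)⁻¹ * (1 / n) := h5
              _ ≤ _ := by gcongr
          rw [h3]
          calc _ = K * Real.exp (-(C * E c₀)) * (Real.exp (-E c₀) * (b - a)) := by ring
            _ ≤ K * Real.exp (-(C * E c₀)) * (u * (1 / n)) := by gcongr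
            _ = _ := by ring

end ScalePosterior

/-! ### Hierarchical Bayes -/

/-- A minimizer up to a factor 2 exists without continuity or compactness, since the infimum is
positive. -/
lemma exists_forall_le_two_mul {s : Set ℝ} (hs : s.Nonempty) {E : ℝ → ℝ} {t : ℝ} (ht : 0 < t)
    (h : ∀ c ∈ s, t ≤ E c) : ∃ c₀ ∈ s, ∀ c ∈ s, E c₀ ≤ 2 * E c := by
  have h1 : t ≤ sInf (E '' s) := le_csInf (hs.image E) (by rintro _ ⟨c, hc, rfl⟩; exact h c hc)
  obtain ⟨_, ⟨c₀, hc₀, rfl⟩, hlt⟩ :=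
    exists_lt_of_csInf_lt (hs.image E) (show sInf (E '' s) < 2 * sInf (E '' s) by linarith)
  refine ⟨c₀, hc₀, fun c hc => ?_⟩
  have h2 : sInf (E '' s) ≤ E c :=
    csInf_le ⟨t, by rintro _ ⟨c, hc, rfl⟩; exact h c hc⟩ ⟨c, hc, rfl⟩
  linarith

section HierarchicalBayes

variable {X Ω : Type*} [MeasurableSpace Ω] {P : Measure Ω} [IsProbabilityMeasure P]
  {W : X → Ω → ℝ} {x : ∀ n : ℕ, Fin n → X} {e : ∀ n : ℕ, OrthonormalBasis (Fin n) ℝ (Vec n)}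
  {lam : ∀ n : ℕ, Fin n → ℝ} {m δlo δhi κ l : ℝ}

theorem exists_uniformCoverage_hbSet (hm : 1 ≤ m) (hδ : 0 < δlo) (hδhi : 0 < δhi)
    (hM : ∀ n, EigenModel P W (x n) (e n) (lam n)) (hS : ∀ n, Spectrum m δlo δhi (lam n))
    (hκ : 0 < κ) (hl : 0 < l) (L ρ : ℝ) (k₀ : ℕ) :
    ∃ M₀ : ℝ, ∀ M, M₀ ≤ M → ∀ η, 0 < η → η < 1 → ∀ p₁ p₂ : ℝ, 0 < p₁ → p₁ < p₂ → p₂ < 1 →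
      UniformCoverage x (fun n => polishedClass (x n) (e n) L ρ k₀ 1)
        (fun n y => hbSet P W (x n) m κ l p₁ p₂ M η y) := by
  obtain ⟨B, hB, hcontr⟩ := exists_scalePosterior_contraction (Ω := Ω) (X := X) (P := P) (W := W)
    hm hδ hδhi hκ hl
  have hl2 : 0 < 2 * l := by positivity
  -- If the bias dominates at `c`, then `E c₀ ≤ 2 * E c' ≤ E c / B`, so `c` belongs to the set of
  -- small posterior mass.
  obtain ⟨A, hA, hpol⟩ := exists_meanCrit_le (l := 2 * l) (L := max L 1) (ρ := ρ) hm hδ hδhi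
    (le_max_right _ _) hl2.le k₀ le_rfl (ε := min 1 (1 / (2 * B))) (by positivity)
    (min_le_left _ _)
  obtain ⟨M₀, -, hball⟩ := exists_forall_mem_ballSet hm hδ hδhi hA.le
  refine ⟨M₀, fun M hMM η hη hη1 p₁ p₂ hp₁ hp₁₂ hp₂ => ?_⟩
  obtain ⟨N₀, hN₀⟩ := hball M hMM η hη hη1
  refine uniformCoverage_of_goodNoise (e := e) (p := 1) (δ := (δlo / (1 + δlo)) ^ 2 / 12) hm
    one_le_two (by positivity) hS (fun n => polishedClass_nonempty _ _ _ _ _ zero_le_one) ?_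
  filter_upwards [eventually_ge_atTop 2, hcontr, eventually_oracleScale_mem hm one_pos,
    eventually_mul_log_le_meanCrit (δhi := δhi) hm hδ hl2 1,
    (tendsto_const_div_atTop_nhds_zero_nat (1 : ℝ)).eventually_lt_const (sub_pos.mpr hp₁₂),
    (tendsto_log_rpow_atTop hm).eventually_ge_atTop (max (max 1 (k₀ : ℝ)) N₀)]
    with n hn hμ hmem hElog hp hlog f hf z hz
  obtain ⟨hprob, hconc, hatom, hbad⟩ := hμ (x n) (e n) (lam n) f z (hM n) (hS n) hz
  set y := restr (x n) f + coordMap (e n) z with hy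
  set μ := scalePosterior P W (x n) m κ l y with hμdef
  set E := meanCrit 1 (2 * l) (lam n) (coef (x n) (e n) f) with hE
  have hlogn : 0 < Real.log n := Real.log_pos (by exact_mod_cast hn)
  obtain ⟨c₀, hc₀, hmin⟩ := exists_forall_le_two_mul (s := scaleInterval m n) (E := E)
    ⟨_, hmem.1, hmem.2.trans (half_le_self (by positivity))⟩ hlogn
    (fun c hc => by simpa using hElog 1 (lam n) (coef (x n) (e n) f) (hS n) c hc)
  have hf2 : ∑ j, coef (x n) (e n) f j ^ 2 ≤ n := by simpa using hf.2
  by_contra hnot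
  -- If no ball between the quantiles covers `f`, then all these scales have dominating bias. Their
  -- mass is then at most `1 / n`, although it is at least `p₂ - p₁`.
  have hsub : Set.Ioo (quantile μ p₁) (quantile μ p₂) ⊆
      {c | B * E c₀ ≤ E c} ∪ (scaleInterval m n)ᶜ := by
    intro c hc
    by_cases hcI : c ∈ scaleInterval m n
    swap
    · exact Or.inr hcI
    refine Or.inl ?_
    have hc0 := scale_pos hn hcI
    have hlogN := hlog.trans (log_rpow_le_effDim hm hn hcI.1)
    have hN1 : 1 ≤ effDim m n c := (le_max_left _ _).trans ((le_max_left _ _).trans hlogN)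
    have hNk : (k₀ : ℝ) ≤ effDim m n c :=
      (le_max_right _ _).trans ((le_max_left _ _).trans hlogN)
    have hlt : A * effDim m n c <
        biasSum 1 (lam n) (coef (x n) (e n) f) c + 2 * l / c := by
      by_contra! hle
      refine hnot ⟨c, hc.1, hc.2, hN₀ f z (hM n) (hS n) hn hcI one_le_two hN1
        ((le_max_right _ _).trans hlogN) hz ?_⟩
      have : 0 ≤ 2 * l / c := by positivity
      linarith
    obtain ⟨c', hcc', hc'n, hle⟩ := hpol n (lam n) (coef (x n) (e n) f) c (hS n)
      (IsPolished.mono (le_max_left _ _) hf.1) hf2 (by omega) hc0 hcI.2 hN1 hNk hlt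
    rw [← hE] at hle
    have h1 := hmin c' ⟨hcI.1.trans hcc', hc'n⟩
    have h2 : 0 ≤ E c :=
      hlogn.le.trans (by simpa using hElog 1 (lam n) (coef (x n) (e n) f) (hS n) c hcI)
    have h3 : E c' ≤ 1 / (2 * B) * E c := hle.trans (by gcongr; exact min_le_right _ _)
    rw [div_mul_eq_mul_div, le_div_iff₀ (by positivity)] at h3
    show B * E c₀ ≤ E c
    nlinarith
  have h1 : μ (Set.Ioo (quantile μ p₁) (quantile μ p₂)) ≤ ENNReal.ofReal (1 / n) := by
    refine (measure_mono hsub).trans ((measure_union_le _ _).trans ?_)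
    rw [hconc, add_zero]
    exact hbad c₀ hc₀
  have h2 := (ofReal_le_add_measure_Ioo_quantile hconc hatom hp₁ hp₂.le).trans
    (add_le_add le_rfl h1)
  rw [← ENNReal.ofReal_add hp₁.le (by positivity),
    ENNReal.ofReal_le_ofReal_iff (by positivity)] at h2
  linarith

theorem uniformDiameterRate_hbSet {α M η p₁ p₂ : ℝ} (hm : 1 < m) (hδ : 0 < δlo) (hδhi : 0 < δhi)
    (hM : ∀ n, EigenModel P W (x n) (e n) (lam n)) (hS : ∀ n, Spectrum m δlo δhi (lam n))
    (hκ : 0 < κ) (hl : 0 < l) (hα : 0 < α) (hαm : 2 * α < m) (hMM : 0 < M) (hη : 0 < η)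
    (hη1 : η < 1) (hp₁ : 0 < p₁) (hp₁₂ : p₁ < p₂) (hp₂ : p₂ < 1) :
    UniformDiameterRate x e α (fun n y => hbSet P W (x n) m κ l p₁ p₂ M η y) := by
  obtain ⟨B, hB, hcontr⟩ := exists_scalePosterior_contraction (Ω := Ω) (X := X) (P := P) (W := W)
    hm.le hδ hδhi hκ hl
  have hl2 : 0 < 2 * l := by positivity
  refine uniformDiameterRate_of_goodNoise (p := 1) (δ := (δlo / (1 + δlo)) ^ 2 / 12) hm.le
    one_le_two (by positivity) hS fun R hR => ?_
  obtain ⟨C, hC, horacle⟩ := exists_meanCrit_oracleScale_le (p := 1) hm.le hδ hδhi hα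
    (by simpa using hαm) hR hl2.le (Or.inr hαm.le)
  set a := (δlo / (1 + δlo)) ^ 2 / 4 with ha
  have ha0 : 0 < a := by positivity
  obtain ⟨D, N₀, hD, hdiam⟩ := exists_scaledDiam_le (K := max (B * C / a) (B * C)) hm hδ hδhi
    (by positivity) hMM hη hη1
  refine ⟨D, hD, ?_⟩
  filter_upwards [eventually_ge_atTop 2, hcontr, eventually_oracleScale_mem hm.le hα,
    (tendsto_const_div_atTop_nhds_zero_nat (1 : ℝ)).eventually_lt_const hp₁,
    (tendsto_const_div_atTop_nhds_zero_nat (1 : ℝ)).eventually_lt_const (sub_pos.mpr hp₂),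
    (tendsto_log_rpow_atTop hm.le).eventually_ge_atTop (max 1 N₀)]
    with n hn hμ hmem hnp₁ hnp₂ hlog f hf z hz
  have hn0 : 0 < n := by omega
  obtain ⟨hprob, hconc, -, hbad⟩ := hμ (x n) (e n) (lam n) f z (hM n) (hS n) hz
  set y := restr (x n) f + coordMap (e n) z with hy
  set μ := scalePosterior P W (x n) m κ l y with hμdef
  set E := meanCrit 1 (2 * l) (lam n) (coef (x n) (e n) f) with hE
  have hoI : oracleScale m α n ∈ scaleInterval m n :=
    ⟨hmem.1, hmem.2.trans (half_le_self (by positivity))⟩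
  have hbad' := hbad _ hoI
  have horacle' := horacle f (hS n) hn0 hf
  rw [← hE] at horacle'
  set Q := (n : ℝ) ^ (1 / (1 + 2 * α)) with hQdef
  have hQ : 0 ≤ Q := by positivity
  have hsmall : ∀ s : Set ℝ, (∀ c ∈ s, c ∈ scaleInterval m n → B * C * Q ≤ E c) →
      μ s ≤ ENNReal.ofReal (1 / n) := by
    intro s hs
    have hsub : s ⊆ {c | B * E (oracleScale m α n) ≤ E c} ∪ (scaleInterval m n)ᶜ := by
      intro c hc
      by_cases hcI : c ∈ scaleInterval m n
      · refine Or.inl (le_trans ?_ (hs c hc hcI))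
        rw [mul_assoc]
        gcongr
      · exact Or.inr hcI
    refine (measure_mono hsub).trans ((measure_union_le _ _).trans ?_)
    rw [hconc, add_zero]
    exact hbad'
  have hlower : ∀ c ∈ scaleInterval m n, 1 ≤ effDim m n c ∧ N₀ ≤ effDim m n c ∧
      a * effDim m n c ≤ E c ∧ biasSum 1 (lam n) (coef (x n) (e n) f) c ≤ E c := by
    intro c hcI
    have hc0 := scale_pos hn hcI
    have hlogN := hlog.trans (log_rpow_le_effDim hm.le hn hcI.1)
    have hN1 : 1 ≤ effDim m n c := (le_max_left _ _).trans hlogN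
    have h1 := (hS n).le_meanCrit (f := coef (x n) (e n) f) (l := 2 * l) 1 hc0 hN1
      (effDim_le_of_le hm.le hn0 hc0 hcI.2)
    have h2 := biasSum_nonneg 1 (hS n).lam_pos (coef (x n) (e n) f) hc0.le
    have h3 : 0 ≤ 2 * l / c := by positivity
    have h4 : 0 ≤ a * effDim m n c := by positivity
    rw [← ha, ← hE] at h1
    exact ⟨hN1, (le_max_right _ _).trans hlogN, by linarith, by linarith⟩
  rw [← sqrt_oracle_rate hα hn0]
  refine hdiam f z (Set.Ioo (quantile μ p₁) (quantile μ p₂)) _ (hM n) (hS n) hn one_le_two hz hQ ?_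
    (fun g ⟨c, hc1, hc2, hg⟩ => ⟨c, ⟨hc1, hc2⟩, hg⟩)
  rintro c ⟨hc1, hc2⟩
  have hcI : c ∈ scaleInterval m n :=
    ⟨(left_le_quantile hconc hp₁ (by linarith)).trans hc1.le,
      hc2.le.trans (quantile_le_right hconc (by linarith) hp₂.le)⟩
  have hc0 := scale_pos hn hcI
  obtain ⟨hN1, hN2, -, -⟩ := hlower c hcI
  refine ⟨hcI, hN1, hN2, ?_, ?_⟩
  -- The effective dimension increases in `c`, so a too large value makes all larger scales
  -- improbable. But more than the mass `1 - p₂` lies to the right of `c`.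
  · suffices h : effDim m n c ≤ B * C / a * Q from
      h.trans (mul_le_mul_of_nonneg_right (le_max_left _ _) hQ)
    by_contra! hlt
    rw [div_mul_eq_mul_div, div_lt_iff₀ ha0] at hlt
    have h1 := hsmall (Set.Ioi c) fun c' hc' hc'I => by
      have h2 := (hlower c' hc'I).2.2.1
      have h3 : effDim m n c ≤ effDim m n c' := effDim_mono hm.le hc0.le (le_of_lt hc')
      nlinarith
    have h2 := measure_Iic_lt_of_lt_quantile hconc (by linarith) hc2
    have h3 : (1 : ℝ≥0∞) < ENNReal.ofReal (p₂ + 1 / n) := by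
      calc (1 : ℝ≥0∞) = μ Set.univ := measure_univ.symm
        _ = μ (Set.Iic c ∪ Set.Ioi c) := by rw [Set.Iic_union_Ioi]
        _ ≤ μ (Set.Iic c) + μ (Set.Ioi c) := measure_union_le _ _
        _ < ENNReal.ofReal p₂ + ENNReal.ofReal (1 / n) :=
            ENNReal.add_lt_add_of_lt_of_le (h1.trans_lt ENNReal.ofReal_lt_top).ne h2 h1
        _ = _ := by rw [ENNReal.ofReal_add (by linarith) (by positivity)]
    rw [ENNReal.one_lt_ofReal] at h3
    linarith
  -- The bias decreases in `c`, so a too large value makes all smaller scales improbable. But at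
  -- least the mass `p₁` lies at or to the left of `c`.
  · suffices h : biasSum 1 (lam n) (coef (x n) (e n) f) c ≤ B * C * Q from
      h.trans (mul_le_mul_of_nonneg_right (le_max_right _ _) hQ)
    by_contra! hlt
    have h1 := hsmall (Set.Iic c) fun c' hc' hc'I => by
      have h2 := (hlower c' hc'I).2.2.2
      have h3 := biasSum_anti 1 (hS n).lam_pos (coef (x n) (e n) f) (scale_pos hn hc'I).le hc'
      linarith
    have h2 := (ofReal_le_measure_Iic_of_quantile_lt hconc (by linarith) hc1).trans h1
    rw [ENNReal.ofReal_le_ofReal_iff (by positivity)] at h2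
    linarith

end HierarchicalBayes

/-! ### The criteria of the empirical Bayes methods -/

section Criteria

variable {X : Type*} {n : ℕ} {U : Matrix (Fin n) (Fin n) ℝ}
  {e : OrthonormalBasis (Fin n) ℝ (Vec n)} {lam : Fin n → ℝ}

lemma exists_likCriterion_eq (hU : ∀ j, U *ᵥ (e j).ofLp = lam j • (e j).ofLp)
    (hlam : ∀ j, 0 < lam j) (x : Fin n → X) (f : X → ℝ) (z : Fin n → ℝ) :
    ∃ b, ∀ c, 0 < c → likCriterion U (restr x f + coordMap e z) c =
      b + (biasSum 1 lam (coef x e f) c + varSum 1 lam c + noise 1 lam (coef x e f) c z) := by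
  refine ⟨n + ∑ j, (z j ^ 2 - 1), fun c hc => ?_⟩
  rw [likCriterion_eq hU fun j => by have := mul_pos hc (hlam j); linarith]
  simp only [inner_restr_add]
  exact likSum_add hlam _ _ hc

lemma exists_riskCriterion_eq (hU : ∀ j, U *ᵥ (e j).ofLp = lam j • (e j).ofLp)
    (hlam : ∀ j, 0 < lam j) (x : Fin n → X) (f : X → ℝ) (z : Fin n → ℝ) :
    ∃ b, ∀ c, 0 < c → riskCriterion U (restr x f + coordMap e z) c =
      b + (biasSum 2 lam (coef x e f) c + varSum 2 lam c + noise 2 lam (coef x e f) c z) := by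
  refine ⟨∑ j, (z j ^ 2 - 1), fun c hc => ?_⟩
  rw [riskCriterion_eq hU fun j => by have := mul_pos hc (hlam j); linarith]
  simp only [inner_restr_add]
  exact riskSum_add hlam _ _ hc

end Criteria

/-! ### The theorem. -/

theorem theorem1 (m δlo : ℝ) (hm : 1 ≤ m) (hδlo : 0 < δlo) :
    ∃ d : ℝ, 0 < d ∧
    ∀ (X : Type*) (Ω : Type*) [MeasurableSpace Ω] (P : Measure Ω) [IsProbabilityMeasure P]
      -- the prior process, the design points, the eigenbasis and eigenvalues of `Uₙ`
      (W : X → Ω → ℝ) (x : ∀ n : ℕ, Fin n → X)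
      (e : ∀ n : ℕ, OrthonormalBasis (Fin n) ℝ (Vec n)) (lam : ∀ n : ℕ, Fin n → ℝ)
      (δhi κ l : ℝ),
      IsGaussianProcess W P →
      (∀ t, ∫ ω, W t ω ∂P = 0) →
      (∀ n j, unitCov P W (x n) *ᵥ (e n j).ofLp = lam n j • (e n j).ofLp) →
      (∀ n (j : Fin n), δlo * (n / ((j : ℝ) + 1) ^ m) ≤ lam n j ∧
        lam n j ≤ δhi * (n / ((j : ℝ) + 1) ^ m)) →
      0 < κ → 0 < l →
      -- coverage
      (∀ (L ρ : ℝ) (k₀ : ℕ), ∃ M₀ : ℝ, ∀ M : ℝ, M₀ ≤ M → ∀ η : ℝ, 0 < η → η < 1 →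
        (∀ chat : ∀ n : ℕ, Vec n → ℝ,
          (∀ n, IsArgminEstimator (likCriterion (unitCov P W (x n))) (scaleInterval m n)
            (chat n)) →
          UniformCoverage x (fun n => polishedClass (x n) (e n) L ρ k₀ d)
            (fun n y => ballSet P W (x n) M η (chat n y) y)) ∧
        (∀ chat : ∀ n : ℕ, Vec n → ℝ,
          (∀ n, IsArgminEstimator (riskCriterion (unitCov P W (x n))) (scaleInterval m n)
            (chat n)) →
          UniformCoverage x (fun n => polishedClass (x n) (e n) L ρ k₀ d)
            (fun n y => ballSet P W (x n) M η (chat n y) y)) ∧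
        (∀ p₁ p₂ : ℝ, 0 < p₁ → p₁ < p₂ → p₂ < 1 →
          UniformCoverage x (fun n => polishedClass (x n) (e n) L ρ k₀ d)
            (fun n y => hbSet P W (x n) m κ l p₁ p₂ M η y))) ∧
      -- diameter
      (1 < m → ∀ M : ℝ, 0 < M → ∀ η : ℝ, 0 < η → η < 1 →
        (∀ chat : ∀ n : ℕ, Vec n → ℝ,
          (∀ n, IsArgminEstimator (likCriterion (unitCov P W (x n))) (scaleInterval m n)
            (chat n)) →
          ∀ α : ℝ, 0 < α → α < m / 2 →
            UniformDiameterRate x e α (fun n y => ballSet P W (x n) M η (chat n y) y)) ∧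
        (∀ chat : ∀ n : ℕ, Vec n → ℝ,
          (∀ n, IsArgminEstimator (riskCriterion (unitCov P W (x n))) (scaleInterval m n)
            (chat n)) →
          ∀ α : ℝ, 0 < α → α < m →
            UniformDiameterRate x e α (fun n y => ballSet P W (x n) M η (chat n y) y)) ∧
        (∀ p₁ p₂ : ℝ, 0 < p₁ → p₁ < p₂ → p₂ < 1 →
          ∀ α : ℝ, 0 < α → α < m / 2 →
            UniformDiameterRate x e α
              (fun n y => hbSet P W (x n) m κ l p₁ p₂ M η y))) := by
  -- The energy bound is used only to keep the enlarged scale in the interval, where the threshold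
  -- of `exists_meanCrit_le` absorbs it; hence `d = 1` suffices.
  refine ⟨1, one_pos, ?_⟩
  intro X Ω _ P _ W x e lam δhi κ l hW hmean heig hlam hκ hl
  -- No sign is assumed for `δhi`; enlarging it to the maximum makes it positive and keeps the upper
  -- bound on the eigenvalues.
  have hδhi : 0 < max δhi δlo := lt_max_of_lt_right hδlo
  have hS : ∀ n, Spectrum m δlo (max δhi δlo) (lam n) := fun n =>
    { one_le := hm
      lo_pos := hδlo
      hi_pos := hδhi
      lower := fun j => (hlam n j).1
      upper := fun j => (hlam n j).2.trans
        (mul_le_mul_of_nonneg_right (le_max_left _ _) (by positivity)) }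
  have hM : ∀ n, EigenModel P W (x n) (e n) (lam n) := fun n =>
    ⟨hW, hmean, heig n, (hS n).lam_pos⟩
  have hlik := fun n => exists_likCriterion_eq (heig n) (hS n).lam_pos (x n)
  have hrisk := fun n => exists_riskCriterion_eq (heig n) (hS n).lam_pos (x n)
  constructor
  · intro L ρ k₀
    obtain ⟨M₁, h₁⟩ := exists_uniformCoverage_argmin hm hδlo hδhi hM hS le_rfl one_le_two hlik
      L ρ k₀
    obtain ⟨M₂, h₂⟩ := exists_uniformCoverage_argmin hm hδlo hδhi hM hS one_le_two le_rfl hrisk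
      L ρ k₀
    obtain ⟨M₃, h₃⟩ := exists_uniformCoverage_hbSet hm hδlo hδhi hM hS hκ hl L ρ k₀
    refine ⟨max (max M₁ M₂) M₃, fun M hMM η hη hη1 => ⟨?_, ?_, ?_⟩⟩
    · exact h₁ M ((le_max_left _ _).trans ((le_max_left _ _).trans hMM)) η hη hη1
    · exact h₂ M ((le_max_right _ _).trans ((le_max_left _ _).trans hMM)) η hη hη1
    · exact h₃ M ((le_max_right _ _).trans hMM) η hη hη1
  · intro hm1 M hMM η hη hη1
    refine ⟨fun chat hchat α hα hαm => ?_, fun chat hchat α hα hαm => ?_,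
      fun p₁ p₂ hp₁ hp₁₂ hp₂ α hα hαm => ?_⟩
    · exact uniformDiameterRate_argmin hm1 hδlo hδhi hM hS one_le_two hlik hα
        (by push_cast; linarith) hMM hη hη1 hchat
    · exact uniformDiameterRate_argmin hm1 hδlo hδhi hM hS le_rfl hrisk hα
        (by push_cast; linarith) hMM hη hη1 hchat
    · exact uniformDiameterRate_hbSet hm1 hδlo hδhi hM hS hκ hl hα (by linarith) hMM hη hη1 hp₁
        hp₁₂ hp₂
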